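/- Conventions. Simplicial model categories are tensored and cotensored over simplicial sets and satisfy Quillen's axiom (SM7); $\mathrm{Map}$ denotes simplicial mapping spaces. A model category is *combinatorial* if it is locally presentable and cofibrantly generated. Let $\mathcal I$ be an ordinary (locally small) category, let $\mathcal J$ be a small simplicial category, and let $\varphi:\mathcal J\to\mathcal I$ be a simplicial functor, where $\mathcal I$ is regarded as a simplicial category with discrete mapping spaces. A *simplicial Quillen presheaf* $\mathcal M$ on $\mathcal I$ is a pseudofunctor from $\mathcal I$ to the $(2,1)$-category of simplicial model categories, simplicial Quillen adjunctions $\alpha_!\dashv\alpha^*$ (in the direction of the left adjoints) and simplicial natural isomorphisms. Its total category $\int\mathcal M$ has as objects the pairs $(i,X)$ with $i\in\mathcal I$ and $X\in\mathcal M(i)$, and is a simplicial category over $\mathcal I$ with $$\mathrm{Map}\big((i,X),(i',Y)\big)=\coprod_{\alpha:i\to i'}\mathrm{Map}_{\mathcal M(i')}(\alpha_!X,Y).$$ Let $\mathrm{Sec}_{\mathcal J}(\mathcal M)$ be the category of simplicial functors $s:\mathcal J\to\int\mathcal M$ over $\mathcal I$ and simplicial natural transformations over $\mathcal I$; thus $s$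 has values $s(j)\in\mathcal M(\varphi(j))$ and a morphism $T:s\to t$ has components $T(j):s(j)\to t(j)$ in $\mathcal M(\varphi(j))$. It is enriched in simplicial sets, the $n$-simplices of $\mathrm{Map}(s,t)$ being the simplicially natural families of $n$-simplices of the spaces $\mathrm{Map}_{\mathcal M(\varphi(j))}(s(j),t(j))$, $j\in\mathcal J$. **Proposition.** Let $\mathcal M$ be a simplicial Quillen presheaf on $\mathcal I$ such that $\mathcal M(i)$ is combinatorial for every $i\in\mathcal I$. Then there is a model structure on $\mathrm{Sec}_{\mathcal J}(\mathcal M)$ (the *projective model structure*) such that: 1. with the enrichment above, it is a combinatorial simplicial model category; 2. a map $T$ is a weak equivalence (resp. a fibration) if and only if $T(j)$ is a weak equivalence (resp. a fibration) in $\mathcal M(\varphi(j))$ for every $j\in\mathcal J$; 3. the cofibrations are the maps having the left lifting property with respect to the maps that are levelwise both fibrations and weak equivalences; 4. it is transferred along free sections: for every $j\in\mathcal J$ the evaluation functor $\mathrm{Sec}_{\mathcal J}(\mathcal M)\to\mathcal M(\varphi(j))$, $s\mapsto s(j)$, has a left adjoint $X\mapsto s_{j,X}$, with $$s_{j,X}(j')\cong\coprod_{\alpha:\varphi(j)\to\varphi(j')}\mathrm{Map}^{\alpha}_{\mathcal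 J}(j,j')\otimes\alpha_!X$$ via the maps induced by the unit $X\to s_{j,X}(j)$ and the action of $\mathrm{Map}^{\alpha}_{\mathcal J}(j,j')$, where $\mathrm{Map}^{\alpha}_{\mathcal J}(j,j')\subseteq\mathrm{Map}_{\mathcal J}(j,j')$ is the preimage of $\alpha$. Moreover, if for every $j\in\mathcal J$ the trivial fibrations (resp. the fibrations) of $\mathcal M(\varphi(j))$ are the maps with the right lifting property with respect to a class $S_j$ of morphisms, then the trivial fibrations (resp. the fibrations) of $\mathrm{Sec}_{\mathcal J}(\mathcal M)$ are the maps with the right lifting property with respect to $\bigcup_{j\in\mathcal J}\{s_{j,X}\to s_{j,Y}\mid (X\to Y)\in S_j\}$. -/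

import Mathlib

universe w u u₁

open CategoryTheory MonoidalCategory Opposite Limits HomotopicalAlgebra

namespace SimplicialSections

section Simplices

/-- The `n`-simplex of a product of simplicial sets given by a pair of `n`-simplices. -/
def pair {K L : SSet.{w}} {n : SimplexCategoryᵒᵖ} (x : K.obj n) (y : L.obj n) : (K ⊗ L).obj n :=
  (x, y)

lemma map_id_apply (K : SSet.{w}) {n : SimplexCategoryᵒᵖ} (x : K.obj n) : K.map (𝟙 n) x = x := by
  rw [Functor.map_id_apply]

lemma map_comp_apply (K : SSet.{w}) {n m k : SimplexCategoryᵒᵖ} (θ : n ⟶ m) (θ' : m ⟶ k)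
    (x : K.obj n) : K.map (θ ≫ θ') x = K.map θ' (K.map θ x) := by
  rw [Functor.map_comp_apply]

variable {C : Type u} [EnrichedCategory SSet.{w} C]

/-- The `n`-simplex of `Map(X, X)` given by the identity of `X`. -/
def sId (X : C) (n : SimplexCategoryᵒᵖ) : (X ⟶[SSet.{w}] X).obj n :=
  (eId SSet.{w} X).app n PUnit.unit

/-- The composition (in diagrammatic order) of `n`-simplices of mapping spaces. -/
def sComp {X Y Z : C} {n : SimplexCategoryᵒᵖ} (f : (X ⟶[SSet.{w}] Y).obj n)
    (g : (Y ⟶[SSet.{w}] Z).obj n) : (X ⟶[SSet.{w}] Z).obj n :=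
  (eComp SSet.{w} X Y Z).app n (pair f g)

lemma sId_sComp {X Y : C} {n : SimplexCategoryᵒᵖ} (f : (X ⟶[SSet.{w}] Y).obj n) :
    sComp (sId X n) f = f :=
  ConcreteCategory.congr_hom (NatTrans.congr_app (e_id_comp SSet.{w} X Y) n) f

lemma sComp_sId {X Y : C} {n : SimplexCategoryᵒᵖ} (f : (X ⟶[SSet.{w}] Y).obj n) :
    sComp f (sId Y n) = f :=
  ConcreteCategory.congr_hom (NatTrans.congr_app (e_comp_id SSet.{w} X Y) n) f

lemma sComp_assoc {W X Y Z : C} {n : SimplexCategoryᵒᵖ} (f : (W ⟶[SSet.{w}] X).obj n)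
    (g : (X ⟶[SSet.{w}] Y).obj n) (h : (Y ⟶[SSet.{w}] Z).obj n) :
    sComp (sComp f g) h = sComp f (sComp g h) :=
  ConcreteCategory.congr_hom (NatTrans.congr_app (e_assoc SSet.{w} W X Y Z) n)
    (pair f (pair g h) :)

lemma map_sId (X : C) {m n : SimplexCategoryᵒᵖ} (θ : n ⟶ m) :
    (X ⟶[SSet.{w}] X).map θ (sId X n) = sId X m :=
  (NatTrans.naturality_apply (eId SSet.{w} X) θ PUnit.unit).symm

lemma map_sComp {X Y Z : C} {m n : SimplexCategoryᵒᵖ} (θ : n ⟶ m)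
    (f : (X ⟶[SSet.{w}] Y).obj n) (g : (Y ⟶[SSet.{w}] Z).obj n) :
    (X ⟶[SSet.{w}] Z).map θ (sComp f g) =
      sComp ((X ⟶[SSet.{w}] Y).map θ f) ((Y ⟶[SSet.{w}] Z).map θ g) :=
  (NatTrans.naturality_apply (eComp SSet.{w} X Y Z) θ (pair f g :)).symm

variable {D : Type u₁} [EnrichedCategory SSet.{w} D]

/-- The action of a simplicial functor on `n`-simplices of mapping spaces. -/
def sMap (F : EnrichedFunctor SSet.{w} C D) {X Y : C} {n : SimplexCategoryᵒᵖ}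
    (f : (X ⟶[SSet.{w}] Y).obj n) : (F.obj X ⟶[SSet.{w}] F.obj Y).obj n :=
  (F.map X Y).app n f

lemma sMap_sId (F : EnrichedFunctor SSet.{w} C D) (X : C) (n : SimplexCategoryᵒᵖ) :
    sMap F (sId X n) = sId (F.obj X) n :=
  ConcreteCategory.congr_hom (NatTrans.congr_app (F.map_id X) n) PUnit.unit

lemma sMap_sComp (F : EnrichedFunctor SSet.{w} C D) {X Y Z : C} {n : SimplexCategoryᵒᵖ}
    (f : (X ⟶[SSet.{w}] Y).obj n) (g : (Y ⟶[SSet.{w}] Z).obj n) :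
    sMap F (sComp f g) = sComp (sMap F f) (sMap F g) :=
  ConcreteCategory.congr_hom (NatTrans.congr_app (F.map_comp X Y Z) n) (pair f g :)

lemma map_sMap (F : EnrichedFunctor SSet.{w} C D) {X Y : C} {m n : SimplexCategoryᵒᵖ}
    (θ : n ⟶ m) (f : (X ⟶[SSet.{w}] Y).obj n) :
    (F.obj X ⟶[SSet.{w}] F.obj Y).map θ (sMap F f) = sMap F ((X ⟶[SSet.{w}] Y).map θ f) :=
  (NatTrans.naturality_apply (F.map X Y) θ f).symm

end Simplices

section Ordinary

variable {C : Type u} [Category.{w} C] [SimplicialCategory C]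

/-- The (degenerate) `n`-simplex of `Map(X, Y)` given by a morphism `X ⟶ Y`. -/
def sHomOf {X Y : C} (f : X ⟶ Y) (n : SimplexCategoryᵒᵖ) : (X ⟶[SSet.{w}] Y).obj n :=
  (eHomEquiv SSet.{w} f).app n PUnit.unit

lemma map_sHomOf {X Y : C} (f : X ⟶ Y) {m n : SimplexCategoryᵒᵖ} (θ : n ⟶ m) :
    (X ⟶[SSet.{w}] Y).map θ (sHomOf f n) = sHomOf f m :=
  (NatTrans.naturality_apply (eHomEquiv SSet.{w} f) θ PUnit.unit).symm

lemma sHomOf_id (X : C) (n : SimplexCategoryᵒᵖ) : sHomOf (𝟙 X) n = sId X n := by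
  simp only [sHomOf, sId, eHomEquiv_id]

lemma sHomOf_comp {X Y Z : C} (f : X ⟶ Y) (g : Y ⟶ Z) (n : SimplexCategoryᵒᵖ) :
    sHomOf (f ≫ g) n = sComp (sHomOf f n) (sHomOf g n) := by
  simp only [sHomOf, eHomEquiv_comp]
  rfl

lemma eHomWhiskerLeft_app (X : C) {Y Z : C} (g : Y ⟶ Z) {n : SimplexCategoryᵒᵖ}
    (f : (X ⟶[SSet.{w}] Y).obj n) :
    (eHomWhiskerLeft SSet.{w} X g).app n f = sComp f (sHomOf g n) := rfl

lemma eHomWhiskerRight_app {X Y : C} (f : X ⟶ Y) (Z : C) {n : SimplexCategoryᵒᵖ}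
    (g : (Y ⟶[SSet.{w}] Z).obj n) :
    (eHomWhiskerRight SSet.{w} f Z).app n g = sComp (sHomOf f n) g := rfl

lemma sHomOf_ext {X Y : C} {f g : X ⟶ Y} (h : ∀ n, sHomOf f n = sHomOf g n) : f = g := by
  apply (eHomEquiv SSet.{w}).injective
  ext n ⟨⟩
  exact h n

variable {D : Type u₁} [Category.{w} D] [SimplicialCategory D]

/-- The underlying ordinary functor of a simplicial functor. -/
def underlying (F : EnrichedFunctor SSet.{w} C D) : C ⥤ D where
  obj X := F.obj X
  map f := (eHomEquiv SSet.{w}).symm (eHomEquiv SSet.{w} f ≫ F.map _ _)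
  map_id X := by
    rw [eHomEquiv_id, F.map_id, ← eHomEquiv_id, Equiv.symm_apply_apply]
  map_comp f g := by
    apply (eHomEquiv SSet.{w}).injective
    simp only [Equiv.apply_symm_apply, eHomEquiv_comp, Category.assoc, F.map_comp]
    simp only [MonoidalCategory.tensorHom_comp_tensorHom_assoc]

lemma sHomOf_underlying_map (F : EnrichedFunctor SSet.{w} C D) {X Y : C} (f : X ⟶ Y)
    (n : SimplexCategoryᵒᵖ) : sHomOf ((underlying F).map f) n = sMap F (sHomOf f n) := by
  have h : eHomEquiv SSet.{w} ((underlying F).map f) = eHomEquiv SSet.{w} f ≫ F.map X Y :=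
    Equiv.apply_symm_apply _ _
  exact ConcreteCategory.congr_hom (NatTrans.congr_app h n) PUnit.unit

/-- A simplicial (i.e. `SSet`-enriched) natural isomorphism between simplicial functors. -/
structure SimplicialNatIso (F G : EnrichedFunctor SSet.{w} C D) where
  /-- the components -/
  app (X : C) : F.obj X ≅ G.obj X
  naturality (X Y : C) :
    F.map X Y ≫ eHomWhiskerLeft SSet.{w} (F.obj X) (app Y).hom =
      G.map X Y ≫ eHomWhiskerRight SSet.{w} (app X).hom (G.obj Y)

lemma SimplicialNatIso.nat {F G : EnrichedFunctor SSet.{w} C D} (e : SimplicialNatIso F G)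
    {X Y : C} {n : SimplexCategoryᵒᵖ} (f : (X ⟶[SSet.{w}] Y).obj n) :
    sComp (sMap F f) (sHomOf (e.app Y).hom n) = sComp (sHomOf (e.app X).hom n) (sMap G f) :=
  ConcreteCategory.congr_hom (NatTrans.congr_app (e.naturality X Y) n) f

/-- A simplicial (i.e. `SSet`-enriched) adjunction. -/
structure SimplicialAdjunction (L : EnrichedFunctor SSet.{w} C D)
    (R : EnrichedFunctor SSet.{w} D C) where
  /-- the isomorphism of mapping spaces `Map(L X, Y) ≅ Map(X, R Y)` -/
  homIso (X : C) (Y : D) : (L.obj X ⟶[SSet.{w}] Y) ≅ (X ⟶[SSet.{w}] R.obj Y)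
  naturality_left (X X' : C) (Y : D) :
    L.map X X' ▷ _ ≫ eComp SSet.{w} (L.obj X) (L.obj X') Y ≫ (homIso X Y).hom =
      _ ◁ (homIso X' Y).hom ≫ eComp SSet.{w} X X' (R.obj Y)
  naturality_right (X : C) (Y Y' : D) :
    eComp SSet.{w} (L.obj X) Y Y' ≫ (homIso X Y').hom =
      ((homIso X Y).hom ⊗ₘ R.map Y Y') ≫ eComp SSet.{w} X (R.obj Y) (R.obj Y')

/-- A tensor `K ⊗ X` of an object `X` of a simplicial category by a simplicial set `K`:
an object together with a map `K ⟶ Map(X, K ⊗ X)` inducing isomorphisms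
`Map(K ⊗ X, Y) ≅ Map(K, Map(X, Y))` of simplicial sets, which is expressed by testing on
maps from an arbitrary simplicial set `L`. -/
structure SimplicialTensor (K : SSet.{w}) (X : C) where
  /-- the tensor `K ⊗ X` -/
  obj : C
  /-- the universal map -/
  unit : K ⟶ (X ⟶[SSet.{w}] obj)
  bijective (Y : C) (L : SSet.{w}) : Function.Bijective
    (fun (f : L ⟶ (obj ⟶[SSet.{w}] Y)) ↦ (unit ⊗ₘ f) ≫ eComp SSet.{w} X obj Y)

/-- A cotensor `Y ^ K` of an object `Y` of a simplicial category by a simplicial set `K`: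
an object together with a map `K ⟶ Map(Y ^ K, Y)` inducing isomorphisms
`Map(X, Y ^ K) ≅ Map(K, Map(X, Y))` of simplicial sets, which is expressed by testing on
maps from an arbitrary simplicial set `L`. -/
structure SimplicialCotensor (K : SSet.{w}) (Y : C) where
  /-- the cotensor `Y ^ K` -/
  obj : C
  /-- the universal map -/
  counit : K ⟶ (obj ⟶[SSet.{w}] Y)
  bijective (X : C) (L : SSet.{w}) : Function.Bijective
    (fun (f : L ⟶ (X ⟶[SSet.{w}] obj)) ↦ (f ⊗ₘ counit) ≫ eComp SSet.{w} X obj Y)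

end Ordinary

section Model

variable (C : Type u) [Category.{w} C] [ModelCategory C]

/-- A model category is combinatorial if its underlying category is locally presentable and it is
cofibrantly generated: there are (small) sets of morphisms which detect by the right lifting
property the trivial fibrations and the fibrations respectively. (In a locally presentable category
every set of morphisms permits the small object argument.) -/
structure IsCombinatorial : Prop where
  isLocallyPresentable : IsLocallyPresentable.{w} C
  exists_generating_cofibrations :
    ∃ S : MorphismProperty C, MorphismProperty.IsSmall.{w} S ∧ trivialFibrations C = S.rlp
  exists_generating_trivialCofibrations :
    ∃ S : MorphismProperty C, MorphismProperty.IsSmall.{w} S ∧ fibrations C = S.rlp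

variable [SimplicialCategory C]

/-- A simplicial model category: a model category with a simplicial enrichment which is
tensored and cotensored over simplicial sets, and which satisfies Quillen's axiom (SM7):
for a cofibration `i : A ⟶ B` and a fibration `p : X ⟶ Y`, the map
`π : Map(B, X) ⟶ Map(A, X) ×_{Map(A, Y)} Map(B, Y)` is a Kan fibration (right lifting property
for the horn inclusions), and a trivial Kan fibration (right lifting property for the boundary
inclusions) if `i` or `p` is moreover a weak equivalence. -/
structure IsSimplicialModelCategory : Prop where
  tensored (K : SSet.{w}) (X : C) : Nonempty (SimplicialTensor K X)
  cotensored (K : SSet.{w}) (X : C) : Nonempty (SimplicialCotensor K X)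
  kanFibration {A B X Y : C} (i : A ⟶ B) (p : X ⟶ Y) (hi : Cofibration i) (hp : Fibration p)
    (sq : (SimplicialCategory.sHomFunctor C).PullbackObjObj i p) :
    SSet.modelCategoryQuillen.J.rlp sq.π
  trivialKanFibration {A B X Y : C} (i : A ⟶ B) (p : X ⟶ Y) (hi : Cofibration i)
    (hp : Fibration p) (h : WeakEquivalence i ∨ WeakEquivalence p)
    (sq : (SimplicialCategory.sHomFunctor C).PullbackObjObj i p) :
    SSet.modelCategoryQuillen.I.rlp sq.π

end Model

/-- A (bundled) simplicial model category. -/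
structure SimplicialModelCat where
  /-- the objects -/
  carrier : Type u
  /-- the underlying category -/
  [category : Category.{w} carrier]
  /-- the simplicial enrichment -/
  [simplicialCategory : SimplicialCategory carrier]
  /-- the model structure -/
  [modelCategory : ModelCategory carrier]
  isSimplicialModelCategory : IsSimplicialModelCategory carrier

instance : CoeSort SimplicialModelCat.{w, u} (Type u) := ⟨SimplicialModelCat.carrier⟩

attribute [instance] SimplicialModelCat.category SimplicialModelCat.simplicialCategory
  SimplicialModelCat.modelCategory

/-- A simplicial Quillen adjunction between simplicial model categories. -/
structure SimplicialQuillenAdjunction (C D : SimplicialModelCat.{w, u}) where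
  /-- the left adjoint -/
  left : EnrichedFunctor SSet.{w} C D
  /-- the right adjoint -/
  right : EnrichedFunctor SSet.{w} D C
  /-- the adjunction -/
  adj : SimplicialAdjunction left right
  cofibration_map {X Y : C} (f : X ⟶ Y) (hf : cofibrations C f) :
    cofibrations D ((underlying left).map f)
  trivialCofibration_map {X Y : C} (f : X ⟶ Y) (hf : trivialCofibrations C f) :
    trivialCofibrations D ((underlying left).map f)

/-- A simplicial Quillen presheaf on an ordinary category `I`: a pseudofunctor `M` from `I`
to the `(2,1)`-category of simplicial model categories, simplicial Quillen adjunctions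
(in the direction of their left adjoints) and simplicial natural isomorphisms (between left
adjoints). The comparison isomorphism for the composition is indexed by a factorization
`f ≫ g = fg`, so that the coherence conditions can be stated without transport. -/
structure SimplicialQuillenPresheaf (I : Type u₁) [Category.{w} I] where
  /-- the values -/
  obj : I → SimplicialModelCat.{w, u}
  /-- the transition adjunctions `α_! ⊣ α^*` -/
  map {i j : I} (α : i ⟶ j) : SimplicialQuillenAdjunction (obj i) (obj j)
  /-- `(𝟙 i)_! ≅ 𝟙` -/
  mapId (i : I) : SimplicialNatIso (map (𝟙 i)).left (EnrichedFunctor.id SSet.{w} (obj i))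
  /-- `(α ≫ β)_! ≅ β_! α_!` -/
  mapComp {i j k : I} (α : i ⟶ j) (β : j ⟶ k) (γ : i ⟶ k) (h : α ≫ β = γ) :
    SimplicialNatIso (map γ).left ((map α).left.comp SSet.{w} (map β).left)
  id_comp {i j : I} (α : i ⟶ j) (X : obj i) :
    ((mapComp (𝟙 i) α α (Category.id_comp α)).app X).hom ≫
      (underlying (map α).left).map ((mapId i).app X).hom = 𝟙 ((map α).left.obj X)
  comp_id {i j : I} (α : i ⟶ j) (X : obj i) :
    ((mapComp α (𝟙 j) α (Category.comp_id α)).app X).hom ≫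
      ((mapId j).app ((map α).left.obj X)).hom = 𝟙 ((map α).left.obj X)
  assoc {i j k l : I} (α : i ⟶ j) (β : j ⟶ k) (γ : k ⟶ l) (αβ : i ⟶ k) (βγ : j ⟶ l)
    (δ : i ⟶ l) (hαβ : α ≫ β = αβ) (hβγ : β ≫ γ = βγ) (h : αβ ≫ γ = δ) (h' : α ≫ βγ = δ)
    (X : obj i) :
    ((mapComp αβ γ δ h).app X).hom ≫
      (underlying (map γ).left).map ((mapComp α β αβ hαβ).app X).hom =
    ((mapComp α βγ δ h').app X).hom ≫ ((mapComp β γ βγ hβγ).app ((map α).left.obj X)).hom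


namespace SimplicialQuillenPresheaf

variable {I : Type u₁} [Category.{w} I] (M : SimplicialQuillenPresheaf.{w, u} I)

/-- The object `α_! X`. -/
abbrev push {i j : I} (α : i ⟶ j) (X : M.obj i) : M.obj j := (M.map α).left.obj X

/-- The action of `α_!` on `n`-simplices of mapping spaces. -/
def pushMap {i j : I} (α : i ⟶ j) {X Y : M.obj i} {n : SimplexCategoryᵒᵖ}
    (f : (X ⟶[SSet.{w}] Y).obj n) : (M.push α X ⟶[SSet.{w}] M.push α Y).obj n :=
  sMap (M.map α).left f

/-- The isomorphism `(𝟙 i)_! X ⟶ X`. -/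
def idHom (i : I) (X : M.obj i) : M.push (𝟙 i) X ⟶ X := ((M.mapId i).app X).hom

/-- The isomorphism `γ_! X ⟶ β_! α_! X` when `α ≫ β = γ`. -/
def compHom {i j k : I} (α : i ⟶ j) (β : j ⟶ k) (γ : i ⟶ k) (h : α ≫ β = γ) (X : M.obj i) :
    M.push γ X ⟶ M.push β (M.push α X) := ((M.mapComp α β γ h).app X).hom

lemma pushMap_sId {i j : I} (α : i ⟶ j) (X : M.obj i) (n : SimplexCategoryᵒᵖ) :
    M.pushMap α (sId X n) = sId (M.push α X) n := sMap_sId _ _ _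

lemma pushMap_sComp {i j : I} (α : i ⟶ j) {X Y Z : M.obj i} {n : SimplexCategoryᵒᵖ}
    (f : (X ⟶[SSet.{w}] Y).obj n) (g : (Y ⟶[SSet.{w}] Z).obj n) :
    M.pushMap α (sComp f g) = sComp (M.pushMap α f) (M.pushMap α g) := sMap_sComp _ _ _

lemma map_pushMap {i j : I} (α : i ⟶ j) {X Y : M.obj i} {m n : SimplexCategoryᵒᵖ} (θ : n ⟶ m)
    (f : (X ⟶[SSet.{w}] Y).obj n) :
    (M.push α X ⟶[SSet.{w}] M.push α Y).map θ (M.pushMap α f) =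
      M.pushMap α ((X ⟶[SSet.{w}] Y).map θ f) := map_sMap _ _ _

lemma idHom_nat {i : I} {X Y : M.obj i} {n : SimplexCategoryᵒᵖ} (f : (X ⟶[SSet.{w}] Y).obj n) :
    sComp (M.pushMap (𝟙 i) f) (sHomOf (M.idHom i Y) n) = sComp (sHomOf (M.idHom i X) n) f :=
  (M.mapId i).nat f

lemma compHom_nat {i j k : I} (α : i ⟶ j) (β : j ⟶ k) (γ : i ⟶ k) (h : α ≫ β = γ)
    {X Y : M.obj i} {n : SimplexCategoryᵒᵖ} (f : (X ⟶[SSet.{w}] Y).obj n) :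
    sComp (M.pushMap γ f) (sHomOf (M.compHom α β γ h Y) n) =
      sComp (sHomOf (M.compHom α β γ h X) n) (M.pushMap β (M.pushMap α f)) :=
  (M.mapComp α β γ h).nat f

lemma compHom_idHom_left {i j : I} (α : i ⟶ j) (X : M.obj i) (n : SimplexCategoryᵒᵖ) :
    sComp (sHomOf (M.compHom (𝟙 i) α α (Category.id_comp α) X) n)
      (M.pushMap α (sHomOf (M.idHom i X) n)) = sId (M.push α X) n := by
  have h := congrArg (fun f ↦ sHomOf f n) (M.id_comp α X)
  exact ((sHomOf_comp _ _ n).trans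
    (congrArg (sComp _) (sHomOf_underlying_map _ _ n))).symm.trans (h.trans (sHomOf_id _ n))

lemma compHom_idHom_right {i j : I} (α : i ⟶ j) (X : M.obj i) (n : SimplexCategoryᵒᵖ) :
    sComp (sHomOf (M.compHom α (𝟙 j) α (Category.comp_id α) X) n)
      (sHomOf (M.idHom j (M.push α X)) n) = sId (M.push α X) n := by
  have h := congrArg (fun f ↦ sHomOf f n) (M.comp_id α X)
  exact (sHomOf_comp _ _ n).symm.trans (h.trans (sHomOf_id _ n))

lemma compHom_assoc {i j k l : I} (α : i ⟶ j) (β : j ⟶ k) (γ : k ⟶ l) (αβ : i ⟶ k) (βγ : j ⟶ l)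
    (δ : i ⟶ l) (hαβ : α ≫ β = αβ) (hβγ : β ≫ γ = βγ) (h : αβ ≫ γ = δ) (h' : α ≫ βγ = δ)
    (X : M.obj i) (n : SimplexCategoryᵒᵖ) :
    sComp (sHomOf (M.compHom αβ γ δ h X) n) (M.pushMap γ (sHomOf (M.compHom α β αβ hαβ X) n)) =
      sComp (sHomOf (M.compHom α βγ δ h' X) n)
        (sHomOf (M.compHom β γ βγ hβγ (M.push α X)) n) := by
  have e := congrArg (fun f ↦ sHomOf f n) (M.assoc α β γ αβ βγ δ hαβ hβγ h h' X)
  exact ((sHomOf_comp _ _ n).trans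
    (congrArg (sComp _) (sHomOf_underlying_map _ _ n))).symm.trans (e.trans (sHomOf_comp _ _ n))

end SimplicialQuillenPresheaf

section Discrete

/-- An ordinary category `I`, regarded as a simplicial category with discrete mapping spaces. -/
structure Disc (I : Type u₁) where
  /-- the object of `I` -/
  as : I

variable {I : Type u₁} [Category.{w} I]

instance : EnrichedCategory SSet.{w} (Disc I) where
  Hom X Y := (Functor.const _).obj (X.as ⟶ Y.as)
  id X := { app _ := ↾fun _ ↦ 𝟙 X.as }
  comp X Y Z := { app _ := ↾fun p ↦ p.1 ≫ p.2 }
  id_comp X Y := by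
    ext n (f : X.as ⟶ Y.as)
    exact Category.id_comp f
  comp_id X Y := by
    ext n (f : X.as ⟶ Y.as)
    exact Category.comp_id f
  assoc W X Y Z := by
    ext n ⟨(f : W.as ⟶ X.as), (g : X.as ⟶ Y.as), (h : Y.as ⟶ Z.as)⟩
    exact Category.assoc f g h

end Discrete

section Total

variable {I : Type u₁} [Category.{w} I]

/-- The objects of the total category `∫ M` of a simplicial Quillen presheaf. -/
structure Total (M : SimplicialQuillenPresheaf.{w, u} I) where
  /-- the object of the base -/
  base : I
  /-- the object of the fiber -/
  fiber : M.obj base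

variable {M : SimplicialQuillenPresheaf.{w, u} I}

namespace Total

/-- The mapping space `Map((i, X), (j, Y)) = ∐_{α : i ⟶ j} Map(α_! X, Y)` in `∫ M`. -/
def Map (A B : Total M) : SSet.{w} where
  obj n := Σ α : A.base ⟶ B.base, (M.push α A.fiber ⟶[SSet.{w}] B.fiber).obj n
  map θ := ↾fun f ↦
    ⟨f.1, (M.push f.1 A.fiber ⟶[SSet.{w}] B.fiber).map θ f.2⟩
  map_id n := by
    ext ⟨α, f⟩
    · rfl
    · have h : (M.push α A.fiber ⟶[SSet.{w}] B.fiber).map (𝟙 n) f = f := map_id_apply _ f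
      exact heq_of_eq h
  map_comp θ θ' := by
    ext ⟨α, f⟩
    · rfl
    · have h : (M.push α A.fiber ⟶[SSet.{w}] B.fiber).map (θ ≫ θ') f =
          (M.push α A.fiber ⟶[SSet.{w}] B.fiber).map θ'
            ((M.push α A.fiber ⟶[SSet.{w}] B.fiber).map θ f) := map_comp_apply _ θ θ' f
      exact heq_of_eq h

/-- The `n`-simplex of `Map((i, X), (j, Y))` given by `α : i ⟶ j` and an `n`-simplex
of `Map(α_! X, Y)`. -/
def mk' {A B : Total M} {n : SimplexCategoryᵒᵖ} (α : A.base ⟶ B.base)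
    (f : (M.push α A.fiber ⟶[SSet.{w}] B.fiber).obj n) : (Map A B).obj n := ⟨α, f⟩

lemma map_mk' {A B : Total M} {m n : SimplexCategoryᵒᵖ} (θ : n ⟶ m) (α : A.base ⟶ B.base)
    (f : (M.push α A.fiber ⟶[SSet.{w}] B.fiber).obj n) :
    (Map A B).map θ (mk' α f) =
      mk' α ((M.push α A.fiber ⟶[SSet.{w}] B.fiber).map θ f) := rfl

/-- The composition in `∫ M` of `n`-simplices lying over `α` and `β`, where `α ≫ β = γ`:
the composite `γ_! X ≅ β_! α_! X ⟶ β_! Y ⟶ Z`. -/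
def compAux {A B C : Total M} {n : SimplexCategoryᵒᵖ} (α : A.base ⟶ B.base)
    (β : B.base ⟶ C.base) (γ : A.base ⟶ C.base) (h : α ≫ β = γ)
    (f : (M.push α A.fiber ⟶[SSet.{w}] B.fiber).obj n)
    (g : (M.push β B.fiber ⟶[SSet.{w}] C.fiber).obj n) :
    (M.push γ A.fiber ⟶[SSet.{w}] C.fiber).obj n :=
  sComp (sHomOf (M.compHom α β γ h A.fiber) n) (sComp (M.pushMap β f) g)

/-- The composition of `n`-simplices in `∫ M`. -/
def comp {A B C : Total M} {n : SimplexCategoryᵒᵖ} (f : (Map A B).obj n) (g : (Map B C).obj n) :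
    (Map A C).obj n :=
  mk' (f.1 ≫ g.1) (compAux f.1 g.1 (f.1 ≫ g.1) rfl f.2 g.2)

lemma comp_mk' {A B C : Total M} {n : SimplexCategoryᵒᵖ} (α : A.base ⟶ B.base)
    (β : B.base ⟶ C.base) (γ : A.base ⟶ C.base) (h : α ≫ β = γ)
    (f : (M.push α A.fiber ⟶[SSet.{w}] B.fiber).obj n)
    (g : (M.push β B.fiber ⟶[SSet.{w}] C.fiber).obj n) :
    comp (mk' α f) (mk' β g) = mk' γ (compAux α β γ h f g) := by
  subst h
  rfl

/-- The identity `n`-simplices in `∫ M`. -/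
def id (A : Total M) (n : SimplexCategoryᵒᵖ) : (Map A A).obj n :=
  mk' (𝟙 A.base) (sHomOf (M.idHom A.base A.fiber) n)

lemma id_comp {A B : Total M} {n : SimplexCategoryᵒᵖ} (f : (Map A B).obj n) :
    comp (id A n) f = f := by
  obtain ⟨α, f⟩ := f
  refine (comp_mk' (𝟙 A.base) α α (Category.id_comp α) _ f).trans (congrArg (mk' α) ?_)
  rw [compAux, ← sComp_assoc, M.compHom_idHom_left, sId_sComp]

lemma comp_id {A B : Total M} {n : SimplexCategoryᵒᵖ} (f : (Map A B).obj n) :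
    comp f (id B n) = f := by
  obtain ⟨α, f⟩ := f
  refine (comp_mk' α (𝟙 B.base) α (Category.comp_id α) f _).trans (congrArg (mk' α) ?_)
  rw [compAux, M.idHom_nat, ← sComp_assoc, M.compHom_idHom_right, sId_sComp]

lemma assoc {A B C D : Total M} {n : SimplexCategoryᵒᵖ} (f : (Map A B).obj n)
    (g : (Map B C).obj n) (h : (Map C D).obj n) :
    comp (comp f g) h = comp f (comp g h) := by
  obtain ⟨α, f⟩ := f
  obtain ⟨β, g⟩ := g
  obtain ⟨γ, h⟩ := h
  refine (comp_mk' (α ≫ β) γ ((α ≫ β) ≫ γ) rfl (compAux α β _ rfl f g) h).trans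
    (Eq.trans (congrArg (mk' _) ?_)
      (comp_mk' α (β ≫ γ) ((α ≫ β) ≫ γ) (Category.assoc _ _ _).symm f
        (compAux β γ _ rfl g h)).symm)
  have e := M.compHom_assoc α β γ (α ≫ β) (β ≫ γ) _ rfl rfl rfl
    (Category.assoc _ _ _).symm A.fiber n
  have e' := M.compHom_nat β γ (β ≫ γ) rfl f
  simp only [compAux, M.pushMap_sComp, ← sComp_assoc]
  rw [e]
  simp only [sComp_assoc]
  congr 1
  simp only [← sComp_assoc]
  rw [e']

lemma map_id' (A : Total M) {m n : SimplexCategoryᵒᵖ} (θ : n ⟶ m) :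
    (Map A A).map θ (id A n) = id A m :=
  congrArg (mk' (𝟙 A.base)) (map_sHomOf _ θ)

lemma map_compAux {A B C : Total M} {m n : SimplexCategoryᵒᵖ} (θ : n ⟶ m)
    (α : A.base ⟶ B.base) (β : B.base ⟶ C.base) (γ : A.base ⟶ C.base) (h : α ≫ β = γ)
    (f : (M.push α A.fiber ⟶[SSet.{w}] B.fiber).obj n)
    (g : (M.push β B.fiber ⟶[SSet.{w}] C.fiber).obj n) :
    (M.push γ A.fiber ⟶[SSet.{w}] C.fiber).map θ (compAux α β γ h f g) =
      compAux α β γ h ((M.push α A.fiber ⟶[SSet.{w}] B.fiber).map θ f)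
        ((M.push β B.fiber ⟶[SSet.{w}] C.fiber).map θ g) := by
  rw [compAux, compAux, map_sComp, map_sHomOf, map_sComp, M.map_pushMap]

lemma map_comp' {A B C : Total M} {m n : SimplexCategoryᵒᵖ} (θ : n ⟶ m) (f : (Map A B).obj n)
    (g : (Map B C).obj n) :
    (Map A C).map θ (comp f g) = comp ((Map A B).map θ f) ((Map B C).map θ g) :=
  congrArg (mk' (f.1 ≫ g.1)) (map_compAux θ f.1 g.1 _ rfl f.2 g.2)

/-- The total category `∫ M` is a simplicial category. -/
instance : EnrichedCategory SSet.{w} (Total M) where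
  Hom A B := Map A B
  id A :=
    { app n := ↾fun _ ↦ id A n
      naturality _ _ θ := by
        ext ⟨⟩
        exact (map_id' A θ).symm }
  comp A B C :=
    { app n := ↾fun p ↦ comp p.1 p.2
      naturality _ _ θ := by
        ext ⟨f, g⟩
        exact (map_comp' θ f g).symm }
  id_comp A B := by
    ext n f
    exact id_comp f
  comp_id A B := by
    ext n f
    exact comp_id f
  assoc A B C D := by
    ext n ⟨f, g, h⟩
    exact assoc f g h

variable (M) in
/-- The projection `∫ M ⟶ I`. -/
def proj : EnrichedFunctor SSet.{w} (Total M) (Disc I) where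
  obj A := ⟨A.base⟩
  map A B := { app _ := ↾fun f ↦ f.1 }
  map_id A := rfl
  map_comp A B C := rfl

/-- The inclusion of the summand `Map(α_! X, Y)` of `Map((i, X), (j, Y))`. -/
def incl {i j : I} (X : M.obj i) (Y : M.obj j) (α : i ⟶ j) :
    (M.push α X ⟶[SSet.{w}] Y) ⟶
      ((⟨i, X⟩ : Total M) ⟶[SSet.{w}] (⟨j, Y⟩ : Total M)) where
  app _ := ↾fun f ↦ ⟨α, f⟩

/-- The inclusion `M(i) ⟶ ∫ M` of a fiber, on `n`-simplices of mapping spaces. -/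
def fiberIncl {i : I} {X Y : M.obj i} {n : SimplexCategoryᵒᵖ} (f : (X ⟶[SSet.{w}] Y).obj n) :
    (Map (⟨i, X⟩ : Total M) ⟨i, Y⟩).obj n :=
  mk' (A := ⟨i, X⟩) (B := ⟨i, Y⟩) (𝟙 i) (sComp (sHomOf (M.idHom i X) n) f)

/-- The composition in `∫ M` with an `n`-simplex of a mapping space of a fiber `M(i)`. -/
def post {A : Total M} {i : I} {X Y : M.obj i} {n : SimplexCategoryᵒᵖ}
    (f : (Map A ⟨i, X⟩).obj n) (g : (X ⟶[SSet.{w}] Y).obj n) : (Map A ⟨i, Y⟩).obj n :=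
  mk' (B := ⟨i, Y⟩) f.1 (sComp f.2 g)

/-- The precomposition in `∫ M` with an `n`-simplex of a mapping space of a fiber `M(i)`. -/
def pre {B : Total M} {i : I} {X Y : M.obj i} {n : SimplexCategoryᵒᵖ}
    (g : (X ⟶[SSet.{w}] Y).obj n) (f : (Map ⟨i, Y⟩ B).obj n) : (Map ⟨i, X⟩ B).obj n :=
  mk' (A := ⟨i, X⟩) f.1 (sComp (M.pushMap f.1 g) f.2)

lemma post_eq_comp {A : Total M} {i : I} {X Y : M.obj i} {n : SimplexCategoryᵒᵖ}
    (f : (Map A ⟨i, X⟩).obj n) (g : (X ⟶[SSet.{w}] Y).obj n) :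
    post f g = comp f (fiberIncl g) := by
  obtain ⟨α, f⟩ := f
  refine Eq.trans (congrArg (mk' (B := ⟨i, Y⟩) α) ?_)
    (comp_mk' (B := ⟨i, X⟩) (C := ⟨i, Y⟩) α (𝟙 i) α (Category.comp_id α) f
      (sComp (sHomOf (M.idHom i X) n) g)).symm
  rw [compAux, ← sComp_assoc (M.pushMap _ f), M.idHom_nat, ← sComp_assoc, ← sComp_assoc,
    M.compHom_idHom_right, sId_sComp]

lemma pre_eq_comp {B : Total M} {i : I} {X Y : M.obj i} {n : SimplexCategoryᵒᵖ}
    (g : (X ⟶[SSet.{w}] Y).obj n) (f : (Map ⟨i, Y⟩ B).obj n) :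
    pre g f = comp (fiberIncl g) f := by
  obtain ⟨α, f⟩ := f
  refine Eq.trans (congrArg (mk' (A := ⟨i, X⟩) α) ?_)
    (comp_mk' (A := ⟨i, X⟩) (B := ⟨i, Y⟩) (𝟙 i) α α (Category.id_comp α)
      (sComp (sHomOf (M.idHom i X) n) g) f).symm
  rw [compAux, M.pushMap_sComp, ← sComp_assoc, ← sComp_assoc, M.compHom_idHom_left, sId_sComp]

lemma post_sId {A : Total M} {i : I} {X : M.obj i} {n : SimplexCategoryᵒᵖ}
    (f : (Map A ⟨i, X⟩).obj n) : post f (sId X n) = f :=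
  congrArg (mk' (B := ⟨i, X⟩) f.1) (sComp_sId f.2)

lemma pre_sId {B : Total M} {i : I} {X : M.obj i} {n : SimplexCategoryᵒᵖ}
    (f : (Map ⟨i, X⟩ B).obj n) : pre (sId X n) f = f := by
  refine congrArg (mk' (A := ⟨i, X⟩) f.1) ?_
  rw [M.pushMap_sId, sId_sComp]

lemma post_sComp {A : Total M} {i : I} {X Y Z : M.obj i} {n : SimplexCategoryᵒᵖ}
    (f : (Map A ⟨i, X⟩).obj n) (g : (X ⟶[SSet.{w}] Y).obj n) (h : (Y ⟶[SSet.{w}] Z).obj n) :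
    post f (sComp g h) = post (post f g) h :=
  congrArg (mk' (B := ⟨i, Z⟩) f.1) (sComp_assoc _ _ _).symm

lemma pre_sComp {B : Total M} {i : I} {X Y Z : M.obj i} {n : SimplexCategoryᵒᵖ}
    (g : (X ⟶[SSet.{w}] Y).obj n) (h : (Y ⟶[SSet.{w}] Z).obj n) (f : (Map ⟨i, Z⟩ B).obj n) :
    pre (sComp g h) f = pre g (pre h f) := by
  refine congrArg (mk' (A := ⟨i, X⟩) f.1) (Eq.trans ?_ (sComp_assoc _ _ _))
  rw [M.pushMap_sComp]
  rfl

lemma post_pre {i j : I} {X Y : M.obj i} {Z W : M.obj j} {n : SimplexCategoryᵒᵖ}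
    (g : (X ⟶[SSet.{w}] Y).obj n) (f : (Map (⟨i, Y⟩ : Total M) ⟨j, Z⟩).obj n)
    (h : (Z ⟶[SSet.{w}] W).obj n) : post (pre g f) h = pre g (post f h) :=
  congrArg (mk' (A := ⟨i, X⟩) (B := ⟨j, W⟩) f.1) (sComp_assoc _ _ _)

end Total

end Total

section Sections

variable {I : Type u₁} [Category.{w} I] {J : Type w} [EnrichedCategory SSet.{w} J]

/-- A simplicial section of `M` along `φ : J ⟶ I`: a simplicial functor `J ⟶ ∫ M` over `I`,
given by objects `obj j` of `M(φ j)` and the action on mapping spaces of a simplicial functor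
which sends `j` to `(φ j, obj j)`. -/
structure SimplicialSection (φ : EnrichedFunctor SSet.{w} J (Disc I))
    (M : SimplicialQuillenPresheaf.{w, u} I) where
  /-- the values -/
  obj (j : J) : M.obj (φ.obj j).as
  /-- the action on mapping spaces -/
  map (j j' : J) : (j ⟶[SSet.{w}] j') ⟶
    ((⟨(φ.obj j).as, obj j⟩ : Total M) ⟶[SSet.{w}] (⟨(φ.obj j').as, obj j'⟩ : Total M))
  map_id (j : J) : eId SSet.{w} j ≫ map j j = eId SSet.{w} (⟨(φ.obj j).as, obj j⟩ : Total M)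
  map_comp (j j' j'' : J) : eComp SSet.{w} j j' j'' ≫ map j j'' =
    (map j j' ⊗ₘ map j' j'') ≫ eComp SSet.{w} (⟨(φ.obj j).as, obj j⟩ : Total M)
      ⟨(φ.obj j').as, obj j'⟩ ⟨(φ.obj j'').as, obj j''⟩
  map_proj (j j' : J) : map j j' ≫ (Total.proj M).map ⟨(φ.obj j).as, obj j⟩
    ⟨(φ.obj j').as, obj j'⟩ = φ.map j j'

variable {φ : EnrichedFunctor SSet.{w} J (Disc I)} {M : SimplicialQuillenPresheaf.{w, u} I}

namespace SimplicialSection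

/-- The simplicial functor `J ⟶ ∫ M` given by a simplicial section. -/
def toEnrichedFunctor (s : SimplicialSection φ M) : EnrichedFunctor SSet.{w} J (Total M) where
  obj j := ⟨(φ.obj j).as, s.obj j⟩
  map := s.map
  map_id := s.map_id
  map_comp := s.map_comp

lemma toEnrichedFunctor_comp_proj (s : SimplicialSection φ M) :
    s.toEnrichedFunctor.comp SSet.{w} (Total.proj M) = φ :=
  EnrichedFunctor.ext _ (fun _ ↦ rfl) (fun j j' ↦ (Category.comp_id _).trans (s.map_proj j j'))

/-- The action of a simplicial section on `n`-simplices of mapping spaces. -/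
def act (s : SimplicialSection φ M) {j j' : J} {n : SimplexCategoryᵒᵖ}
    (γ : (j ⟶[SSet.{w}] j').obj n) :
    (Total.Map (⟨(φ.obj j).as, s.obj j⟩ : Total M) ⟨(φ.obj j').as, s.obj j'⟩).obj n :=
  (s.map j j').app n γ

/-- The naturality condition on a family of `n`-simplices `T j` of the mapping spaces
`Map(s(j), t(j))`: for every simplex `γ` of a mapping space `Map(j, j')`, the square in `∫ M`
given by the actions of `s` and `t` on `γ` and by (the restrictions of) `T j` and `T j'`
commutes. -/
def IsNatural {s t : SimplicialSection φ M} {n : SimplexCategoryᵒᵖ}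
    (T : ∀ j, (s.obj j ⟶[SSet.{w}] t.obj j).obj n) : Prop :=
  ∀ ⦃m : SimplexCategoryᵒᵖ⦄ (θ : n ⟶ m) ⦃j j' : J⦄ (γ : (j ⟶[SSet.{w}] j').obj m),
    Total.post (s.act γ) ((s.obj j' ⟶[SSet.{w}] t.obj j').map θ (T j')) =
      Total.pre ((s.obj j ⟶[SSet.{w}] t.obj j).map θ (T j)) (t.act γ)

lemma IsNatural.map {s t : SimplicialSection φ M} {m n : SimplexCategoryᵒᵖ}
    {T : ∀ j, (s.obj j ⟶[SSet.{w}] t.obj j).obj n} (hT : IsNatural T) (θ : n ⟶ m) :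
    IsNatural (fun j ↦ (s.obj j ⟶[SSet.{w}] t.obj j).map θ (T j)) := by
  intro k θ' j j' γ
  have h := hT (θ ≫ θ') γ
  rwa [Functor.map_comp_apply, Functor.map_comp_apply] at h

lemma IsNatural.id (s : SimplicialSection φ M) (n : SimplexCategoryᵒᵖ) :
    IsNatural (fun j ↦ sId (s.obj j) n) := by
  intro m θ j j' γ
  rw [map_sId, map_sId, Total.post_sId, Total.pre_sId]

lemma IsNatural.comp {s t r : SimplicialSection φ M} {n : SimplexCategoryᵒᵖ}
    {T : ∀ j, (s.obj j ⟶[SSet.{w}] t.obj j).obj n} (hT : IsNatural T)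
    {T' : ∀ j, (t.obj j ⟶[SSet.{w}] r.obj j).obj n} (hT' : IsNatural T') :
    IsNatural (fun j ↦ sComp (T j) (T' j)) := by
  intro m θ j j' γ
  rw [map_sComp, map_sComp, Total.post_sComp, hT θ γ, Total.post_pre, hT' θ γ, Total.pre_sComp]

/-- Morphisms of simplicial sections: simplicial natural transformations over `I`. -/
@[ext]
structure Hom (s t : SimplicialSection φ M) where
  /-- the components -/
  app (j : J) : s.obj j ⟶ t.obj j
  naturality ⦃n : SimplexCategoryᵒᵖ⦄ ⦃j j' : J⦄ (γ : (j ⟶[SSet.{w}] j').obj n) :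
    Total.post (s.act γ) (sHomOf (app j') n) = Total.pre (sHomOf (app j) n) (t.act γ)

instance : Category.{w} (SimplicialSection φ M) where
  Hom s t := Hom s t
  id s :=
    { app j := 𝟙 (s.obj j)
      naturality n j j' γ := by
        rw [sHomOf_id, sHomOf_id, Total.post_sId, Total.pre_sId] }
  comp f g :=
    { app j := f.app j ≫ g.app j
      naturality n j j' γ := by
        rw [sHomOf_comp, sHomOf_comp, Total.post_sComp, f.naturality, Total.post_pre,
          g.naturality, Total.pre_sComp] }
  id_comp f := Hom.ext (funext fun j ↦ Category.id_comp (f.app j))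
  comp_id f := Hom.ext (funext fun j ↦ Category.comp_id (f.app j))
  assoc f g h := Hom.ext (funext fun j ↦ Category.assoc (f.app j) (g.app j) (h.app j))

variable (φ M) in
/-- The evaluation functor `s ↦ s(j)`. -/
def ev (j : J) : SimplicialSection φ M ⥤ M.obj (φ.obj j).as where
  obj s := s.obj j
  map f := f.app j
  map_id _ := rfl
  map_comp _ _ := rfl

/-- The mapping space `Map(s, t)`: its `n`-simplices are the natural families of `n`-simplices
of the mapping spaces `Map(s(j), t(j))`. -/
def Map (s t : SimplicialSection φ M) : SSet.{w} where
  obj n := { T : ∀ j, (s.obj j ⟶[SSet.{w}] t.obj j).obj n // IsNatural T }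
  map θ := ↾fun T ↦ ⟨fun j ↦ (s.obj j ⟶[SSet.{w}] t.obj j).map θ (T.1 j), T.2.map θ⟩
  map_id n := by
    ext T j
    exact map_id_apply _ (T.1 j)
  map_comp θ θ' := by
    ext T j
    exact map_comp_apply _ θ θ' (T.1 j)

/-- The projection `Map(s, t) ⟶ Map(s(j), t(j))`. -/
def Map.ev (s t : SimplicialSection φ M) (j : J) : Map s t ⟶ (s.obj j ⟶[SSet.{w}] t.obj j) where
  app n := ↾fun T ↦ T.1 j

/-- The simplicial set of natural families is an enrichment of the category of simplicial
sections. -/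
instance : EnrichedCategory SSet.{w} (SimplicialSection φ M) where
  Hom s t := Map s t
  id s :=
    { app n := ↾fun _ ↦ ⟨fun j ↦ sId (s.obj j) n, IsNatural.id s n⟩
      naturality _ _ θ := by
        ext ⟨⟩
        exact Subtype.ext (funext fun j ↦ (map_sId (s.obj j) θ).symm) }
  comp s t r :=
    { app n := ↾fun p ↦ ⟨fun j ↦ sComp (p.1.1 j) (p.2.1 j), p.1.2.comp p.2.2⟩
      naturality _ _ θ := by
        ext ⟨T, T'⟩
        exact Subtype.ext (funext fun j ↦ (map_sComp θ (T.1 j) (T'.1 j)).symm) }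
  id_comp s t := by
    ext n T
    exact Subtype.ext (funext fun j ↦ sId_sComp (T.1 j))
  comp_id s t := by
    ext n T
    exact Subtype.ext (funext fun j ↦ sComp_sId (T.1 j))
  assoc s t r q := by
    ext n ⟨T, T', T''⟩
    exact Subtype.ext (funext fun j ↦ sComp_assoc (T.1 j) (T'.1 j) (T''.1 j))

/-- Morphisms of simplicial sections identify with the vertices of the mapping spaces. -/
def homEquiv (s t : SimplicialSection φ M) : (s ⟶ t) ≃ (𝟙_ SSet.{w} ⟶ (s ⟶[SSet.{w}] t)) where
  toFun f :=
    { app n := ↾fun _ ↦ ⟨fun j ↦ sHomOf (f.app j) n, fun m θ j j' γ ↦ by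
        rw [map_sHomOf, map_sHomOf]
        exact f.naturality γ⟩
      naturality _ _ θ := by
        ext ⟨⟩
        exact Subtype.ext (funext fun j ↦ (map_sHomOf (f.app j) θ).symm) }
  invFun x :=
    { app j := (eHomEquiv SSet.{w}).symm (x ≫ Map.ev s t j)
      naturality n j j' γ := by
        have h (j : J) : sHomOf ((eHomEquiv SSet.{w}).symm (x ≫ Map.ev s t j)) n =
            (x.app n PUnit.unit).1 j :=
          ConcreteCategory.congr_hom (NatTrans.congr_app
            (Equiv.apply_symm_apply (eHomEquiv SSet.{w}) (x ≫ Map.ev s t j)) n) PUnit.unit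
        rw [h, h]
        have := (x.app n PUnit.unit).2 (𝟙 n) γ
        rwa [Functor.map_id_apply, Functor.map_id_apply] at this }
  left_inv f := Hom.ext (funext fun j ↦ (Equiv.symm_apply_eq _).2 rfl)
  right_inv x := by
    ext n ⟨⟩
    exact Subtype.ext (funext fun j ↦ ConcreteCategory.congr_hom (NatTrans.congr_app
      (Equiv.apply_symm_apply (eHomEquiv SSet.{w}) (x ≫ Map.ev s t j)) n) PUnit.unit)

/-- The category of simplicial sections is a simplicial category. -/
instance : SimplicialCategory (SimplicialSection φ M) where
  homEquiv {s t} := homEquiv s t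
  homEquiv_id s := by
    ext n ⟨⟩
    exact Subtype.ext (funext fun j ↦ sHomOf_id (s.obj j) n)
  homEquiv_comp f g := by
    ext n ⟨⟩
    exact Subtype.ext (funext fun j ↦ sHomOf_comp (f.app j) (g.app j) n)

end SimplicialSection

/-- The simplicial subset `Map^α(j, j')` of `Map(j, j')` which is the preimage of `α`. -/
def mapOver (φ : EnrichedFunctor SSet.{w} J (Disc I)) {j j' : J}
    (α : (φ.obj j).as ⟶ (φ.obj j').as) : (j ⟶[SSet.{w}] j').Subcomplex where
  obj n := { γ | (φ.map j j').app n γ = α }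
  map {n m} θ γ hγ := by
    have h : (φ.map j j').app n γ = α := hγ
    have h' := NatTrans.naturality_apply (φ.map j j') θ γ
    exact h'.trans h

namespace SimplicialSection

/-- The condition that `η : X ⟶ s(j)` exhibits the section `s` as the free section `s_{j, X}`,
i.e. for every `j'` the maps `Map^α(j, j') ⊗ α_! X ⟶ Map^α(j, j') ⊗ α_! s(j) ⟶ s(j')` (induced
by `η` and by the action of `s`) exhibit `s(j')` as the coproduct
`∐_{α : φ j ⟶ φ j'} Map^α(j, j') ⊗ α_! X`. -/
def IsFreeSection {j : J} {X : M.obj (φ.obj j).as} {s : SimplicialSection φ M}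
    (η : X ⟶ s.obj j) : Prop :=
  ∀ (j' : J) (T : ∀ α : (φ.obj j).as ⟶ (φ.obj j').as,
      SimplicialTensor ((mapOver φ α : (j ⟶[SSet.{w}] j').Subcomplex) : SSet.{w}) (M.push α X)),
    ∃ c : ∀ α, (T α).obj ⟶ s.obj j',
      (∀ α (n : SimplexCategoryᵒᵖ) (γ : ((mapOver φ α) : SSet.{w}).obj n),
        Total.mk' (A := ⟨(φ.obj j).as, X⟩) (B := ⟨(φ.obj j').as, s.obj j'⟩) α
          (sComp ((T α).unit.app n γ) (sHomOf (c α) n)) =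
            Total.pre (sHomOf η n) (s.act γ.1)) ∧
      Nonempty (IsColimit (Cofan.mk (s.obj j') c))

variable (φ M)

/-- The levelwise weak equivalences between simplicial sections. -/
def levelwiseWeakEquivalences : MorphismProperty (SimplicialSection φ M) :=
  fun _ _ T ↦ ∀ j, weakEquivalences _ ((ev φ M j).map T)

/-- The levelwise fibrations between simplicial sections. -/
def levelwiseFibrations : MorphismProperty (SimplicialSection φ M) :=
  fun _ _ T ↦ ∀ j, fibrations _ ((ev φ M j).map T)

end SimplicialSection

end Sections

end SimplicialSections

open SimplicialSections

/-
Weighted (co)limits of simplicial sections are computed levelwise: for colimits because the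
simplicial left adjoints `α_!` preserve weighted colimits, for limits because an action on the
vertices is induced by the universal property. So sections are tensored, cotensored and cocomplete,
and the section with values `∐_α Map^α(j, k) ⊗ α_! X` is free on `X` at `j`.

The evaluation functors are jointly conservative and preserve colimits. Together with their left
adjoints they give local presentability and transfer the generating (trivial) cofibrations. The
acyclicity condition holds because, by (SM7), the free map on a trivial cofibration is levelwise a
trivial cofibration. For sections, (SM7) amounts to a property of the maps
`X ^ L ⟶ X ^ K ×_{Y ^ K} Y ^ L`, which are computed levelwise.
-/

universe v v'

namespace SimplicialSections

section Simplices

lemma app_map {K L : SSet.{w}} (f : K ⟶ L) {n m : SimplexCategoryᵒᵖ} (θ : n ⟶ m) (x : K.obj n) :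
    f.app m (K.map θ x) = L.map θ (f.app n x) :=
  NatTrans.naturality_apply f θ x

lemma hom_ext_of_app {K L : SSet.{w}} {f g : K ⟶ L} (h : ∀ n x, f.app n x = g.app n x) :
    f = g :=
  NatTrans.ext (funext fun n ↦ ConcreteCategory.hom_ext _ _ (h n))

/-- A map of simplicial sets given by its action on simplices. -/
def ofSimplices {K L : SSet.{w}} (f : ∀ ⦃n⦄, K.obj n → L.obj n)
    (h : ∀ ⦃n m⦄ (θ : n ⟶ m) (x : K.obj n),
      L.map θ (f x) = f (K.map θ x)) : K ⟶ L where
  app n := ↾(@f n)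
  naturality _ _ θ := ConcreteCategory.hom_ext _ _ fun x ↦ (h θ x).symm

/-- An injectivity property of a map out of a simplicial set which holds for maps from arbitrary
simplicial sets holds for simplices, by the Yoneda lemma. -/
lemma eq_of_forall_hom_eq {K : SSet.{w}} {p : ∀ {n : SimplexCategoryᵒᵖ}, K.obj n → K.obj n → Prop}
    (h : ∀ (L : SSet.{w}) (f g : L ⟶ K), (∀ n l, p (f.app n l) (g.app n l)) → f = g)
    {n : SimplexCategoryᵒᵖ} {a b : K.obj n}
    (hab : ∀ (m : SimplexCategoryᵒᵖ) (θ : n ⟶ m), p (K.map θ a) (K.map θ b)) : a = b := by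
  apply SSet.yonedaEquiv.symm.injective
  exact h _ _ _ fun m l ↦ hab m (SSet.stdSimplex.objEquiv l).op

variable {C : Type u} [Category.{w} C] [SimplicialCategory C]

lemma sHomOf_eHomEquiv_symm {X Y : C} (f : 𝟙_ SSet.{w} ⟶ (X ⟶[SSet.{w}] Y))
    (n : SimplexCategoryᵒᵖ) : sHomOf ((eHomEquiv SSet.{w}).symm f) n = f.app n PUnit.unit := by
  rw [sHomOf, Equiv.apply_symm_apply]

lemma sComp_sHomOf_injective {X Y Z : C} (e : X ⟶ Y) [IsIso e] (n : SimplexCategoryᵒᵖ) :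
    Function.Injective fun f : (Y ⟶[SSet.{w}] Z).obj n ↦ sComp (sHomOf e n) f :=
  Function.LeftInverse.injective (g := sComp (sHomOf (inv e) n)) fun f ↦ by
    rw [← sComp_assoc, ← sHomOf_comp, IsIso.inv_hom_id, sHomOf_id, sId_sComp]

lemma exists_sHomOf_eq {X Y : C} (a : ∀ n, (X ⟶[SSet.{w}] Y).obj n)
    (ha : ∀ ⦃n m : SimplexCategoryᵒᵖ⦄ (θ : n ⟶ m), (X ⟶[SSet.{w}] Y).map θ (a n) = a m) :
    ∃ f : X ⟶ Y, ∀ n, sHomOf f n = a n := by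
  let g : 𝟙_ SSet.{w} ⟶ (X ⟶[SSet.{w}] Y) := ofSimplices (fun n _ ↦ a n) fun _ _ θ _ ↦ ha θ
  exact ⟨(eHomEquiv SSet.{w}).symm g, sHomOf_eHomEquiv_symm g⟩

end Simplices

section WeightedColimits

variable {K : Type v} [Category.{v'} K] {C : Type u} [Category.{w} C] [SimplicialCategory C]

/-- A cocone with vertex `P` on the diagram `F` weighted by `W`, i.e. a natural transformation
`W ⟶ Map(F(-), P)`. It is given on `n`-simplices. -/
structure WeightedCocone (W : Kᵒᵖ ⥤ SSet.{w}) (F : K ⥤ C) (P : C) where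
  /-- the action of the natural transformation on simplices -/
  app (k : K) {n : SimplexCategoryᵒᵖ} (x : (W.obj (op k)).obj n) :
    (F.obj k ⟶[SSet.{w}] P).obj n
  map_app (k : K) {n m : SimplexCategoryᵒᵖ} (θ : n ⟶ m) (x : (W.obj (op k)).obj n) :
    (F.obj k ⟶[SSet.{w}] P).map θ (app k x) = app k ((W.obj (op k)).map θ x)
  naturality {k k' : K} (f : k ⟶ k') {n : SimplexCategoryᵒᵖ} (x : (W.obj (op k')).obj n) :
    app k ((W.map f.op).app n x) = sComp (sHomOf (F.map f) n) (app k' x)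

namespace WeightedCocone

variable {W : Kᵒᵖ ⥤ SSet.{w}} {F : K ⥤ C} {P Y : C}

@[ext]
lemma ext {s t : WeightedCocone W F P}
    (h : ∀ k {n : SimplexCategoryᵒᵖ} (x : (W.obj (op k)).obj n), s.app k x = t.app k x) :
    s = t := by
  cases s; cases t; congr; ext; exact h ..

/-- The composition of a weighted cocone with a morphism out of its vertex. -/
def postcomp (u : WeightedCocone W F P) (f : P ⟶ Y) : WeightedCocone W F Y where
  app k n x := sComp (u.app k x) (sHomOf f n)
  map_app k _ _ θ x := by rw [map_sComp, u.map_app, map_sHomOf]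
  naturality φ _ x := by rw [← sComp_assoc, ← u.naturality]

/-- A weighted cocone exhibits its vertex `P` as a weighted colimit if, for every `Y`, it induces an
isomorphism from `Map(P, Y)` to the simplicial set of weighted cocones with vertex `Y`, whose maps
from `L` are the cocones weighted by `W ⊗ L`. -/
structure IsColimit (u : WeightedCocone W F P) : Prop where
  exists_desc {Y : C} {L : SSet.{w}} (s : WeightedCocone (W ⋙ tensorRight L) F Y) :
    ∃ f : L ⟶ (P ⟶[SSet.{w}] Y), ∀ (k : K) {n : SimplexCategoryᵒᵖ} (x : (W.obj (op k)).obj n)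
      (l : L.obj n), sComp (u.app k x) (f.app n l) = s.app k (pair x l)
  simplex_ext {Y : C} {n : SimplexCategoryᵒᵖ} {a b : (P ⟶[SSet.{w}] Y).obj n}
    (h : ∀ (k : K) {m : SimplexCategoryᵒᵖ} (θ : n ⟶ m) (x : (W.obj (op k)).obj m),
      sComp (u.app k x) ((P ⟶[SSet.{w}] Y).map θ a) =
        sComp (u.app k x) ((P ⟶[SSet.{w}] Y).map θ b)) : a = b

namespace IsColimit

variable {u : WeightedCocone W F P}

lemma hom_ext (hu : u.IsColimit) {f g : P ⟶ Y} (h : u.postcomp f = u.postcomp g) : f = g :=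
  sHomOf_ext fun n ↦ hu.simplex_ext fun k m θ x ↦ by
    rw [map_sHomOf, map_sHomOf]
    exact congrArg (fun s ↦ s.app k x) h

lemma exists_postcomp_eq (hu : u.IsColimit) (s : WeightedCocone W F Y) :
    ∃ f : P ⟶ Y, u.postcomp f = s := by
  obtain ⟨f, hf⟩ := hu.exists_desc (L := 𝟙_ SSet.{w})
    { app k n x := s.app k x.1
      map_app k _ _ θ x := s.map_app k θ x.1
      naturality φ _ x := s.naturality φ x.1 }
  refine ⟨(eHomEquiv SSet.{w}).symm f, ext fun k n x ↦ ?_⟩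
  exact (congrArg (sComp _) (sHomOf_eHomEquiv_symm f n)).trans (hf k x PUnit.unit)

end IsColimit

variable {D : Type u₁} [Category.{w} D] [SimplicialCategory D]

/-- The image of a weighted cocone under a simplicial functor. -/
def map (u : WeightedCocone W F P) (G : EnrichedFunctor SSet.{w} C D) :
    WeightedCocone W (F ⋙ underlying G) (G.obj P) where
  app k n x := sMap G (u.app k x)
  map_app k _ _ θ x := by
    rw [← u.map_app]
    exact map_sMap G θ _
  naturality f n x := by
    rw [u.naturality, sMap_sComp]
    exact congrArg₂ sComp (sHomOf_underlying_map G (F.map f) n).symm rfl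

end WeightedCocone

end WeightedColimits

namespace SimplicialAdjunction

variable {C : Type u} [Category.{w} C] [SimplicialCategory C]
  {D : Type u₁} [Category.{w} D] [SimplicialCategory D]
  {G : EnrichedFunctor SSet.{w} C D} {R : EnrichedFunctor SSet.{w} D C}

lemma homIso_hom_sComp (adj : SimplicialAdjunction G R) {X X' : C} {Y : D}
    {n : SimplexCategoryᵒᵖ} (f : (X ⟶[SSet.{w}] X').obj n) (g : (G.obj X' ⟶[SSet.{w}] Y).obj n) :
    (adj.homIso X Y).hom.app n (sComp (sMap G f) g) = sComp f ((adj.homIso X' Y).hom.app n g) :=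
  ConcreteCategory.congr_hom (NatTrans.congr_app (adj.naturality_left X X' Y) n) (pair f g :)

lemma homIso_hom_injective (adj : SimplicialAdjunction G R) {X : C} {Y : D}
    (n : SimplexCategoryᵒᵖ) : Function.Injective ((adj.homIso X Y).hom.app n) :=
  ((CategoryTheory.isIso_iff_bijective _).1 inferInstance).1

variable {K : Type v} [Category.{v'} K] {W : Kᵒᵖ ⥤ SSet.{w}} {F : K ⥤ C} {P : C}

lemma isColimit_map (adj : SimplicialAdjunction G R) {u : WeightedCocone W F P}
    (hu : u.IsColimit) : (u.map G).IsColimit where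
  exists_desc {Y L} s := by
    obtain ⟨f, hf⟩ := hu.exists_desc (Y := R.obj Y) (L := L)
      { app k n x := (adj.homIso (F.obj k) Y).hom.app n (s.app k x)
        map_app k _ _ θ x := by
          rw [← s.map_app]
          exact (app_map (adj.homIso (F.obj k) Y).hom θ _).symm
        naturality φ n x :=
          (congrArg _ ((s.naturality φ x).trans
            (congrArg (sComp · _) (sHomOf_underlying_map G (F.map φ) _)))).trans
            (adj.homIso_hom_sComp _ _) }
    refine ⟨f ≫ (adj.homIso P Y).inv, fun k n x l ↦ adj.homIso_hom_injective n ?_⟩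
    refine (adj.homIso_hom_sComp _ _).trans (Eq.trans ?_ (hf k x l))
    exact congrArg (sComp _) (ConcreteCategory.congr_hom
      (NatTrans.congr_app (adj.homIso P Y).inv_hom_id n) (f.app n l))
  simplex_ext {Y n a b} h := by
    refine adj.homIso_hom_injective n (hu.simplex_ext fun k m θ x ↦ ?_)
    rw [← app_map, ← app_map, ← adj.homIso_hom_sComp, ← adj.homIso_hom_sComp]
    exact congrArg _ (h k θ x)

end SimplicialAdjunction

section WeightedLimits

variable {K : Type v} [Category.{v'} K] {C : Type u} [Category.{w} C] [SimplicialCategory C]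

/-- A cone with vertex `P` on the diagram `F` weighted by `W`, i.e. a natural transformation
`W ⟶ Map(P, F(-))`. It is given on `n`-simplices. -/
structure WeightedCone (W : K ⥤ SSet.{w}) (F : K ⥤ C) (P : C) where
  /-- the action of the natural transformation on simplices -/
  app (k : K) {n : SimplexCategoryᵒᵖ} (x : (W.obj k).obj n) : (P ⟶[SSet.{w}] F.obj k).obj n
  map_app (k : K) {n m : SimplexCategoryᵒᵖ} (θ : n ⟶ m) (x : (W.obj k).obj n) :
    (P ⟶[SSet.{w}] F.obj k).map θ (app k x) = app k ((W.obj k).map θ x)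
  naturality {k k' : K} (f : k ⟶ k') {n : SimplexCategoryᵒᵖ} (x : (W.obj k).obj n) :
    app k' ((W.map f).app n x) = sComp (app k x) (sHomOf (F.map f) n)

namespace WeightedCone

variable {W : K ⥤ SSet.{w}} {F : K ⥤ C} {P Z : C}

@[ext]
lemma ext {s t : WeightedCone W F P}
    (h : ∀ k {n : SimplexCategoryᵒᵖ} (x : (W.obj k).obj n), s.app k x = t.app k x) : s = t := by
  cases s; cases t; congr; ext; exact h ..

/-- The composition of a weighted cone with a morphism into its vertex. -/
def precomp (f : Z ⟶ P) (u : WeightedCone W F P) : WeightedCone W F Z where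
  app k n x := sComp (sHomOf f n) (u.app k x)
  map_app k _ _ θ x := by rw [map_sComp, u.map_app, map_sHomOf]
  naturality φ _ x := by rw [sComp_assoc, ← u.naturality]

/-- A weighted cone exhibits its vertex `P` as a weighted limit if, for every `Z`, it induces an
isomorphism from `Map(Z, P)` to the simplicial set of weighted cones with vertex `Z`, whose maps
from `L` are the cones weighted by `W ⊗ L`. -/
structure IsLimit (u : WeightedCone W F P) : Prop where
  exists_lift {Z : C} {L : SSet.{w}} (s : WeightedCone (W ⋙ tensorRight L) F Z) :
    ∃ f : L ⟶ (Z ⟶[SSet.{w}] P), ∀ (k : K) {n : SimplexCategoryᵒᵖ} (x : (W.obj k).obj n)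
      (l : L.obj n), sComp (f.app n l) (u.app k x) = s.app k (pair x l)
  simplex_ext {Z : C} {n : SimplexCategoryᵒᵖ} {a b : (Z ⟶[SSet.{w}] P).obj n}
    (h : ∀ (k : K) {m : SimplexCategoryᵒᵖ} (θ : n ⟶ m) (x : (W.obj k).obj m),
      sComp ((Z ⟶[SSet.{w}] P).map θ a) (u.app k x) =
        sComp ((Z ⟶[SSet.{w}] P).map θ b) (u.app k x)) : a = b

namespace IsLimit

variable {u : WeightedCone W F P}

lemma hom_ext (hu : u.IsLimit) {f g : Z ⟶ P} (h : u.precomp f = u.precomp g) : f = g :=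
  sHomOf_ext fun n ↦ hu.simplex_ext fun k m θ x ↦ by
    rw [map_sHomOf, map_sHomOf]
    exact congrArg (fun s ↦ s.app k x) h

lemma exists_precomp_eq (hu : u.IsLimit) (s : WeightedCone W F Z) :
    ∃ f : Z ⟶ P, u.precomp f = s := by
  obtain ⟨f, hf⟩ := hu.exists_lift (L := 𝟙_ SSet.{w})
    { app k n x := s.app k x.1
      map_app k _ _ θ x := s.map_app k θ x.1
      naturality φ _ x := s.naturality φ x.1 }
  refine ⟨(eHomEquiv SSet.{w}).symm f, ext fun k n x ↦ ?_⟩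
  exact (congrArg (sComp · _) (sHomOf_eHomEquiv_symm f n)).trans (hf k x PUnit.unit)

end IsLimit

end WeightedCone

end WeightedLimits

section Tensors

variable {C : Type u} [Category.{w} C] [SimplicialCategory C] {K L : SSet.{w}} {X Y P : C}

/-- A family of maps `W i ⟶ Map(F i, P)`, regarded as a weighted cocone on a discrete diagram. -/
def WeightedCocone.ofDiscrete {ι : Type v} {W : (Discrete ι)ᵒᵖ ⥤ SSet.{w}} {F : Discrete ι ⥤ C}
    (f : ∀ i, W.obj (op ⟨i⟩) ⟶ (F.obj ⟨i⟩ ⟶[SSet.{w}] P)) : WeightedCocone W F P where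
  app i n x := (f i.as).app n x
  map_app i _ _ θ x := (app_map (f i.as) θ x).symm
  naturality {i i'} φ n x := by
    obtain rfl := Discrete.ext (Discrete.eq_of_hom φ)
    obtain rfl : φ = 𝟙 i := Subsingleton.elim _ _
    simp only [op_id, CategoryTheory.Functor.map_id, sHomOf_id, sId_sComp, NatTrans.id_app,
      ConcreteCategory.id_apply]

lemma WeightedCocone.exists_ofDiscrete_eq {ι : Type v} {W : (Discrete ι)ᵒᵖ ⥤ SSet.{w}}
    {F : Discrete ι ⥤ C} (u : WeightedCocone W F P) : ∃ f, ofDiscrete f = u :=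
  ⟨fun i ↦ ofSimplices (fun _ x ↦ u.app ⟨i⟩ x) fun _ _ θ x ↦ u.map_app ⟨i⟩ θ x, rfl⟩

/-- A family of maps `W i ⟶ Map(P, F i)`, regarded as a weighted cone on a discrete diagram. -/
def WeightedCone.ofDiscrete {ι : Type v} {W : Discrete ι ⥤ SSet.{w}} {F : Discrete ι ⥤ C}
    (f : ∀ i, W.obj ⟨i⟩ ⟶ (P ⟶[SSet.{w}] F.obj ⟨i⟩)) : WeightedCone W F P where
  app i n x := (f i.as).app n x
  map_app i _ _ θ x := (app_map (f i.as) θ x).symm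
  naturality {i i'} φ n x := by
    obtain rfl := Discrete.ext (Discrete.eq_of_hom φ)
    obtain rfl : φ = 𝟙 i := Subsingleton.elim _ _
    simp only [CategoryTheory.Functor.map_id, sHomOf_id, sComp_sId, NatTrans.id_app,
      ConcreteCategory.id_apply]

namespace SimplicialTensor

variable (T : SimplicialTensor K X)

lemma exists_desc (s : K ⊗ L ⟶ (X ⟶[SSet.{w}] Y)) : ∃ f : L ⟶ (T.obj ⟶[SSet.{w}] Y),
    ∀ n x l, sComp (T.unit.app n x) (f.app n l) = s.app n (pair x l) := by
  obtain ⟨f, hf⟩ := (T.bijective Y L).2 s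
  exact ⟨f, fun n x l ↦ ConcreteCategory.congr_hom (NatTrans.congr_app hf n) (pair x l :)⟩

lemma simplex_ext {n : SimplexCategoryᵒᵖ} {a b : (T.obj ⟶[SSet.{w}] Y).obj n}
    (h : ∀ (m : SimplexCategoryᵒᵖ) (θ : n ⟶ m) (x : K.obj m),
      sComp (T.unit.app m x) ((T.obj ⟶[SSet.{w}] Y).map θ a) =
        sComp (T.unit.app m x) ((T.obj ⟶[SSet.{w}] Y).map θ b)) : a = b := by
  refine eq_of_forall_hom_eq (p := fun {m} a b ↦ ∀ x : K.obj m,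
    sComp (T.unit.app m x) a = sComp (T.unit.app m x) b) (fun L f g hfg ↦ ?_) h
  exact (T.bijective Y L).1 (hom_ext_of_app fun n x ↦ hfg n x.2 x.1)

lemma exists_hom (s : K ⟶ (X ⟶[SSet.{w}] Y)) :
    ∃ f : T.obj ⟶ Y, ∀ n x, sComp (T.unit.app n x) (sHomOf f n) = s.app n x := by
  obtain ⟨f, hf⟩ := T.exists_desc ((ρ_ K).hom ≫ s)
  refine ⟨(eHomEquiv SSet.{w}).symm f, fun n x ↦ ?_⟩
  exact (congrArg (sComp _) (sHomOf_eHomEquiv_symm f n)).trans (hf n x PUnit.unit)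

lemma hom_ext {f g : T.obj ⟶ Y} (h : ∀ n x,
    sComp (T.unit.app n x) (sHomOf f n) = sComp (T.unit.app n x) (sHomOf g n)) : f = g :=
  sHomOf_ext fun n ↦ T.simplex_ext fun m θ x ↦ by
    rw [map_sHomOf, map_sHomOf, h]

/-- A weighted colimit of a diagram with a single object is a tensor. -/
def ofIsColimit {u : WeightedCocone ((Functor.const (Discrete PUnit.{w + 1})ᵒᵖ).obj K)
    ((Functor.const (Discrete PUnit.{w + 1})).obj X) P} (hu : u.IsColimit) :
    SimplicialTensor K X where
  obj := P
  unit := ofSimplices (fun _ ↦ u.app ⟨PUnit.unit⟩) fun _ _ ↦ u.map_app ⟨PUnit.unit⟩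
  bijective Y L := by
    refine ⟨fun f g h ↦ ?_, fun s ↦ ?_⟩
    · refine hom_ext_of_app fun n l ↦ hu.simplex_ext fun k m θ x ↦ ?_
      rw [← app_map, ← app_map]
      exact ConcreteCategory.congr_hom (NatTrans.congr_app h m) (pair x (L.map θ l) :)
    · obtain ⟨f, hf⟩ := hu.exists_desc (L := L) (.ofDiscrete fun _ ↦ s)
      exact ⟨f, hom_ext_of_app fun n x ↦ hf ⟨PUnit.unit⟩ x.1 x.2⟩

end SimplicialTensor

namespace SimplicialCotensor

variable (T : SimplicialCotensor K Y)

lemma exists_lift (s : L ⊗ K ⟶ (X ⟶[SSet.{w}] Y)) : ∃ f : L ⟶ (X ⟶[SSet.{w}] T.obj),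
    ∀ n l x, sComp (f.app n l) (T.counit.app n x) = s.app n (pair l x) := by
  obtain ⟨f, hf⟩ := (T.bijective X L).2 s
  exact ⟨f, fun n l x ↦ ConcreteCategory.congr_hom (NatTrans.congr_app hf n) (pair l x :)⟩

lemma simplex_ext {n : SimplexCategoryᵒᵖ} {a b : (X ⟶[SSet.{w}] T.obj).obj n}
    (h : ∀ (m : SimplexCategoryᵒᵖ) (θ : n ⟶ m) (x : K.obj m),
      sComp ((X ⟶[SSet.{w}] T.obj).map θ a) (T.counit.app m x) =
        sComp ((X ⟶[SSet.{w}] T.obj).map θ b) (T.counit.app m x)) : a = b := by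
  refine eq_of_forall_hom_eq (p := fun {m} a b ↦ ∀ x : K.obj m,
    sComp a (T.counit.app m x) = sComp b (T.counit.app m x)) (fun L f g hfg ↦ ?_) h
  exact (T.bijective X L).1 (hom_ext_of_app fun n x ↦ hfg n x.1 x.2)

lemma exists_hom (s : K ⟶ (X ⟶[SSet.{w}] Y)) :
    ∃ f : X ⟶ T.obj, ∀ n x, sComp (sHomOf f n) (T.counit.app n x) = s.app n x := by
  obtain ⟨f, hf⟩ := T.exists_lift ((λ_ K).hom ≫ s)
  refine ⟨(eHomEquiv SSet.{w}).symm f, fun n x ↦ ?_⟩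
  exact (congrArg (sComp · _) (sHomOf_eHomEquiv_symm f n)).trans (hf n PUnit.unit x)

lemma hom_ext {f g : X ⟶ T.obj} (h : ∀ n x,
    sComp (sHomOf f n) (T.counit.app n x) = sComp (sHomOf g n) (T.counit.app n x)) : f = g :=
  sHomOf_ext fun n ↦ T.simplex_ext fun m θ x ↦ by
    rw [map_sHomOf, map_sHomOf, h]

/-- A weighted limit of a diagram with a single object is a cotensor. -/
def ofIsLimit {u : WeightedCone ((Functor.const (Discrete PUnit.{w + 1})).obj K)
    ((Functor.const (Discrete PUnit.{w + 1})).obj Y) P} (hu : u.IsLimit) :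
    SimplicialCotensor K Y where
  obj := P
  counit := ofSimplices (fun _ ↦ u.app ⟨PUnit.unit⟩) fun _ _ ↦ u.map_app ⟨PUnit.unit⟩
  bijective X L := by
    refine ⟨fun f g h ↦ ?_, fun s ↦ ?_⟩
    · refine hom_ext_of_app fun n l ↦ hu.simplex_ext fun k m θ x ↦ ?_
      rw [← app_map, ← app_map]
      exact ConcreteCategory.congr_hom (NatTrans.congr_app h m) (pair (L.map θ l) x :)
    · obtain ⟨f, hf⟩ := hu.exists_lift (L := L) (.ofDiscrete fun _ ↦ (β_ _ _).hom ≫ s)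
      exact ⟨f, hom_ext_of_app fun n x ↦ hf ⟨PUnit.unit⟩ x.2 x.1⟩

end SimplicialCotensor

end Tensors

section Existence

variable {K : Type v} [Category.{v'} K] {C : Type u} [Category.{w} C] [SimplicialCategory C]

namespace WeightedCocone

variable {W : Kᵒᵖ ⥤ SSet.{w}} {F : K ⥤ C} {P : C}

/-- In a cotensored simplicial category, the universal property of a weighted colimit need only be
checked on morphisms: apply it to the cotensors `Y ^ L`. -/
lemma isColimit_of_bijective_postcomp
    (hC : ∀ (L : SSet.{w}) (Y : C), Nonempty (SimplicialCotensor L Y)) {u : WeightedCocone W F P}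
    (hu : ∀ Y, Function.Bijective fun f : P ⟶ Y ↦ u.postcomp f) : u.IsColimit where
  exists_desc {Y L} s := by
    obtain ⟨T⟩ := hC L Y
    have (k : K) := T.exists_lift
      (ofSimplices (fun _ ↦ s.app k) fun _ _ ↦ s.map_app k)
    choose g hg using this
    obtain ⟨f, hf⟩ := (hu T.obj).2
      { app k n x := (g k).app n x
        map_app k _ _ θ x := (app_map (g k) θ x).symm
        naturality {k k'} φ n x := by
          refine T.simplex_ext fun m θ l ↦ ?_
          rw [← app_map, ← app_map, map_sComp, ← app_map, map_sHomOf, sComp_assoc]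
          exact (hg k m _ l).trans ((s.naturality φ _).trans
            (congrArg (sComp _) (hg k' m _ l)).symm) }
    refine ⟨T.counit ≫ eHomWhiskerRight SSet.{w} f Y, fun k n x l ↦ ?_⟩
    refine (sComp_assoc _ _ _).symm.trans (Eq.trans ?_ (hg k n x l))
    exact congrArg (sComp · (T.counit.app n l)) (congrArg (fun s ↦ s.app k x) hf)
  simplex_ext {Y n a b} h := by
    refine eq_of_forall_hom_eq (p := fun {m} a b ↦ ∀ k (x : (W.obj (op k)).obj m),
      sComp (u.app k x) a = sComp (u.app k x) b) (fun L f g hfg ↦ ?_) (fun m θ k x ↦ h k θ x)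
    obtain ⟨T⟩ := hC L Y
    obtain ⟨f', hf'⟩ := T.exists_hom f
    obtain ⟨g', hg'⟩ := T.exists_hom g
    have hfg' : f' = g' := (hu T.obj).1 (ext fun k n x ↦ T.simplex_ext fun m θ l ↦ by
      simp only [postcomp, map_sComp, map_sHomOf, sComp_assoc, hf', hg', u.map_app]
      exact hfg m l k _)
    refine hom_ext_of_app fun n l ↦ ?_
    rw [← hf', ← hg', hfg']

end WeightedCocone

namespace WeightedCone

variable {W : K ⥤ SSet.{w}} {F : K ⥤ C} {P : C}

/-- In a tensored simplicial category, the universal property of a weighted limit need only be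
checked on morphisms: apply it to the tensors `L ⊗ Z`. -/
lemma isLimit_of_bijective_precomp
    (hC : ∀ (L : SSet.{w}) (Z : C), Nonempty (SimplicialTensor L Z)) {u : WeightedCone W F P}
    (hu : ∀ Z, Function.Bijective fun f : Z ⟶ P ↦ u.precomp f) : u.IsLimit where
  exists_lift {Z L} s := by
    obtain ⟨T⟩ := hC L Z
    have (k : K) := T.exists_desc
      (ofSimplices (fun _ x ↦ s.app k (pair x.2 x.1)) fun _ _ θ x ↦ s.map_app k θ (pair x.2 x.1))
    choose g hg using this
    obtain ⟨f, hf⟩ := (hu T.obj).2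
      { app k n x := (g k).app n x
        map_app k _ _ θ x := (app_map (g k) θ x).symm
        naturality {k k'} φ n x := by
          refine T.simplex_ext fun m θ l ↦ ?_
          rw [← app_map, ← app_map, map_sComp, ← app_map, map_sHomOf, ← sComp_assoc]
          exact (hg k' m l _).trans ((s.naturality φ (pair _ l)).trans
            (congrArg (sComp · _) (hg k m l _)).symm) }
    refine ⟨T.unit ≫ eHomWhiskerLeft SSet.{w} Z f, fun k n x l ↦ ?_⟩
    refine (sComp_assoc _ _ _).trans (Eq.trans ?_ (hg k n l x))
    exact congrArg (sComp (T.unit.app n l)) (congrArg (fun s ↦ s.app k x) hf)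
  simplex_ext {Z n a b} h := by
    refine eq_of_forall_hom_eq (p := fun {m} a b ↦ ∀ k (x : (W.obj k).obj m),
      sComp a (u.app k x) = sComp b (u.app k x)) (fun L f g hfg ↦ ?_) (fun m θ k x ↦ h k θ x)
    obtain ⟨T⟩ := hC L Z
    obtain ⟨f', hf'⟩ := T.exists_hom f
    obtain ⟨g', hg'⟩ := T.exists_hom g
    have hfg' : f' = g' := (hu T.obj).1 (ext fun k n x ↦ T.simplex_ext fun m θ l ↦ by
      simp only [precomp, map_sComp, map_sHomOf, ← sComp_assoc, hf', hg', u.map_app]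
      exact hfg m l k _)
    refine hom_ext_of_app fun n l ↦ ?_
    rw [← hf', ← hg', hfg']

end WeightedCone

end Existence

section Existence

variable {K : Type v} [Category.{v'} K] {C : Type u} [Category.{w} C] [SimplicialCategory C]

/-- The weighted colimit is the coend of the tensors `W k ⊗ F k`. -/
theorem WeightedCocone.exists_isColimit [HasColimitsOfSize.{max v v', max v v'} C]
    (hT : ∀ (L : SSet.{w}) (X : C), Nonempty (SimplicialTensor L X))
    (hT' : ∀ (L : SSet.{w}) (Y : C), Nonempty (SimplicialCotensor L Y))
    (W : Kᵒᵖ ⥤ SSet.{w}) (F : K ⥤ C) :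
    ∃ (P : C) (u : WeightedCocone W F P), u.IsColimit := by
  let T (k k' : K) : SimplicialTensor (W.obj (op k')) (F.obj k) := (hT _ _).some
  choose a ha using fun f : Σ k k' : K, (k ⟶ k') ↦
    (T f.1 f.2.1).exists_hom (W.map f.2.2.op ≫ (T f.1 f.1).unit)
  choose b hb using fun f : Σ k k' : K, (k ⟶ k') ↦
    (T f.1 f.2.1).exists_hom
      ((T f.2.1 f.2.1).unit ≫ eHomWhiskerRight SSet.{w} (F.map f.2.2) (T f.2.1 f.2.1).obj)
  let D : MultispanIndex ⟨Σ k k' : K, (k ⟶ k'), K, fun f ↦ f.1, fun f ↦ f.2.1⟩ C :=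
    { left f := (T f.1 f.2.1).obj, right k := (T k k).obj, fst := a, snd := b }
  let u : WeightedCocone W F (multicoequalizer D) :=
    { app k n x := sComp ((T k k).unit.app n x) (sHomOf (Multicoequalizer.π D k) n)
      map_app k _ _ θ x := by rw [map_sComp, map_sHomOf, app_map]
      naturality {k k'} f n x := by
        have h := congrArg (fun g ↦ sComp ((T k k').unit.app n x) (sHomOf g n))
          (Multicoequalizer.condition D ⟨k, k', f⟩)
        simp only [sHomOf_comp, ← sComp_assoc] at h ⊢
        exact (congrArg (sComp · _) (ha ⟨k, k', f⟩ n x)).symm.trans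
          (h.trans (congrArg (sComp · _) (hb ⟨k, k', f⟩ n x))) }
  refine ⟨_, u, isColimit_of_bijective_postcomp hT' fun Y ↦ ⟨fun f g h ↦ ?_, fun s ↦ ?_⟩⟩
  · refine Multicoequalizer.hom_ext D _ _ fun k ↦ (T k k).hom_ext fun n x ↦ ?_
    simp only [sHomOf_comp, ← sComp_assoc]
    exact congrArg (fun s ↦ s.app k x) h
  · choose c hc using fun k ↦
      (T k k).exists_hom (ofSimplices (fun _ ↦ s.app k) fun _ _ ↦ s.map_app k)
    refine ⟨Multicoequalizer.desc D Y c fun f ↦ (T f.1 f.2.1).hom_ext fun n x ↦ ?_,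
      WeightedCocone.ext fun k n x ↦ ?_⟩
    · simp only [sHomOf_comp, ← sComp_assoc]
      refine (congrArg (sComp · _) (ha f n x)).trans (Eq.trans ?_
        (congrArg (sComp · _) (hb f n x)).symm)
      exact (hc f.1 n _).trans ((s.naturality f.2.2 x).trans
        ((congrArg (sComp _) (hc f.2.1 n x)).symm.trans (sComp_assoc _ _ _).symm))
    · refine (sComp_assoc _ _ _).trans ?_
      rw [← sHomOf_comp, Multicoequalizer.π_desc]
      exact hc k n x

/-- The weighted limit is the end of the cotensors `F k ^ W k`. -/
theorem WeightedCone.exists_isLimit {K : Type v} [SmallCategory K] [FinCategory K]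
    [HasFiniteLimits C]
    (hT : ∀ (L : SSet.{w}) (X : C), Nonempty (SimplicialTensor L X))
    (hT' : ∀ (L : SSet.{w}) (Y : C), Nonempty (SimplicialCotensor L Y))
    (W : K ⥤ SSet.{w}) (F : K ⥤ C) :
    ∃ (P : C) (u : WeightedCone W F P), u.IsLimit := by
  let T (k k' : K) : SimplicialCotensor (W.obj k) (F.obj k') := (hT' _ _).some
  choose a ha using fun f : Σ k k' : K, (k ⟶ k') ↦
    (T f.1 f.2.1).exists_hom
      ((T f.1 f.1).counit ≫ eHomWhiskerLeft SSet.{w} (T f.1 f.1).obj (F.map f.2.2))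
  choose b hb using fun f : Σ k k' : K, (k ⟶ k') ↦
    (T f.1 f.2.1).exists_hom (W.map f.2.2 ≫ (T f.2.1 f.2.1).counit)
  let A : MulticospanShape := ⟨K, Σ k k' : K, (k ⟶ k'), fun f ↦ f.1, fun f ↦ f.2.1⟩
  have : Fintype A.L := inferInstanceAs (Fintype K)
  have : Fintype A.R := inferInstanceAs (Fintype (Σ k k' : K, (k ⟶ k')))
  classical
  let D : MulticospanIndex A C :=
    { left k := (T k k).obj, right f := (T f.1 f.2.1).obj, fst := a, snd := b }
  let u : WeightedCone W F (multiequalizer D) :=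
    { app k n x := sComp (sHomOf (Multiequalizer.ι D k) n) ((T k k).counit.app n x)
      map_app k _ _ θ x := by rw [map_sComp, map_sHomOf, app_map]
      naturality {k k'} f n x := by
        have h := congrArg (fun g ↦ sComp (sHomOf g n) ((T k k').counit.app n x))
          (Multiequalizer.condition D ⟨k, k', f⟩)
        simp only [sHomOf_comp, sComp_assoc] at h ⊢
        exact (congrArg (sComp _) (hb ⟨k, k', f⟩ n x)).symm.trans
          (h.symm.trans (congrArg (sComp _) (ha ⟨k, k', f⟩ n x))) }
  refine ⟨_, u, isLimit_of_bijective_precomp hT fun Z ↦ ⟨fun f g h ↦ ?_, fun s ↦ ?_⟩⟩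
  · refine Multiequalizer.hom_ext D _ _ fun k ↦ (T k k).hom_ext fun n x ↦ ?_
    simp only [sHomOf_comp, sComp_assoc]
    exact congrArg (fun s ↦ s.app k x) h
  · choose c hc using fun k ↦
      (T k k).exists_hom (ofSimplices (fun _ ↦ s.app k) fun _ _ ↦ s.map_app k)
    refine ⟨Multiequalizer.lift D Z c fun f ↦ (T f.1 f.2.1).hom_ext fun n x ↦ ?_,
      WeightedCone.ext fun k n x ↦ ?_⟩
    · simp only [sHomOf_comp, sComp_assoc]
      refine (congrArg (sComp _) (ha f n x)).trans (Eq.trans ?_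
        (congrArg (sComp _) (hb f n x)).symm)
      exact (sComp_assoc _ _ _).symm.trans ((congrArg (sComp · _) (hc f.1 n x)).trans
        ((s.naturality f.2.2 x).symm.trans (hc f.2.1 n _).symm))
    · refine (sComp_assoc _ _ _).symm.trans ?_
      rw [← sHomOf_comp, Multiequalizer.lift_ι]
      exact hc k n x

end Existence

section Conical

variable {K : Type v} [Category.{v'} K] {C : Type u} [Category.{w} C] [SimplicialCategory C]
  {F : K ⥤ C} {P : C}

/-- A cocone, regarded as a cocone weighted by the constant weight. -/
def WeightedCocone.ofCocone (c : Cocone F) :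
    WeightedCocone ((Functor.const Kᵒᵖ).obj (𝟙_ SSet.{w})) F c.pt where
  app k n _ := sHomOf (c.ι.app k) n
  map_app k _ _ θ _ := map_sHomOf _ θ
  naturality f n _ := by rw [← sHomOf_comp, c.w]

lemma WeightedCocone.exists_ofCocone_eq
    (u : WeightedCocone ((Functor.const Kᵒᵖ).obj (𝟙_ SSet.{w})) F P) :
    ∃ ι : F ⟶ (Functor.const K).obj P, ofCocone ⟨P, ι⟩ = u := by
  choose ι hι using fun k ↦ exists_sHomOf_eq (fun n ↦ u.app k (n := n) PUnit.unit)
    fun _ _ θ ↦ u.map_app k θ PUnit.unit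
  refine ⟨{ app := ι, naturality k k' f := sHomOf_ext fun n ↦ ?_ }, ext fun k n _ ↦ hι k n⟩
  refine (sHomOf_comp _ _ _).trans ?_
  rw [hι, ← u.naturality]
  exact (hι k n).symm.trans (congrArg (sHomOf · n) (Category.comp_id _).symm)

lemma WeightedCocone.IsColimit.nonempty_isColimit {c : Cocone F} (h : (ofCocone c).IsColimit) :
    Nonempty (Limits.IsColimit c) := by
  choose d hd using fun s : Cocone F ↦ h.exists_postcomp_eq (ofCocone s)
  refine ⟨{ desc := d, fac s k := sHomOf_ext fun n ↦ ?_, uniq s m hm := h.hom_ext ?_ }⟩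
  · rw [sHomOf_comp]
    exact congrArg (fun t ↦ t.app k (n := n) PUnit.unit) (hd s)
  · rw [hd]
    exact ext fun k n x ↦ (sHomOf_comp _ _ _).symm.trans (congrArg (sHomOf · n) (hm k))

/-- A cone, regarded as a cone weighted by the constant weight. -/
def WeightedCone.ofCone (c : Cone F) :
    WeightedCone ((Functor.const K).obj (𝟙_ SSet.{w})) F c.pt where
  app k n _ := sHomOf (c.π.app k) n
  map_app k _ _ θ _ := map_sHomOf _ θ
  naturality f n _ := by rw [← sHomOf_comp, c.w]

lemma WeightedCone.exists_ofCone_eq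
    (u : WeightedCone ((Functor.const K).obj (𝟙_ SSet.{w})) F P) :
    ∃ π : (Functor.const K).obj P ⟶ F, ofCone ⟨P, π⟩ = u := by
  choose π hπ using fun k ↦ exists_sHomOf_eq (fun n ↦ u.app k (n := n) PUnit.unit)
    fun _ _ θ ↦ u.map_app k θ PUnit.unit
  refine ⟨{ app := π, naturality k k' f := sHomOf_ext fun n ↦ ?_ }, ext fun k n _ ↦ hπ k n⟩
  refine Eq.trans ?_ (sHomOf_comp _ _ _).symm
  rw [hπ, ← u.naturality]
  exact (congrArg (sHomOf · n) (Category.id_comp _)).trans (hπ k' n)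

lemma WeightedCone.IsLimit.nonempty_isLimit {c : Cone F} (h : (ofCone c).IsLimit) :
    Nonempty (Limits.IsLimit c) := by
  choose d hd using fun s : Cone F ↦ h.exists_precomp_eq (ofCone s)
  refine ⟨{ lift := d, fac s k := sHomOf_ext fun n ↦ ?_, uniq s m hm := h.hom_ext ?_ }⟩
  · rw [sHomOf_comp]
    exact congrArg (fun t ↦ t.app k (n := n) PUnit.unit) (hd s)
  · rw [hd]
    exact ext fun k n x ↦ (sHomOf_comp _ _ _).symm.trans (congrArg (sHomOf · n) (hm k))

end Conical

section Actions

variable {I : Type u₁} [Category.{w} I] {J : Type w} [EnrichedCategory SSet.{w} J]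
  {φ : EnrichedFunctor SSet.{w} J (Disc I)} {M : SimplicialQuillenPresheaf.{w, u} I}

lemma Total.mk'_injective {A B : Total M} {n : SimplexCategoryᵒᵖ} (α : A.base ⟶ B.base) :
    Function.Injective (Total.mk' (A := A) (B := B) (n := n) α) :=
  fun _ _ h ↦ eq_of_heq (Sigma.mk.inj h).2

lemma Total.mk'_cast {A B : Total M} {n : SimplexCategoryᵒᵖ} (x : (Total.Map A B).obj n)
    {α : A.base ⟶ B.base} (h : x.1 = α) : Total.mk' α (h ▸ x.2) = x := by
  subst h
  rfl

variable (φ) in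
/-- The identity of `j`, as a simplex of the part of `Map(j, j)` lying over the identity. -/
def mapOverId (j : J) (n : SimplexCategoryᵒᵖ) :
    (mapOver φ (𝟙 (φ.obj j).as) : SSet.{w}).obj n :=
  ⟨sId j n, sMap_sId φ j n⟩

lemma map_mapOverId (j : J) {n m : SimplexCategoryᵒᵖ} (θ : n ⟶ m) :
    (mapOver φ (𝟙 (φ.obj j).as) : SSet.{w}).map θ (mapOverId φ j n) = mapOverId φ j m :=
  Subtype.ext (map_sId j θ)

variable {j j' j'' : J} {α : (φ.obj j).as ⟶ (φ.obj j').as}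
  {β : (φ.obj j').as ⟶ (φ.obj j'').as} {αβ : (φ.obj j).as ⟶ (φ.obj j'').as}

/-- The composition of simplices lying over `α` and over `β`. -/
def mapOverComp (h : α ≫ β = αβ) {n : SimplexCategoryᵒᵖ} (γ : (mapOver φ α : SSet.{w}).obj n)
    (δ : (mapOver φ β : SSet.{w}).obj n) : (mapOver φ αβ : SSet.{w}).obj n :=
  ⟨sComp γ.1 δ.1, (sMap_sComp φ γ.1 δ.1).trans ((congrArg₂ (· ≫ ·) γ.2 δ.2).trans h)⟩

lemma map_mapOverComp (h : α ≫ β = αβ) {n m : SimplexCategoryᵒᵖ} (θ : n ⟶ m)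
    (γ : (mapOver φ α : SSet.{w}).obj n) (δ : (mapOver φ β : SSet.{w}).obj n) :
    (mapOver φ αβ : SSet.{w}).map θ (mapOverComp h γ δ) =
      mapOverComp h ((mapOver φ α : SSet.{w}).map θ γ) ((mapOver φ β : SSet.{w}).map θ δ) :=
  Subtype.ext (map_sComp θ γ.1 δ.1)

lemma mapOverId_mapOverComp {n : SimplexCategoryᵒᵖ} (γ : (mapOver φ α : SSet.{w}).obj n) :
    mapOverComp (Category.id_comp α) (mapOverId φ j n) γ = γ :=
  Subtype.ext (sId_sComp γ.1)

lemma mapOverComp_mapOverId {n : SimplexCategoryᵒᵖ} (γ : (mapOver φ α : SSet.{w}).obj n) :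
    mapOverComp (Category.comp_id α) γ (mapOverId φ j' n) = γ :=
  Subtype.ext (sComp_sId γ.1)

namespace SimplicialSection

variable (s : SimplicialSection φ M)

lemma act_fst {n : SimplexCategoryᵒᵖ} (γ : (mapOver φ α : SSet.{w}).obj n) :
    (s.act γ.1).1 = α :=
  (ConcreteCategory.congr_hom (NatTrans.congr_app (s.map_proj _ _) n) γ.1 :).trans γ.2

/-- The action `Map^α(j, j') ⟶ Map(α_! s(j), s(j'))` of a simplicial section. -/
def actOver (α : (φ.obj j).as ⟶ (φ.obj j').as) :
    (mapOver φ α : SSet.{w}) ⟶ (M.push α (s.obj j) ⟶[SSet.{w}] s.obj j') :=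
  ofSimplices (fun _ γ ↦ s.act_fst γ ▸ (s.act γ.1).2) fun n m θ γ ↦ by
    apply Total.mk'_injective (A := ⟨(φ.obj j).as, s.obj j⟩) (B := ⟨(φ.obj j').as, s.obj j'⟩)
    rw [← Total.map_mk', Total.mk'_cast, Total.mk'_cast]
    exact (app_map (s.map j j') θ γ.1).symm

lemma mk'_actOver {n : SimplexCategoryᵒᵖ} (γ : (mapOver φ α : SSet.{w}).obj n) :
    Total.mk' (A := ⟨(φ.obj j).as, s.obj j⟩) (B := ⟨(φ.obj j').as, s.obj j'⟩) α
      ((s.actOver α).app n γ) = s.act γ.1 :=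
  Total.mk'_cast _ (s.act_fst γ)

lemma actOver_mapOverId (j : J) (n : SimplexCategoryᵒᵖ) :
    (s.actOver (𝟙 _)).app n (mapOverId φ j n) = sHomOf (M.idHom _ (s.obj j)) n := by
  apply Total.mk'_injective (A := ⟨(φ.obj j).as, s.obj j⟩) (B := ⟨(φ.obj j).as, s.obj j⟩)
  rw [mk'_actOver]
  exact ConcreteCategory.congr_hom (NatTrans.congr_app (s.map_id j) n) PUnit.unit

lemma actOver_mapOverComp (h : α ≫ β = αβ) {n : SimplexCategoryᵒᵖ}
    (γ : (mapOver φ α : SSet.{w}).obj n) (δ : (mapOver φ β : SSet.{w}).obj n) :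
    (s.actOver αβ).app n (mapOverComp h γ δ) =
      sComp (sHomOf (M.compHom α β αβ h (s.obj j)) n)
        (sComp (M.pushMap β ((s.actOver α).app n γ)) ((s.actOver β).app n δ)) := by
  apply Total.mk'_injective (A := ⟨(φ.obj j).as, s.obj j⟩) (B := ⟨(φ.obj j'').as, s.obj j''⟩)
  rw [mk'_actOver]
  refine Eq.trans ?_ (Total.comp_mk' (A := ⟨(φ.obj j).as, s.obj j⟩)
    (B := ⟨(φ.obj j').as, s.obj j'⟩) (C := ⟨(φ.obj j'').as, s.obj j''⟩) α β αβ h _ _)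
  rw [mk'_actOver, mk'_actOver]
  exact ConcreteCategory.congr_hom (NatTrans.congr_app (s.map_comp j j' j'') n) (pair γ.1 δ.1 :)

lemma pushMap_sComp_actOver_mapOverId {X : M.obj (φ.obj j).as} {n : SimplexCategoryᵒᵖ}
    (p : (X ⟶[SSet.{w}] s.obj j).obj n) :
    sComp (M.pushMap (𝟙 _) p) ((s.actOver (𝟙 _)).app n (mapOverId φ j n)) =
      sComp (sHomOf (M.idHom _ X) n) p := by
  rw [actOver_mapOverId, M.idHom_nat]

lemma pushMap_sComp_actOver_mapOverComp (h : α ≫ β = αβ) {X : M.obj (φ.obj j).as}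
    {n : SimplexCategoryᵒᵖ} (p : (X ⟶[SSet.{w}] s.obj j).obj n)
    (γ : (mapOver φ α : SSet.{w}).obj n) (δ : (mapOver φ β : SSet.{w}).obj n) :
    sComp (M.pushMap αβ p) ((s.actOver αβ).app n (mapOverComp h γ δ)) =
      sComp (sHomOf (M.compHom α β αβ h X) n)
        (sComp (M.pushMap β (sComp (M.pushMap α p) ((s.actOver α).app n γ)))
          ((s.actOver β).app n δ)) := by
  rw [actOver_mapOverComp, ← sComp_assoc, M.compHom_nat, M.pushMap_sComp]
  simp only [sComp_assoc]

lemma sComp_comp_eq_pushMap_sComp_actOver {X : M.obj (φ.obj j).as} {X' : M.obj (φ.obj j').as}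
    {X'' : M.obj (φ.obj j'').as} {n : SimplexCategoryᵒᵖ}
    {p : (X ⟶[SSet.{w}] s.obj j).obj n} {p' : (X' ⟶[SSet.{w}] s.obj j').obj n}
    {p'' : (X'' ⟶[SSet.{w}] s.obj j'').obj n} {a : (M.push α X ⟶[SSet.{w}] X').obj n}
    {b : (M.push β X' ⟶[SSet.{w}] X'').obj n} {γ : (mapOver φ α : SSet.{w}).obj n}
    {δ : (mapOver φ β : SSet.{w}).obj n}
    (ha : sComp a p' = sComp (M.pushMap α p) ((s.actOver α).app n γ))
    (hb : sComp b p'' = sComp (M.pushMap β p') ((s.actOver β).app n δ)) (h : α ≫ β = αβ) :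
    sComp (sComp (sHomOf (M.compHom α β αβ h X) n) (sComp (M.pushMap β a) b)) p'' =
      sComp (M.pushMap αβ p) ((s.actOver αβ).app n (mapOverComp h γ δ)) := by
  rw [pushMap_sComp_actOver_mapOverComp, ← ha, M.pushMap_sComp]
  simp only [sComp_assoc, hb]

lemma actOver_sComp_eq_pushMap_sComp_comp {X : M.obj (φ.obj j).as} {X' : M.obj (φ.obj j').as}
    {X'' : M.obj (φ.obj j'').as} {n : SimplexCategoryᵒᵖ}
    {p : (s.obj j ⟶[SSet.{w}] X).obj n} {p' : (s.obj j' ⟶[SSet.{w}] X').obj n}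
    {p'' : (s.obj j'' ⟶[SSet.{w}] X'').obj n} {a : (M.push α X ⟶[SSet.{w}] X').obj n}
    {b : (M.push β X' ⟶[SSet.{w}] X'').obj n} {γ : (mapOver φ α : SSet.{w}).obj n}
    {δ : (mapOver φ β : SSet.{w}).obj n}
    (ha : sComp (M.pushMap α p) a = sComp ((s.actOver α).app n γ) p')
    (hb : sComp (M.pushMap β p') b = sComp ((s.actOver β).app n δ) p'') (h : α ≫ β = αβ) :
    sComp ((s.actOver αβ).app n (mapOverComp h γ δ)) p'' = sComp (M.pushMap αβ p)
      (sComp (sHomOf (M.compHom α β αβ h X) n) (sComp (M.pushMap β a) b)) := by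
  have hpush := congrArg (M.pushMap β) ha
  rw [M.pushMap_sComp, M.pushMap_sComp] at hpush
  rw [actOver_mapOverComp, sComp_assoc, sComp_assoc, ← hb, ← sComp_assoc (M.pushMap β _), ← hpush,
    ← sComp_assoc (M.pushMap αβ p), M.compHom_nat]
  simp only [sComp_assoc]

variable {s} {t : SimplicialSection φ M}

lemma post_eq_pre_iff {n : SimplexCategoryᵒᵖ} (γ : (mapOver φ α : SSet.{w}).obj n)
    (f : (s.obj j' ⟶[SSet.{w}] t.obj j').obj n) (g : (s.obj j ⟶[SSet.{w}] t.obj j).obj n) :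
    Total.post (s.act γ.1) f = Total.pre g (t.act γ.1) ↔
      sComp ((s.actOver α).app n γ) f = sComp (M.pushMap α g) ((t.actOver α).app n γ) := by
  rw [← s.mk'_actOver γ, ← t.mk'_actOver γ]
  exact (Total.mk'_injective (A := ⟨(φ.obj j).as, s.obj j⟩)
    (B := ⟨(φ.obj j').as, t.obj j'⟩) α).eq_iff

lemma isNatural_iff {n : SimplexCategoryᵒᵖ} {T : ∀ j, (s.obj j ⟶[SSet.{w}] t.obj j).obj n} :
    IsNatural T ↔ ∀ ⦃m : SimplexCategoryᵒᵖ⦄ (θ : n ⟶ m) ⦃j j' : J⦄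
      (α : (φ.obj j).as ⟶ (φ.obj j').as) (γ : (mapOver φ α : SSet.{w}).obj m),
      sComp ((s.actOver α).app m γ) ((s.obj j' ⟶[SSet.{w}] t.obj j').map θ (T j')) =
        sComp (M.pushMap α ((s.obj j ⟶[SSet.{w}] t.obj j).map θ (T j)))
          ((t.actOver α).app m γ) :=
  ⟨fun hT _ θ _ _ _ γ ↦ (post_eq_pre_iff γ _ _).1 (hT θ γ.1),
    fun hT _ θ _ _ γ ↦ (post_eq_pre_iff ⟨γ, rfl⟩ _ _).2 (hT θ _ ⟨γ, rfl⟩)⟩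

lemma IsNatural.actOver_comp {n : SimplexCategoryᵒᵖ}
    {T : ∀ j, (s.obj j ⟶[SSet.{w}] t.obj j).obj n} (hT : IsNatural T)
    (α : (φ.obj j).as ⟶ (φ.obj j').as) (γ : (mapOver φ α : SSet.{w}).obj n) :
    sComp ((s.actOver α).app n γ) (T j') =
      sComp (M.pushMap α (T j)) ((t.actOver α).app n γ) := by
  simpa only [map_id_apply] using isNatural_iff.1 hT (𝟙 n) α γ

lemma Hom.actOver_comp (f : s ⟶ t) (α : (φ.obj j).as ⟶ (φ.obj j').as) {n : SimplexCategoryᵒᵖ}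
    (γ : (mapOver φ α : SSet.{w}).obj n) :
    sComp ((s.actOver α).app n γ) (sHomOf (f.app j') n) =
      sComp (M.pushMap α (sHomOf (f.app j) n)) ((t.actOver α).app n γ) :=
  (post_eq_pre_iff γ _ _).1 (f.naturality γ.1)

/-- The morphism of simplicial sections with prescribed components. -/
def Hom.ofActOver (f : ∀ j, s.obj j ⟶ t.obj j)
    (h : ∀ ⦃j j' : J⦄ (α : (φ.obj j).as ⟶ (φ.obj j').as) ⦃n : SimplexCategoryᵒᵖ⦄
      (γ : (mapOver φ α : SSet.{w}).obj n),
      sComp ((s.actOver α).app n γ) (sHomOf (f j') n) =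
        sComp (M.pushMap α (sHomOf (f j) n)) ((t.actOver α).app n γ)) : s ⟶ t :=
  Hom.mk f fun _ _ _ γ ↦ (post_eq_pre_iff ⟨γ, rfl⟩ _ _).2 (h _ ⟨γ, rfl⟩)

variable (φ M) in
/-- The data of maps `Map^α(j, j') ⟶ Map(α_! X(j), X(j'))` which turn a family `X` of objects into
a simplicial section. -/
structure Action (X : ∀ j : J, M.obj (φ.obj j).as) where
  /-- the action of the simplices over `α` -/
  hom {j j' : J} (α : (φ.obj j).as ⟶ (φ.obj j').as) :
    (mapOver φ α : SSet.{w}) ⟶ (M.push α (X j) ⟶[SSet.{w}] X j')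
  hom_id (j : J) (n : SimplexCategoryᵒᵖ) :
    (hom (𝟙 _)).app n (mapOverId φ j n) = sHomOf (M.idHom _ (X j)) n
  hom_comp {j j' j'' : J} (α : (φ.obj j).as ⟶ (φ.obj j').as) (β : (φ.obj j').as ⟶ (φ.obj j'').as)
    {n : SimplexCategoryᵒᵖ} (γ : (mapOver φ α : SSet.{w}).obj n)
    (δ : (mapOver φ β : SSet.{w}).obj n) :
    (hom (α ≫ β)).app n (mapOverComp rfl γ δ) = sComp (sHomOf (M.compHom α β _ rfl (X j)) n)
      (sComp (M.pushMap β ((hom α).app n γ)) ((hom β).app n δ))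

namespace Action

variable {X : ∀ j : J, M.obj (φ.obj j).as} (a : Action φ M X)

lemma mk'_hom_congr {n : SimplexCategoryᵒᵖ} {γ γ' : (j ⟶[SSet.{w}] j').obj n}
    (e : γ = γ') {α' : (φ.obj j).as ⟶ (φ.obj j').as} (h : γ ∈ (mapOver φ α).obj n)
    (h' : γ' ∈ (mapOver φ α').obj n) :
    Total.mk' (A := ⟨(φ.obj j).as, X j⟩) (B := ⟨(φ.obj j').as, X j'⟩) α
      ((a.hom α).app n ⟨γ, h⟩) = Total.mk' α' ((a.hom α').app n ⟨γ', h'⟩) := by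
  subst e
  obtain rfl : α = α' := Eq.trans (Eq.symm h) h'
  rfl

/-- The simplicial section given by an action. -/
def toSection : SimplicialSection φ M where
  obj := X
  map j j' := ofSimplices (fun n γ ↦ Total.mk' (A := ⟨(φ.obj j).as, X j⟩)
    (B := ⟨(φ.obj j').as, X j'⟩) _ ((a.hom ((φ.map j j').app n γ)).app n ⟨γ, rfl⟩))
    fun n m θ γ ↦ by
      refine (congrArg (Total.mk' _) (app_map (a.hom _) θ ⟨γ, rfl⟩).symm).trans ?_
      exact a.mk'_hom_congr rfl _ _
  map_id j := hom_ext_of_app fun n _ ↦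
    (a.mk'_hom_congr rfl _ (sMap_sId φ j n)).trans (congrArg (Total.mk' _) (a.hom_id j n))
  map_comp j j' j'' := hom_ext_of_app fun n ⟨γ, δ⟩ ↦
    (a.mk'_hom_congr rfl _ (sMap_sComp φ γ δ)).trans
      (congrArg (Total.mk' _) (a.hom_comp _ _ ⟨γ, rfl⟩ ⟨δ, rfl⟩))
  map_proj _ _ := rfl

lemma toSection_actOver (α : (φ.obj j).as ⟶ (φ.obj j').as) :
    a.toSection.actOver α = a.hom α := by
  refine hom_ext_of_app fun n γ ↦ ?_
  apply Total.mk'_injective (A := ⟨(φ.obj j).as, X j⟩) (B := ⟨(φ.obj j').as, X j'⟩)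
  exact (a.toSection.mk'_actOver γ).trans (a.mk'_hom_congr rfl _ _)

end Action

end SimplicialSection

end Actions

section Levelwise

variable {I : Type u₁} [Category.{w} I] {J : Type w} [EnrichedCategory SSet.{w} J]
  {φ : EnrichedFunctor SSet.{w} J (Disc I)} {M : SimplicialQuillenPresheaf.{w, u} I}
  {K : Type v} [Category.{v'} K] {s : SimplicialSection φ M} {X : ∀ j : J, M.obj (φ.obj j).as}

open SimplicialSection

namespace WeightedCocone

variable {W : Kᵒᵖ ⥤ SSet.{w}} {F : K ⥤ SimplicialSection φ M}

/-- The evaluation of a weighted cocone of simplicial sections. -/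
def eval (u : WeightedCocone W F s) (j : J) : WeightedCocone W (F ⋙ ev φ M j) (s.obj j) where
  app k _ x := (u.app k x).1 j
  map_app k _ _ θ x := congrArg (fun T ↦ T.1 j) (u.map_app k θ x)
  naturality f _ x := congrArg (fun T ↦ T.1 j) (u.naturality f x)

/-- The image of a weighted cocone on the values at `j` under the left adjoint `α_!`. -/
abbrev push {j j' : J} (α : (φ.obj j).as ⟶ (φ.obj j').as) {P : M.obj (φ.obj j).as}
    (u : WeightedCocone W (F ⋙ ev φ M j) P) :
    WeightedCocone W ((F ⋙ ev φ M j) ⋙ underlying (M.map α).left) (M.push α P) :=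
  u.map (M.map α).left

lemma IsColimit.push {j j' : J} {P : M.obj (φ.obj j).as}
    {u : WeightedCocone W (F ⋙ ev φ M j) P} (hu : u.IsColimit)
    (α : (φ.obj j).as ⟶ (φ.obj j').as) : (u.push α).IsColimit :=
  (M.map α).adj.isColimit_map hu

lemma isColimit_of_eval {u : WeightedCocone W F s} (hu : ∀ j, (u.eval j).IsColimit) :
    u.IsColimit where
  exists_desc {t L} c := by
    choose f hf using fun j ↦ (hu j).exists_desc (eval (W := W ⋙ tensorRight L) c j)
    have natural {n : SimplexCategoryᵒᵖ} (l : L.obj n) :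
        IsNatural (s := s) (t := t) fun j ↦ (f j).app n l := by
      refine isNatural_iff.2 fun m θ j j' α γ ↦ ((hu j).push α).simplex_ext ?_
      intro k p θ' x
      rw [← app_map, ← app_map, map_sComp, map_sComp, ← app_map, ← app_map, ← app_map,
        M.map_pushMap, ← app_map]
      refine (sComp_assoc _ _ _).symm.trans <| (congrArg (sComp · _)
        ((u.app k x).2.actOver_comp α _).symm).trans <| (sComp_assoc _ _ _).trans <|
        (congrArg (sComp _) (hf j' k x _)).trans <|
        ((c.app k _).2.actOver_comp α _).trans ?_
      refine Eq.trans ?_ (sComp_assoc _ _ _)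
      exact congrArg (sComp · _) ((congrArg (M.pushMap α) (hf j k x _).symm).trans
        (M.pushMap_sComp α _ _))
    exact ⟨ofSimplices (fun n l ↦ ⟨fun j ↦ (f j).app n l, natural l⟩) fun n m θ l ↦
      Subtype.ext (funext fun j ↦ (app_map (f j) θ l).symm),
      fun k n x l ↦ Subtype.ext (funext fun j ↦ hf j k x l)⟩
  simplex_ext {t n a b} h := Subtype.ext <| funext fun j ↦ (hu j).simplex_ext fun k _ θ x ↦
    congrArg (fun T ↦ T.1 j) (h k θ x)

lemma exists_pushAction {j j' : J} (α : (φ.obj j).as ⟶ (φ.obj j').as) {P : M.obj (φ.obj j).as}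
    {P' : M.obj (φ.obj j').as} {u : WeightedCocone W (F ⋙ ev φ M j) P} (hu : u.IsColimit)
    (u' : WeightedCocone W (F ⋙ ev φ M j') P') :
    ∃ a : (mapOver φ α : SSet.{w}) ⟶ (M.push α P ⟶[SSet.{w}] P'),
      ∀ k {n : SimplexCategoryᵒᵖ} (x : (W.obj (op k)).obj n) (γ : (mapOver φ α : SSet.{w}).obj n),
        sComp (M.pushMap α (u.app k x)) (a.app n γ) =
          sComp (((F.obj k).actOver α).app n γ) (u'.app k x) :=
  (hu.push α).exists_desc (L := (mapOver φ α : SSet.{w}))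
    { app k n p := sComp (((F.obj k).actOver α).app n p.2) (u'.app k p.1)
      map_app k n m θ p := by
        refine (map_sComp θ _ _).trans ?_
        exact congrArg₂ sComp (app_map _ θ _).symm (u'.map_app k θ p.1)
      naturality {k k'} f n p := by
        refine (congrArg (sComp _) (u'.naturality f p.1)).trans <| (sComp_assoc _ _ _).symm.trans <|
          (congrArg (sComp · _) ((F.map f).actOver_comp α p.2)).trans <|
          (sComp_assoc _ _ _).trans ?_
        exact congrArg (sComp · _)
          (sHomOf_underlying_map (M.map α).left ((F.map f).app j) n).symm }

/-- The values of a levelwise weighted colimit of simplicial sections carry a canonical action,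
because the functors `α_!` preserve weighted colimits. -/
lemma exists_action {u : ∀ j, WeightedCocone W (F ⋙ ev φ M j) (X j)} (hu : ∀ j, (u j).IsColimit) :
    ∃ a : Action φ M X, ∀ {j j' : J} (α : (φ.obj j).as ⟶ (φ.obj j').as) k {n : SimplexCategoryᵒᵖ}
      (x : (W.obj (op k)).obj n) (γ : (mapOver φ α : SSet.{w}).obj n),
      sComp (M.pushMap α ((u j).app k x)) ((a.hom α).app n γ) =
        sComp (((F.obj k).actOver α).app n γ) ((u j').app k x) := by
  choose a ha using fun (j j' : J) (α : (φ.obj j).as ⟶ (φ.obj j').as) ↦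
    exists_pushAction α (hu j) (u j')
  refine ⟨{ hom := a _ _, hom_id := fun j n ↦ ?_, hom_comp := fun {j j' j''} α β n γ δ ↦ ?_ },
    fun {j j'} ↦ ha j j'⟩
  · refine ((hu j).push (𝟙 _)).simplex_ext fun k m θ x ↦ ?_
    rw [← app_map, map_mapOverId, map_sHomOf]
    refine (ha _ _ _ k x _).trans <| Eq.trans ?_ (M.idHom_nat _).symm
    exact congrArg (sComp · _) ((F.obj k).actOver_mapOverId j m)
  · refine ((hu j).push (α ≫ β)).simplex_ext fun k m θ x ↦ ?_
    rw [← app_map, map_mapOverComp, map_sComp, map_sComp, map_sHomOf, M.map_pushMap,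
      ← app_map, ← app_map]
    generalize (mapOver φ α : SSet.{w}).map θ γ = γ
    generalize (mapOver φ β : SSet.{w}).map θ δ = δ
    exact (ha _ _ _ k x _).trans
      ((F.obj k).actOver_sComp_eq_pushMap_sComp_comp (ha _ _ α k x γ) (ha _ _ β k x δ) rfl)

theorem exists_isColimit_eval
    (h : ∀ j, ∃ (P : M.obj (φ.obj j).as) (u : WeightedCocone W (F ⋙ ev φ M j) P), u.IsColimit) :
    ∃ (s : SimplicialSection φ M) (u : WeightedCocone W F s), ∀ j, (u.eval j).IsColimit := by
  choose P u hu using h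
  obtain ⟨a, ha⟩ := exists_action hu
  refine ⟨a.toSection,
    { app k n x := ⟨fun j ↦ (u j).app k x, isNatural_iff.2 fun m θ j j' α γ ↦ ?_⟩
      map_app k _ _ θ x := Subtype.ext (funext fun j ↦ (u j).map_app k θ x)
      naturality f _ x := Subtype.ext (funext fun j ↦ (u j).naturality f x) }, hu⟩
  rw [a.toSection_actOver]
  refine (congrArg (sComp _) ((u j').map_app k θ x)).trans <| (ha α k _ γ).symm.trans ?_
  exact congrArg (fun y ↦ sComp (M.pushMap α y) _) ((u j).map_app k θ x).symm

end WeightedCocone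

namespace WeightedCone

variable {W : K ⥤ SSet.{w}} {F : K ⥤ SimplicialSection φ M}

/-- The evaluation of a weighted cone of simplicial sections. -/
def eval (u : WeightedCone W F s) (j : J) : WeightedCone W (F ⋙ ev φ M j) (s.obj j) where
  app k _ x := (u.app k x).1 j
  map_app k _ _ θ x := congrArg (fun T ↦ T.1 j) (u.map_app k θ x)
  naturality f _ x := congrArg (fun T ↦ T.1 j) (u.naturality f x)

lemma isLimit_of_eval {u : WeightedCone W F s} (hu : ∀ j, (u.eval j).IsLimit) : u.IsLimit where
  exists_lift {t L} c := by
    choose f hf using fun j ↦ (hu j).exists_lift (eval (W := W ⋙ tensorRight L) c j)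
    have natural {n : SimplexCategoryᵒᵖ} (l : L.obj n) :
        IsNatural (s := t) (t := s) fun j ↦ (f j).app n l := by
      refine isNatural_iff.2 fun m θ j j' α γ ↦ (hu j').simplex_ext ?_
      intro k p θ' x
      rw [← app_map, ← app_map, map_sComp, map_sComp, ← app_map, ← app_map, ← app_map,
        M.map_pushMap, ← app_map]
      refine (sComp_assoc _ _ _).trans <| (congrArg (sComp _) (hf j' k x _)).trans <|
        ((c.app k _).2.actOver_comp α _).trans ?_
      refine (congrArg (sComp · _) ((congrArg (M.pushMap α) (hf j k x _).symm).trans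
        (M.pushMap_sComp α _ _))).trans ?_
      exact (sComp_assoc _ _ _).trans <| (congrArg (sComp _)
        ((u.app k x).2.actOver_comp α _).symm).trans (sComp_assoc _ _ _).symm
    exact ⟨ofSimplices (fun n l ↦ ⟨fun j ↦ (f j).app n l, natural l⟩) fun n m θ l ↦
      Subtype.ext (funext fun j ↦ (app_map (f j) θ l).symm),
      fun k n x l ↦ Subtype.ext (funext fun j ↦ hf j k x l)⟩
  simplex_ext {t n a b} h := Subtype.ext <| funext fun j ↦ (hu j).simplex_ext fun k _ θ x ↦
    congrArg (fun T ↦ T.1 j) (h k θ x)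

lemma exists_pushAction {j j' : J} (α : (φ.obj j).as ⟶ (φ.obj j').as) {P : M.obj (φ.obj j).as}
    {P' : M.obj (φ.obj j').as} (u : WeightedCone W (F ⋙ ev φ M j) P)
    {u' : WeightedCone W (F ⋙ ev φ M j') P'} (hu' : u'.IsLimit) :
    ∃ a : (mapOver φ α : SSet.{w}) ⟶ (M.push α P ⟶[SSet.{w}] P'),
      ∀ k {n : SimplexCategoryᵒᵖ} (x : (W.obj k).obj n) (γ : (mapOver φ α : SSet.{w}).obj n),
        sComp (a.app n γ) (u'.app k x) =
          sComp (M.pushMap α (u.app k x)) (((F.obj k).actOver α).app n γ) :=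
  hu'.exists_lift (L := (mapOver φ α : SSet.{w}))
    { app k n p := sComp (M.pushMap α (u.app k p.1)) (((F.obj k).actOver α).app n p.2)
      map_app k n m θ p := by
        refine (map_sComp θ _ _).trans ?_
        exact congrArg₂ sComp ((M.map_pushMap α θ _).trans
          (congrArg (M.pushMap α) (u.map_app k θ p.1))) (app_map _ θ _).symm
      naturality {k k'} f n p := by
        refine (congrArg (fun y ↦ sComp (M.pushMap α y) _) (u.naturality f p.1)).trans <|
          (congrArg (sComp · _) (M.pushMap_sComp α _ _)).trans <| (sComp_assoc _ _ _).trans <|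
          (congrArg (sComp _) ((F.map f).actOver_comp α p.2).symm).trans
            (sComp_assoc _ _ _).symm }

lemma exists_action {u : ∀ j, WeightedCone W (F ⋙ ev φ M j) (X j)} (hu : ∀ j, (u j).IsLimit) :
    ∃ a : Action φ M X, ∀ {j j' : J} (α : (φ.obj j).as ⟶ (φ.obj j').as) k {n : SimplexCategoryᵒᵖ}
      (x : (W.obj k).obj n) (γ : (mapOver φ α : SSet.{w}).obj n),
      sComp ((a.hom α).app n γ) ((u j').app k x) =
        sComp (M.pushMap α ((u j).app k x)) (((F.obj k).actOver α).app n γ) := by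
  choose a ha using fun (j j' : J) (α : (φ.obj j).as ⟶ (φ.obj j').as) ↦
    exists_pushAction α (u j) (hu j')
  refine ⟨{ hom := a _ _, hom_id := fun j n ↦ ?_, hom_comp := fun {j j' j''} α β n γ δ ↦ ?_ },
    fun {j j'} ↦ ha j j'⟩
  · refine (hu j).simplex_ext fun k m θ x ↦ ?_
    rw [← app_map, map_mapOverId, map_sHomOf]
    refine (ha _ _ _ k x _).trans <| Eq.trans ?_ (M.idHom_nat _)
    exact congrArg (sComp _) ((F.obj k).actOver_mapOverId j m)
  · refine (hu j'').simplex_ext fun k m θ x ↦ ?_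
    rw [← app_map, map_mapOverComp, map_sComp, map_sComp, map_sHomOf, M.map_pushMap,
      ← app_map, ← app_map]
    generalize (mapOver φ α : SSet.{w}).map θ γ = γ
    generalize (mapOver φ β : SSet.{w}).map θ δ = δ
    exact (ha _ _ _ k x _).trans ((F.obj k).sComp_comp_eq_pushMap_sComp_actOver
      (ha _ _ α k x γ) (ha _ _ β k x δ) rfl).symm

theorem exists_isLimit_eval
    (h : ∀ j, ∃ (P : M.obj (φ.obj j).as) (u : WeightedCone W (F ⋙ ev φ M j) P), u.IsLimit) :
    ∃ (s : SimplicialSection φ M) (u : WeightedCone W F s), ∀ j, (u.eval j).IsLimit := by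
  choose P u hu using h
  obtain ⟨a, ha⟩ := exists_action hu
  refine ⟨a.toSection,
    { app k n x := ⟨fun j ↦ (u j).app k x, isNatural_iff.2 fun m θ j j' α γ ↦ ?_⟩
      map_app k _ _ θ x := Subtype.ext (funext fun j ↦ (u j).map_app k θ x)
      naturality f _ x := Subtype.ext (funext fun j ↦ (u j).naturality f x) }, hu⟩
  rw [a.toSection_actOver]
  refine (congrArg (sComp _) ((u j').map_app k θ x)).trans <| (ha α k _ γ).trans ?_
  exact congrArg (fun y ↦ sComp (M.pushMap α y) _) ((u j).map_app k θ x).symm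

end WeightedCone

end Levelwise

namespace SimplicialSection

variable {I : Type u₁} [Category.{w} I] {J : Type w} [EnrichedCategory SSet.{w} J]
  {φ : EnrichedFunctor SSet.{w} J (Disc I)} {M : SimplicialQuillenPresheaf.{w, u} I}

section Colimits

variable {K : Type v} [Category.{v'} K] [∀ i, HasColimitsOfSize.{max v v', max v v'} (M.obj i)]

lemma exists_weightedColimit (W : Kᵒᵖ ⥤ SSet.{w}) (F : K ⥤ SimplicialSection φ M) :
    ∃ (s : SimplicialSection φ M) (u : WeightedCocone W F s), ∀ j, (u.eval j).IsColimit :=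
  WeightedCocone.exists_isColimit_eval fun _ ↦ WeightedCocone.exists_isColimit
    (M.obj _).isSimplicialModelCategory.tensored (M.obj _).isSimplicialModelCategory.cotensored _ _

lemma exists_colimitCocone (F : K ⥤ SimplicialSection φ M) : ∃ c : Cocone F,
    Nonempty (IsColimit c) ∧ ∀ j, Nonempty (IsColimit ((ev φ M j).mapCocone c)) := by
  obtain ⟨s, u, hu⟩ := exists_weightedColimit ((Functor.const Kᵒᵖ).obj (𝟙_ SSet.{w})) F
  obtain ⟨ι, rfl⟩ := u.exists_ofCocone_eq
  exact ⟨⟨s, ι⟩, (WeightedCocone.isColimit_of_eval hu).nonempty_isColimit, fun j ↦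
    WeightedCocone.IsColimit.nonempty_isColimit (c := (ev φ M j).mapCocone ⟨s, ι⟩) (hu j)⟩

end Colimits

section

variable [∀ i, HasColimitsOfSize.{w, w} (M.obj i)]

instance : HasColimitsOfSize.{w, w} (SimplicialSection φ M) where
  has_colimits_of_shape _ _ := ⟨fun F ↦ by
    obtain ⟨c, ⟨hc⟩, -⟩ := exists_colimitCocone F
    exact ⟨⟨c, hc⟩⟩⟩

instance (j : J) : PreservesColimitsOfSize.{w, w} (ev φ M j) where
  preservesColimitsOfShape := ⟨fun {F} ↦ by
    obtain ⟨c, ⟨hc⟩, hc'⟩ := exists_colimitCocone F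
    exact preservesColimit_of_preserves_colimit_cocone hc (hc' j).some⟩

end

section Limits

variable {K : Type v} [SmallCategory K] [FinCategory K]

lemma exists_weightedLimit (W : K ⥤ SSet.{w}) (F : K ⥤ SimplicialSection φ M) :
    ∃ (s : SimplicialSection φ M) (u : WeightedCone W F s), ∀ j, (u.eval j).IsLimit :=
  WeightedCone.exists_isLimit_eval fun _ ↦ WeightedCone.exists_isLimit
    (M.obj _).isSimplicialModelCategory.tensored (M.obj _).isSimplicialModelCategory.cotensored _ _

instance : HasFiniteLimits (SimplicialSection φ M) where
  out _ _ _ := ⟨fun F ↦ by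
    obtain ⟨s, u, hu⟩ := exists_weightedLimit ((Functor.const _).obj (𝟙_ SSet.{w})) F
    obtain ⟨π, rfl⟩ := u.exists_ofCone_eq
    obtain ⟨h⟩ := (WeightedCone.isLimit_of_eval hu).nonempty_isLimit
    exact ⟨⟨_, h⟩⟩⟩

end Limits

lemma nonempty_simplicialTensor [∀ i, HasColimitsOfSize.{w, w} (M.obj i)] (K : SSet.{w})
    (s : SimplicialSection φ M) : Nonempty (SimplicialTensor K s) :=
  have ⟨_, _, hu⟩ := exists_weightedColimit ((Functor.const (Discrete PUnit)ᵒᵖ).obj K)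
    ((Functor.const (Discrete PUnit)).obj s)
  ⟨.ofIsColimit (WeightedCocone.isColimit_of_eval hu)⟩

lemma nonempty_simplicialCotensor (K : SSet.{w}) (s : SimplicialSection φ M) :
    Nonempty (SimplicialCotensor K s) :=
  have ⟨_, _, hu⟩ := exists_weightedLimit ((Functor.const (Discrete PUnit)).obj K)
    ((Functor.const (Discrete PUnit)).obj s)
  ⟨.ofIsLimit (WeightedCone.isLimit_of_eval hu)⟩

variable (φ M) in
lemma jointlyReflectIsomorphisms_ev : JointlyReflectIsomorphisms (ev φ M) := by
  refine ⟨fun {s t} f hf ↦ ?_⟩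
  have hf' (j : J) : IsIso (Hom.app f j) := hf j
  have h (j : J) (n : SimplexCategoryᵒᵖ) :
      sComp (sHomOf (Hom.app f j) n) (sHomOf (inv (Hom.app f j)) n) = sId _ n := by
    rw [← sHomOf_comp, IsIso.hom_inv_id, sHomOf_id]
  have h' (j : J) (n : SimplexCategoryᵒᵖ) :
      sComp (sHomOf (inv (Hom.app f j)) n) (sHomOf (Hom.app f j) n) = sId _ n := by
    rw [← sHomOf_comp, IsIso.inv_hom_id, sHomOf_id]
  let g : t ⟶ s := Hom.ofActOver (fun j ↦ inv (Hom.app f j)) fun j j' α n γ ↦ by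
    rw [← sId_sComp ((t.actOver α).app n γ), ← M.pushMap_sId, ← h' j n, M.pushMap_sComp,
      sComp_assoc, sComp_assoc, ← sComp_assoc _ _ (sHomOf (inv (Hom.app f j')) n),
      ← f.actOver_comp, sComp_assoc, h, sComp_sId]
  exact ⟨g, Hom.ext (funext fun j ↦ IsIso.hom_inv_id (Hom.app f j)),
    Hom.ext (funext fun j ↦ IsIso.inv_hom_id (Hom.app f j))⟩

end SimplicialSection

section FreeSections

variable {I : Type u₁} [Category.{w} I] {J : Type w} [EnrichedCategory SSet.{w} J]
  {φ : EnrichedFunctor SSet.{w} J (Disc I)} {M : SimplicialQuillenPresheaf.{w, u} I}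

instance {i j k : I} (α : i ⟶ j) (β : j ⟶ k) (αβ : i ⟶ k) (h : α ≫ β = αβ) (X : M.obj i) :
    IsIso (M.compHom α β αβ h X) :=
  inferInstanceAs (IsIso ((M.mapComp α β αβ h).app X).hom)

instance (i : I) (X : M.obj i) : IsIso (M.idHom i X) :=
  inferInstanceAs (IsIso ((M.mapId i).app X).hom)

namespace SimplicialSection

variable {j : J} {X : M.obj (φ.obj j).as}

variable (X) in
/-- The data of maps `Map^α(j, k) ⟶ Map(α_! X, P)`, for `α : φ(j) ⟶ φ(k)`. -/
abbrev FreeCocone (k : J) (P : M.obj (φ.obj k).as) :=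
  ∀ α : (φ.obj j).as ⟶ (φ.obj k).as, (mapOver φ α : SSet.{w}) ⟶ (M.push α X ⟶[SSet.{w}] P)

namespace FreeCocone

/-- The maps exhibit `P` as the coproduct `∐ Map^α(j, k) ⊗ α_! X`. -/
def IsColimit {k : J} {P : M.obj (φ.obj k).as} (u : FreeCocone X k P) : Prop :=
  (WeightedCocone.ofDiscrete (W := (Discrete.opposite _).functor ⋙
    Discrete.functor fun α : (φ.obj j).as ⟶ (φ.obj k).as ↦ (mapOver φ α : SSet.{w}))
    (F := Discrete.functor fun α ↦ M.push α X) u).IsColimit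

lemma exists_isColimit {k : J} [HasColimitsOfSize.{w, w} (M.obj (φ.obj k).as)]
    (X : M.obj (φ.obj j).as) :
    ∃ (P : M.obj (φ.obj k).as) (u : FreeCocone X k P), u.IsColimit := by
  obtain ⟨P, u, hu⟩ := WeightedCocone.exists_isColimit
    (M.obj (φ.obj k).as).isSimplicialModelCategory.tensored
    (M.obj (φ.obj k).as).isSimplicialModelCategory.cotensored
    ((Discrete.opposite _).functor ⋙
      Discrete.functor fun α : (φ.obj j).as ⟶ (φ.obj k).as ↦ (mapOver φ α : SSet.{w}))
    (Discrete.functor fun α ↦ M.push α X)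
  obtain ⟨u, rfl⟩ := u.exists_ofDiscrete_eq
  exact ⟨P, u, hu⟩

namespace IsColimit

variable {k l : J} {β : (φ.obj k).as ⟶ (φ.obj l).as} {P : M.obj (φ.obj k).as}
  {Z : M.obj (φ.obj l).as} {u : FreeCocone X k P} (hu : u.IsColimit)
include hu

lemma exists_hom {Y : M.obj (φ.obj k).as} (v : FreeCocone X k Y) : ∃ f : P ⟶ Y,
    ∀ α n γ, sComp ((u α).app n γ) (sHomOf f n) = (v α).app n γ :=
  have ⟨f, hf⟩ := hu.exists_postcomp_eq (.ofDiscrete v)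
  ⟨f, fun α _ γ ↦ congrArg (fun s ↦ s.app ⟨α⟩ γ) hf⟩

lemma hom_ext {Y : M.obj (φ.obj k).as} {f g : P ⟶ Y} (h : ∀ α n γ,
    sComp ((u α).app n γ) (sHomOf f n) = sComp ((u α).app n γ) (sHomOf g n)) : f = g :=
  WeightedCocone.IsColimit.hom_ext hu <| WeightedCocone.ext fun ⟨α⟩ n γ ↦ h α n γ

lemma push_simplex_ext {n : SimplexCategoryᵒᵖ} {f g : (M.push β P ⟶[SSet.{w}] Z).obj n}
    {αβ : ((φ.obj j).as ⟶ (φ.obj k).as) → ((φ.obj j).as ⟶ (φ.obj l).as)}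
    (hαβ : ∀ α, α ≫ β = αβ α)
    (h : ∀ α (m : SimplexCategoryᵒᵖ) (θ : n ⟶ m) (γ : (mapOver φ α : SSet.{w}).obj m),
      sComp (sHomOf (M.compHom α β _ (hαβ α) X) m) (sComp (M.pushMap β ((u α).app m γ))
        ((M.push β P ⟶[SSet.{w}] Z).map θ f)) =
      sComp (sHomOf (M.compHom α β _ (hαβ α) X) m) (sComp (M.pushMap β ((u α).app m γ))
        ((M.push β P ⟶[SSet.{w}] Z).map θ g))) : f = g :=
  ((M.map β).adj.isColimit_map hu).simplex_ext fun ⟨α⟩ m θ γ ↦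
    sComp_sHomOf_injective (M.compHom α β _ (hαβ α) X) m (h α m θ γ)

lemma exists_pushAction (β : (φ.obj k).as ⟶ (φ.obj l).as) (v : FreeCocone X l Z) :
    ∃ a : (mapOver φ β : SSet.{w}) ⟶ (M.push β P ⟶[SSet.{w}] Z),
      ∀ {α αβ} (h : α ≫ β = αβ) {n : SimplexCategoryᵒᵖ} (γ : (mapOver φ α : SSet.{w}).obj n)
        (δ : (mapOver φ β : SSet.{w}).obj n),
        sComp (sHomOf (M.compHom α β αβ h X) n) (sComp (M.pushMap β ((u α).app n γ)) (a.app n δ)) =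
          (v αβ).app n (mapOverComp h γ δ) := by
  let c (α : (φ.obj j).as ⟶ (φ.obj k).as) : (mapOver φ α : SSet.{w}) ⊗ (mapOver φ β : SSet.{w}) ⟶
      (M.push β (M.push α X) ⟶[SSet.{w}] Z) :=
    ofSimplices (fun n p ↦ sComp (sHomOf (inv (M.compHom α β _ rfl X)) n)
      ((v (α ≫ β)).app n (mapOverComp rfl p.1 p.2))) fun n m θ p ↦ by
        rw [map_sComp, map_sHomOf, ← app_map, map_mapOverComp]
        rfl
  obtain ⟨a, ha⟩ := ((M.map β).adj.isColimit_map hu).exists_desc (L := (mapOver φ β : SSet.{w}))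
    (.ofDiscrete c)
  replace ha {α : (φ.obj j).as ⟶ (φ.obj k).as} {n : SimplexCategoryᵒᵖ}
      (γ : (mapOver φ α : SSet.{w}).obj n) (δ : (mapOver φ β : SSet.{w}).obj n) :
      sComp (M.pushMap β ((u α).app n γ)) (a.app n δ) =
        sComp (sHomOf (inv (M.compHom α β _ rfl X)) n)
          ((v (α ≫ β)).app n (mapOverComp rfl γ δ)) := ha ⟨α⟩ γ δ
  refine ⟨a, fun h n γ δ ↦ ?_⟩
  subst h
  rw [ha, ← sComp_assoc, ← sHomOf_comp, IsIso.hom_inv_id, sHomOf_id, sId_sComp]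

end IsColimit

lemma exists_action {P : ∀ k : J, M.obj (φ.obj k).as} {u : ∀ k, FreeCocone X k (P k)}
    (hu : ∀ k, (u k).IsColimit) :
    ∃ a : Action φ M P, ∀ {k l : J} {α : (φ.obj j).as ⟶ (φ.obj k).as}
      {β : (φ.obj k).as ⟶ (φ.obj l).as} {αβ : (φ.obj j).as ⟶ (φ.obj l).as} (h : α ≫ β = αβ)
      {n : SimplexCategoryᵒᵖ} (γ : (mapOver φ α : SSet.{w}).obj n)
      (δ : (mapOver φ β : SSet.{w}).obj n),
      sComp (sHomOf (M.compHom α β αβ h X) n) (sComp (M.pushMap β ((u k α).app n γ))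
        ((a.hom β).app n δ)) = (u l αβ).app n (mapOverComp h γ δ) := by
  choose a ha using fun (k l : J) (β : (φ.obj k).as ⟶ (φ.obj l).as) ↦
    (hu k).exists_pushAction β (u l)
  refine ⟨{ hom := a _ _, hom_id := fun k n ↦ ?_, hom_comp := fun {k l l'} β β' n δ ε ↦ ?_ },
    fun {k l _ β} ↦ ha k l β⟩
  · refine (hu k).push_simplex_ext Category.comp_id fun α m θ γ ↦ ?_
    rw [← app_map, map_mapOverId, map_sHomOf, ha, mapOverComp_mapOverId, M.idHom_nat,
      ← sComp_assoc, M.compHom_idHom_right, sId_sComp]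
  · refine (hu k).push_simplex_ext (fun _ ↦ rfl) fun α m θ γ ↦ ?_
    rw [← app_map, map_mapOverComp, map_sComp, map_sComp, map_sHomOf, M.map_pushMap,
      ← app_map, ← app_map]
    generalize (mapOver φ β : SSet.{w}).map θ δ = δ
    generalize (mapOver φ β' : SSet.{w}).map θ ε = ε
    rw [ha, ← sComp_assoc (M.pushMap (β ≫ β') _), M.compHom_nat, sComp_assoc, ← sComp_assoc,
      ← M.compHom_assoc α β β' (α ≫ β) (β ≫ β') _ rfl rfl (Category.assoc _ _ _) rfl,
      sComp_assoc, ← sComp_assoc (M.pushMap β' _), ← M.pushMap_sComp,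
      ← sComp_assoc (M.pushMap β' _), ← M.pushMap_sComp, sComp_assoc, ha, ha]
    exact congrArg _ (Subtype.ext (sComp_assoc _ _ _).symm)

lemma exists_unit {P : M.obj (φ.obj j).as} (u : FreeCocone X j P) : ∃ η : X ⟶ P, ∀ n,
    sComp (sHomOf (M.idHom _ X) n) (sHomOf η n) = (u (𝟙 _)).app n (mapOverId φ j n) := by
  obtain ⟨η, hη⟩ := exists_sHomOf_eq (fun n ↦
    sComp (sHomOf (inv (M.idHom _ X)) n) ((u (𝟙 _)).app n (mapOverId φ j n))) fun n m θ ↦ by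
      rw [map_sComp, map_sHomOf, ← app_map, map_mapOverId]
  refine ⟨η, fun n ↦ ?_⟩
  rw [hη, ← sComp_assoc, ← sHomOf_comp, IsIso.hom_inv_id, sHomOf_id, sId_sComp]

/-- The cocone induced by the action of a section on a map to its value at `j`. -/
def ofHom {s : SimplicialSection φ M} (η : X ⟶ s.obj j) (k : J) : FreeCocone X k (s.obj k) :=
  fun α ↦ ofSimplices (fun n γ ↦ sComp (M.pushMap α (sHomOf η n)) ((s.actOver α).app n γ))
    fun n m θ γ ↦ by rw [map_sComp, M.map_pushMap, map_sHomOf, ← app_map]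

theorem exists_isColimit_ofHom [∀ i, HasColimitsOfSize.{w, w} (M.obj i)]
    (X : M.obj (φ.obj j).as) : ∃ (s : SimplicialSection φ M) (η : X ⟶ s.obj j),
    ∀ k, (ofHom η k).IsColimit := by
  choose P u hu using fun k : J ↦ exists_isColimit (k := k) X
  obtain ⟨a, ha⟩ := exists_action hu
  obtain ⟨η, hη⟩ := exists_unit (u j)
  have h {k : J} {α : (φ.obj j).as ⟶ (φ.obj k).as} {n : SimplexCategoryᵒᵖ}
      (γ : (mapOver φ α : SSet.{w}).obj n) :
      sComp (M.pushMap α (sHomOf η n)) ((a.hom α).app n γ) = (u k α).app n γ := by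
    have := ha (Category.id_comp α) (mapOverId φ j n) γ
    rwa [← hη, M.pushMap_sComp, sComp_assoc, ← sComp_assoc, M.compHom_idHom_left, sId_sComp,
      mapOverId_mapOverComp] at this
  have h' (k : J) : ofHom (s := a.toSection) η k = u k :=
    funext fun α ↦ hom_ext_of_app fun n γ ↦
      (congrArg (fun f : (mapOver φ α : SSet.{w}) ⟶ (M.push α (P j) ⟶[SSet.{w}] P k) ↦
        sComp (M.pushMap α (sHomOf η n)) (f.app n γ)) (a.toSection_actOver α)).trans (h γ)
  exact ⟨a.toSection, η, fun k ↦ h' k ▸ hu k⟩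

lemma ofHom_app {s : SimplicialSection φ M} (η : X ⟶ s.obj j) {k : J}
    {α : (φ.obj j).as ⟶ (φ.obj k).as} {n : SimplexCategoryᵒᵖ}
    (γ : (mapOver φ α : SSet.{w}).obj n) :
    (ofHom η k α).app n γ = sComp (M.pushMap α (sHomOf η n)) ((s.actOver α).app n γ) := rfl

lemma ofHom_mapOverComp {s : SimplicialSection φ M} (η : X ⟶ s.obj j) {k l : J}
    {α : (φ.obj j).as ⟶ (φ.obj k).as} {β : (φ.obj k).as ⟶ (φ.obj l).as} {n : SimplexCategoryᵒᵖ}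
    (γ : (mapOver φ α : SSet.{w}).obj n) (δ : (mapOver φ β : SSet.{w}).obj n) :
    (ofHom η l (α ≫ β)).app n (mapOverComp rfl γ δ) = sComp (sHomOf (M.compHom α β _ rfl X) n)
      (sComp (M.pushMap β ((ofHom η k α).app n γ)) ((s.actOver β).app n δ)) :=
  s.pushMap_sComp_actOver_mapOverComp rfl _ γ δ

lemma ofHom_mapOverId {s : SimplicialSection φ M} (η : X ⟶ s.obj j) (n : SimplexCategoryᵒᵖ) :
    (ofHom η j (𝟙 _)).app n (mapOverId φ j n) = sComp (sHomOf (M.idHom _ X) n) (sHomOf η n) :=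
  s.pushMap_sComp_actOver_mapOverId _

lemma ofHom_sComp_app {s t : SimplicialSection φ M} (η : X ⟶ s.obj j) (f : s ⟶ t) {k : J}
    {α : (φ.obj j).as ⟶ (φ.obj k).as} {n : SimplexCategoryᵒᵖ}
    (γ : (mapOver φ α : SSet.{w}).obj n) :
    sComp ((ofHom η k α).app n γ) (sHomOf (Hom.app f k) n) =
      (ofHom (η ≫ Hom.app f j) k α).app n γ := by
  rw [ofHom_app, ofHom_app, sComp_assoc, Hom.actOver_comp f, sHomOf_comp, M.pushMap_sComp,
    sComp_assoc]

end FreeCocone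

variable {s : SimplicialSection φ M} {η : X ⟶ s.obj j}

open FreeCocone

lemma bijective_comp_app_of_isColimit_ofHom (hη : ∀ k, (ofHom η k).IsColimit)
    (t : SimplicialSection φ M) : Function.Bijective fun f : s ⟶ t ↦ η ≫ Hom.app f j := by
  refine ⟨fun f g (h : η ≫ Hom.app f j = η ≫ Hom.app g j) ↦ Hom.ext <| funext fun k ↦
    (hη k).hom_ext fun α n γ ↦ ?_, fun g ↦ ?_⟩
  · rw [ofHom_sComp_app, ofHom_sComp_app, h]
  · choose T hT using fun k ↦ (hη k).exists_hom (ofHom g k)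
    have hT' : η ≫ T j = g := sHomOf_ext fun n ↦ sComp_sHomOf_injective (M.idHom _ X) n <| by
      dsimp only
      rw [sHomOf_comp, ← sComp_assoc, ← ofHom_mapOverId, ← ofHom_mapOverId, hT]
    refine ⟨Hom.ofActOver T fun k l β n δ ↦ (hη k).push_simplex_ext (fun _ ↦ rfl)
      fun α m θ γ ↦ ?_, hT'⟩
    rw [map_sComp, map_sComp, map_sHomOf, M.map_pushMap, map_sHomOf, ← app_map, ← app_map,
      ← sComp_assoc (M.pushMap β _), ← sComp_assoc, ← ofHom_mapOverComp, hT,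
      ofHom_mapOverComp, ← sComp_assoc (M.pushMap β _), ← M.pushMap_sComp, hT]

lemma isFreeSection_of_isColimit_ofHom (hη : ∀ k, (ofHom η k).IsColimit) :
    IsFreeSection η := by
  intro k T
  choose c hc using fun α ↦ (T α).exists_hom (ofHom η k α)
  refine ⟨c, fun α n γ ↦ ?_, ?_⟩
  · rw [hc, ← s.mk'_actOver γ]
    rfl
  · choose d hd using fun t : Cofan (fun α ↦ (T α).obj) ↦ (hη k).exists_hom
      fun α ↦ (T α).unit ≫ eHomWhiskerLeft SSet.{w} (M.push α X) (t.inj α)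
    replace hd (t α n γ) : sComp ((ofHom η k α).app n γ) (sHomOf (d t) n) =
      sComp ((T α).unit.app n γ) (sHomOf (t.inj α) n) := hd t α n γ
    refine ⟨Cofan.IsColimit.mk _ d (fun t α ↦ (T α).hom_ext fun n γ ↦ ?_)
      fun t f hf ↦ (hη k).hom_ext fun α n γ ↦ ?_⟩
    · rw [← hd, ← hc, sComp_assoc, ← sHomOf_comp]
      rfl
    · rw [hd, ← hc, sComp_assoc, ← sHomOf_comp]
      exact congrArg (fun f ↦ sComp _ (sHomOf f n)) (hf α)

section Adjunction

variable [∀ i, HasColimitsOfSize.{w, w} (M.obj i)]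

variable (φ M) in
theorem exists_evAdjunction (j : J) : ∃ (L : M.obj (φ.obj j).as ⥤ SimplicialSection φ M)
    (adj : L ⊣ ev φ M j), ∀ X k, (ofHom (adj.unit.app X) k).IsColimit := by
  choose s η hη using exists_isColimit_ofHom (φ := φ) (M := M) (j := j)
  let e (X : M.obj (φ.obj j).as) (t : SimplicialSection φ M) :
      (s X ⟶ t) ≃ (X ⟶ (ev φ M j).obj t) :=
    .ofBijective _ (bijective_comp_app_of_isColimit_ofHom (hη X) t)
  have he (X) (t t' : SimplicialSection φ M) (f : t ⟶ t') (g : s X ⟶ t) :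
      e X t' (g ≫ f) = e X t g ≫ (ev φ M j).map f := (Category.assoc _ _ _).symm
  refine ⟨_, Adjunction.adjunctionOfEquivLeft e he, fun X k ↦ ?_⟩
  have h : (Adjunction.adjunctionOfEquivLeft e he).unit.app X = η X := by
    rw [Adjunction.adjunctionOfEquivLeft_unit_app]
    exact Category.comp_id (η X)
  exact h ▸ hη X k

end Adjunction

end SimplicialSection

end FreeSections

section SimplicialLifting

variable {C : Type u} [Category.{w} C] [SimplicialCategory C] {K L : SSet.{w}} {k : K ⟶ L}
  {A B X Y : C}

/-- The lifting property of `k : K ⟶ L` with respect to the map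
`Map(B, X) ⟶ Map(A, X) ×_{Map(A, Y)} Map(B, Y)` induced by `i : A ⟶ B` and `p : X ⟶ Y`, stated
without choosing a fiber product. -/
def HasSimplicialLifting (k : K ⟶ L) (i : A ⟶ B) (p : X ⟶ Y) : Prop :=
  ∀ (b : K ⟶ (B ⟶[SSet.{w}] X)) (a : L ⟶ (A ⟶[SSet.{w}] X)) (d : L ⟶ (B ⟶[SSet.{w}] Y)),
    k ≫ a = b ≫ eHomWhiskerRight SSet.{w} i X → k ≫ d = b ≫ eHomWhiskerLeft SSet.{w} B p →
    a ≫ eHomWhiskerLeft SSet.{w} A p = d ≫ eHomWhiskerRight SSet.{w} i Y →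
    ∃ l : L ⟶ (B ⟶[SSet.{w}] X), k ≫ l = b ∧ l ≫ eHomWhiskerRight SSet.{w} i X = a ∧
      l ≫ eHomWhiskerLeft SSet.{w} B p = d

lemma hasLiftingProperty_iff_of_isPullback {D : Type v} [Category.{v'} D] {K L P Q R S T : D}
    (k : K ⟶ L) {π : P ⟶ Q} {fst : Q ⟶ R} {snd : Q ⟶ S} {f : R ⟶ T} {g : S ⟶ T}
    (h : IsPullback fst snd f g) {r : P ⟶ R} {s : P ⟶ S} (hr : π ≫ fst = r) (hs : π ≫ snd = s) :
    HasLiftingProperty k π ↔ ∀ (b : K ⟶ P) (a : L ⟶ R) (d : L ⟶ S), k ≫ a = b ≫ r →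
      k ≫ d = b ≫ s → a ≫ f = d ≫ g → ∃ l : L ⟶ P, k ≫ l = b ∧ l ≫ r = a ∧ l ≫ s = d := by
  subst hr hs
  refine ⟨fun _ b a d hr hs hw ↦ ?_, fun H ↦ ⟨fun {b e} sq ↦ ?_⟩⟩
  · have sq : CommSq b k π (h.lift a d hw) :=
      ⟨h.hom_ext (by simpa using hr.symm) (by simpa using hs.symm)⟩
    exact ⟨sq.lift, sq.fac_left, by simp, by simp⟩
  · obtain ⟨l, hb, hr, hs⟩ := H b (e ≫ fst) (e ≫ snd) (by simp [reassoc_of% sq.w])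
      (by simp [reassoc_of% sq.w]) (by simp [h.w])
    exact ⟨⟨l, hb, h.hom_ext (by simpa using hr) (by simpa using hs)⟩⟩

lemma hasLiftingProperty_π_iff (i : A ⟶ B) (p : X ⟶ Y)
    (sq : (SimplicialCategory.sHomFunctor C).PullbackObjObj i p) :
    HasLiftingProperty k sq.π ↔ HasSimplicialLifting k i p :=
  hasLiftingProperty_iff_of_isPullback k sq.isPullback sq.π_fst sq.π_snd

/-- The maps `b` and `d` exhibit `P` as the fiber product `X ^ K ×_{Y ^ K} Y ^ L`, in the sense of
ordinary categories. -/
structure IsPullbackPower (k : K ⟶ L) (p : X ⟶ Y) {P : C} (b : K ⟶ (P ⟶[SSet.{w}] X))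
    (d : L ⟶ (P ⟶[SSet.{w}] Y)) : Prop where
  w : k ≫ d = b ≫ eHomWhiskerLeft SSet.{w} P p
  exists_lift {A : C} (b' : K ⟶ (A ⟶[SSet.{w}] X)) (d' : L ⟶ (A ⟶[SSet.{w}] Y))
    (h : k ≫ d' = b' ≫ eHomWhiskerLeft SSet.{w} A p) : ∃ f : A ⟶ P,
      b ≫ eHomWhiskerRight SSet.{w} f X = b' ∧ d ≫ eHomWhiskerRight SSet.{w} f Y = d'
  hom_ext {A : C} {f g : A ⟶ P}
    (hb : b ≫ eHomWhiskerRight SSet.{w} f X = b ≫ eHomWhiskerRight SSet.{w} g X)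
    (hd : d ≫ eHomWhiskerRight SSet.{w} f Y = d ≫ eHomWhiskerRight SSet.{w} g Y) : f = g

namespace WeightedCone

variable {E : Type v} [Category.{v'} E] {W : E ⥤ SSet.{w}} {F : E ⥤ C} {P : C}

/-- A natural transformation `W ⟶ Map(P, F(-))`, regarded as a weighted cone. -/
def ofNatTrans (τ : W ⟶ F ⋙ (SimplicialCategory.sHomFunctor C).obj (op P)) :
    WeightedCone W F P where
  app e n x := (τ.app e).app n x
  map_app e _ _ θ x := (app_map (τ.app e) θ x).symm
  naturality f n x := ConcreteCategory.congr_hom (NatTrans.congr_app (τ.naturality f) n) x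

lemma exists_ofNatTrans_eq (u : WeightedCone W F P) : ∃ τ, ofNatTrans τ = u :=
  ⟨{ app := fun e ↦ ofSimplices (fun _ x ↦ u.app e x) fun _ _ θ x ↦ u.map_app e θ x
     naturality := fun _ _ f ↦ hom_ext_of_app fun _ x ↦ u.naturality f x }, rfl⟩

end WeightedCone

namespace IsPullbackPower

variable {p : X ⟶ Y} {P : C}

lemma of_isLimit {W : ComposableArrows SSet.{w} 1} {F : ComposableArrows C 1}
    {τ : W ⟶ F ⋙ (SimplicialCategory.sHomFunctor C).obj (op P)}
    (hτ : (WeightedCone.ofNatTrans τ).IsLimit) :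
    IsPullbackPower W.hom F.hom (τ.app 0) (τ.app 1) where
  w := τ.naturality _
  exists_lift b d h := by
    obtain ⟨f, hf⟩ := hτ.exists_precomp_eq (.ofNatTrans (ComposableArrows.homMk₁ b d h))
    exact ⟨f, hom_ext_of_app fun _ x ↦ congrArg (fun c ↦ c.app 0 x) hf,
      hom_ext_of_app fun _ x ↦ congrArg (fun c ↦ c.app 1 x) hf⟩
  hom_ext hb hd := hτ.hom_ext <| WeightedCone.ext fun
    | 0, x => ConcreteCategory.congr_hom (NatTrans.congr_app hb _) x
    | 1, x => ConcreteCategory.congr_hom (NatTrans.congr_app hd _) x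

section Power

variable {u : L ⟶ (P ⟶[SSet.{w}] X)} {v : L ⟶ (P ⟶[SSet.{w}] Y)}
  (hu : IsPullbackPower (𝟙 L) p u v)
include hu

lemma exists_hom (a : L ⟶ (A ⟶[SSet.{w}] X)) :
    ∃ f : A ⟶ P, u ≫ eHomWhiskerRight SSet.{w} f X = a :=
  have ⟨f, hf, _⟩ := hu.exists_lift a _ (Category.id_comp _)
  ⟨f, hf⟩

lemma eq_comp : v = u ≫ eHomWhiskerLeft SSet.{w} P p :=
  (Category.id_comp v).symm.trans hu.w

lemma comp_whiskerRight (f : A ⟶ P) : v ≫ eHomWhiskerRight SSet.{w} f Y =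
    (u ≫ eHomWhiskerRight SSet.{w} f X) ≫ eHomWhiskerLeft SSet.{w} A p := by
  rw [hu.eq_comp, Category.assoc, Category.assoc, eHom_whisker_exchange]

lemma hom_ext_of_id {f g : A ⟶ P}
    (h : u ≫ eHomWhiskerRight SSet.{w} f X = u ≫ eHomWhiskerRight SSet.{w} g X) : f = g :=
  hu.hom_ext h <| by rw [hu.comp_whiskerRight, hu.comp_whiskerRight, h]

end Power

/-- `X ^ L` is the fiber product `X ^ L ×_{Y ^ L} Y ^ L`, so that `π` is the map
`X ^ L ⟶ X ^ K ×_{Y ^ K} Y ^ L` induced by `k` and `p`. -/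
theorem hasLiftingProperty_iff {Q : C} {u : L ⟶ (Q ⟶[SSet.{w}] X)} {v : L ⟶ (Q ⟶[SSet.{w}] Y)}
    (hu : IsPullbackPower (𝟙 L) p u v) {b : K ⟶ (P ⟶[SSet.{w}] X)} {d : L ⟶ (P ⟶[SSet.{w}] Y)}
    (h : IsPullbackPower k p b d) {π : Q ⟶ P} (hb : b ≫ eHomWhiskerRight SSet.{w} π X = k ≫ u)
    (hd : d ≫ eHomWhiskerRight SSet.{w} π Y = v) (i : A ⟶ B) :
    HasLiftingProperty i π ↔ HasSimplicialLifting k i p := by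
  have hb' {Z : C} (f : Z ⟶ Q) : b ≫ eHomWhiskerRight SSet.{w} (f ≫ π) X =
      k ≫ u ≫ eHomWhiskerRight SSet.{w} f X := by
    rw [eHomWhiskerRight_comp, reassoc_of% hb]
  have hd' {Z : C} (f : Z ⟶ Q) : d ≫ eHomWhiskerRight SSet.{w} (f ≫ π) Y =
      (u ≫ eHomWhiskerRight SSet.{w} f X) ≫ eHomWhiskerLeft SSet.{w} Z p := by
    rw [eHomWhiskerRight_comp, reassoc_of% hd, hu.comp_whiskerRight]
  refine ⟨fun _ b₁ a₁ d₁ hka hkd had ↦ ?_, fun H ↦ ⟨fun {f g} sq ↦ ?_⟩⟩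
  · obtain ⟨f, rfl⟩ := hu.exists_hom a₁
    obtain ⟨g, rfl, rfl⟩ := h.exists_lift b₁ d₁ hkd
    have sq : CommSq f i π g := ⟨h.hom_ext
      (by rw [hb', hka, eHomWhiskerRight_comp, Category.assoc])
      (by rw [hd', had, eHomWhiskerRight_comp, Category.assoc])⟩
    refine ⟨u ≫ eHomWhiskerRight SSet.{w} sq.lift X, ?_, ?_, ?_⟩
    · rw [← hb', sq.fac_right]
    · rw [Category.assoc, ← eHomWhiskerRight_comp, sq.fac_left]
    · rw [← hd', sq.fac_right]
  · obtain ⟨l, hl, hla, hld⟩ := H (b ≫ eHomWhiskerRight SSet.{w} g X)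
      (u ≫ eHomWhiskerRight SSet.{w} f X) (d ≫ eHomWhiskerRight SSet.{w} g Y)
      (by rw [← hb', sq.w, eHomWhiskerRight_comp, Category.assoc])
      (by rw [Category.assoc, reassoc_of% h.w, eHom_whisker_exchange])
      (by rw [← hd', sq.w, eHomWhiskerRight_comp, Category.assoc])
    obtain ⟨l, rfl⟩ := hu.exists_hom l
    refine ⟨⟨⟨l, hu.hom_ext_of_id ?_, h.hom_ext ?_ ?_⟩⟩⟩
    · rw [eHomWhiskerRight_comp, ← Category.assoc, hla]
    · rw [hb', hl]
    · rw [hd', hld]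

end IsPullbackPower

end SimplicialLifting

namespace IsSimplicialModelCategory

variable {C : Type u} [Category.{w} C] [SimplicialCategory C] [ModelCategory C]
  (hC : IsSimplicialModelCategory C) {K L : SSet.{w}} {k : K ⟶ L} {A B X Y : C} {i : A ⟶ B}
  {p : X ⟶ Y}
include hC

lemma hasSimplicialLifting_of_J (hk : SSet.modelCategoryQuillen.J k) (hi : cofibrations C i)
    (hp : fibrations C p) : HasSimplicialLifting k i p :=
  (hasLiftingProperty_π_iff i p (.ofHasPullback _ i p)).1 <|
    hC.kanFibration i p ⟨hi⟩ ⟨hp⟩ _ _ hk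

lemma hasSimplicialLifting_of_mono [Mono k] (hi : cofibrations C i) (hp : fibrations C p)
    (h : weakEquivalences C i ∨ weakEquivalences C p) : HasSimplicialLifting k i p := by
  have := hC.trivialKanFibration i p ⟨hi⟩ ⟨hp⟩ (h.imp (⟨·⟩) (⟨·⟩)) (.ofHasPullback _ i p)
  rw [← SSet.rlp_monomorphisms] at this
  exact (hasLiftingProperty_π_iff i p _).1 (this _ (.infer_property k))

lemma exists_comp_whisker_eq (hi : trivialCofibrations C i) (hp : fibrations C p)
    {a : L ⟶ (A ⟶[SSet.{w}] X)} {d : L ⟶ (B ⟶[SSet.{w}] Y)}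
    (h : a ≫ eHomWhiskerLeft SSet.{w} A p = d ≫ eHomWhiskerRight SSet.{w} i Y) :
    ∃ l : L ⟶ (B ⟶[SSet.{w}] X), l ≫ eHomWhiskerRight SSet.{w} i X = a ∧
      l ≫ eHomWhiskerLeft SSet.{w} B p = d := by
  have hL : IsInitial ((⊥ : L.Subcomplex) : SSet.{w}) := SSet.Subcomplex.isInitialBot
  obtain ⟨l, -, hl⟩ := hC.hasSimplicialLifting_of_mono (k := (⊥ : L.Subcomplex).ι) hi.1 hp
    (.inl hi.2) (hL.to _) a d (hL.hom_ext _ _) (hL.hom_ext _ _) h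
  exact ⟨l, hl⟩

end IsSimplicialModelCategory

namespace SimplicialSection

variable {I : Type u₁} [Category.{w} I] {J : Type w} [EnrichedCategory SSet.{w} J]
  {φ : EnrichedFunctor SSet.{w} J (Disc I)} {M : SimplicialQuillenPresheaf.{w, u} I}
  {K L : SSet.{w}} (k : K ⟶ L) {s t : SimplicialSection φ M} (p : s ⟶ t)

lemma exists_isPullbackPower : ∃ (P : SimplicialSection φ M) (b : K ⟶ (P ⟶[SSet.{w}] s))
    (d : L ⟶ (P ⟶[SSet.{w}] t)), IsPullbackPower k p b d ∧ ∀ j,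
      IsPullbackPower k (Hom.app p j) (b ≫ Map.ev P s j) (d ≫ Map.ev P t j) := by
  obtain ⟨P, u, hu⟩ := exists_weightedLimit (ComposableArrows.mk₁ k) (ComposableArrows.mk₁ p)
  obtain ⟨τ, rfl⟩ := u.exists_ofNatTrans_eq
  refine ⟨P, τ.app 0, τ.app 1, .of_isLimit (WeightedCone.isLimit_of_eval hu), fun j ↦ ?_⟩
  obtain ⟨τ', hτ'⟩ := ((WeightedCone.ofNatTrans τ).eval j).exists_ofNatTrans_eq
  have h := IsPullbackPower.of_isLimit (F := ComposableArrows.mk₁ p ⋙ ev φ M j)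
    (show (WeightedCone.ofNatTrans τ').IsLimit from hτ'.symm ▸ hu j)
  have h₀ : τ'.app 0 = τ.app 0 ≫ Map.ev P s j :=
    hom_ext_of_app fun _ x ↦ congrArg (fun c ↦ c.app 0 x) hτ'
  have h₁ : τ'.app 1 = τ.app 1 ≫ Map.ev P t j :=
    hom_ext_of_app fun _ x ↦ congrArg (fun c ↦ c.app 1 x) hτ'
  rw [h₀, h₁] at h
  exact h

/-- The morphism `π` is the map `s ^ L ⟶ s ^ K ×_{t ^ K} t ^ L` induced by `k` and `p`. -/
lemma exists_forall_hasLiftingProperty_app_iff : ∃ (Q P : SimplicialSection φ M) (π : Q ⟶ P),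
    (∀ {A B : SimplicialSection φ M} (i : A ⟶ B),
      HasLiftingProperty i π ↔ HasSimplicialLifting k i p) ∧
    ∀ j {A B : M.obj (φ.obj j).as} (i : A ⟶ B),
      HasLiftingProperty i (Hom.app π j) ↔ HasSimplicialLifting k i (Hom.app p j) := by
  obtain ⟨Q, u, v, hu, hu'⟩ := exists_isPullbackPower (𝟙 L) p
  obtain ⟨P, b, d, h, h'⟩ := exists_isPullbackPower k p
  obtain ⟨π, hb, hd⟩ := h.exists_lift (k ≫ u) v <| by rw [hu.eq_comp, Category.assoc]
  exact ⟨Q, P, π, fun i ↦ hu.hasLiftingProperty_iff h hb hd i, fun j _ _ i ↦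
    (hu' j).hasLiftingProperty_iff (h' j) (congrArg (· ≫ Map.ev _ _ j) hb)
      (congrArg (· ≫ Map.ev _ _ j) hd) i⟩

end SimplicialSection

namespace IsSimplicialModelCategory

variable {C : Type u} [Category.{w} C] [SimplicialCategory C] [ModelCategory C]
  (hC : IsSimplicialModelCategory C) {K L : SSet.{w}} {k : K ⟶ L} {P Q X Y : C} {π : Q ⟶ P}
  {p : X ⟶ Y} (hπ : ∀ {A B : C} (i : A ⟶ B), HasLiftingProperty i π ↔ HasSimplicialLifting k i p)
include hC hπ

lemma trivialFibrations_of_J (hk : SSet.modelCategoryQuillen.J k) (hp : fibrations C p) :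
    trivialFibrations C π := by
  rw [← MorphismProperty.rlp_eq_of_wfs (cofibrations C) (trivialFibrations C)]
  exact fun _ _ i hi ↦ (hπ i).2 (hC.hasSimplicialLifting_of_J hk hi hp)

lemma fibrations_of_mono [Mono k] (hp : fibrations C p) : fibrations C π := by
  rw [← MorphismProperty.rlp_eq_of_wfs (trivialCofibrations C) (fibrations C)]
  exact fun _ _ i hi ↦ (hπ i).2 (hC.hasSimplicialLifting_of_mono hi.1 hp (.inl hi.2))

lemma trivialFibrations_of_mono [Mono k] (hp : trivialFibrations C p) :
    trivialFibrations C π := by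
  rw [← MorphismProperty.rlp_eq_of_wfs (cofibrations C) (trivialFibrations C)]
  exact fun _ _ i hi ↦ (hπ i).2 (hC.hasSimplicialLifting_of_mono hi hp.1 (.inr hp.2))

end IsSimplicialModelCategory

namespace SimplicialSection

variable {I : Type u₁} [Category.{w} I] {J : Type w} [EnrichedCategory SSet.{w} J]
  {φ : EnrichedFunctor SSet.{w} J (Disc I)} {M : SimplicialQuillenPresheaf.{w, u} I}

theorem isSimplicialModelCategory_of_levelwise [∀ i, HasColimitsOfSize.{w, w} (M.obj i)]
    [ModelCategory (SimplicialSection φ M)]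
    (hW : weakEquivalences (SimplicialSection φ M) = levelwiseWeakEquivalences φ M)
    (hfib : fibrations (SimplicialSection φ M) = levelwiseFibrations φ M) :
    IsSimplicialModelCategory (SimplicialSection φ M) where
  tensored := nonempty_simplicialTensor
  cotensored := nonempty_simplicialCotensor
  kanFibration i p _ hp sq _ _ k hk := by
    obtain ⟨_, _, π, hπ, hπ'⟩ := exists_forall_hasLiftingProperty_app_iff k p
    rw [hasLiftingProperty_π_iff, ← hπ]
    have hp' : levelwiseFibrations φ M p := hfib ▸ hp.mem
    have h (j : J) := (M.obj _).isSimplicialModelCategory.trivialFibrations_of_J (hπ' j) hk (hp' j)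
    have : Fibration π := ⟨hfib ▸ fun j ↦ (h j).1⟩
    have : WeakEquivalence π := ⟨hW ▸ fun j ↦ (h j).2⟩
    infer_instance
  trivialKanFibration i p _ hp hW' sq _ _ k hk := by
    have : Mono k := SSet.modelCategoryQuillen.I_le_monomorphisms _ hk
    obtain ⟨_, _, π, hπ, hπ'⟩ := exists_forall_hasLiftingProperty_app_iff k p
    rw [hasLiftingProperty_π_iff, ← hπ]
    have hp' : levelwiseFibrations φ M p := hfib ▸ hp.mem
    have : Fibration π := ⟨hfib ▸ fun j ↦
      (M.obj _).isSimplicialModelCategory.fibrations_of_mono (hπ' j) (hp' j)⟩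
    obtain _ | hW' := hW'
    · infer_instance
    · have hW' : levelwiseWeakEquivalences φ M p := hW ▸ hW'.mem
      have : WeakEquivalence π := ⟨hW ▸ fun j ↦
        ((M.obj _).isSimplicialModelCategory.trivialFibrations_of_mono (hπ' j) ⟨hp' j, hW' j⟩).2⟩
      infer_instance

section Free

variable {j : J} {X Y : M.obj (φ.obj j).as} {s t : SimplicialSection φ M} {η : X ⟶ s.obj j}
  {θ : Y ⟶ t.obj j}

namespace FreeCocone

namespace IsColimit

variable {k : J} {P Z : M.obj (φ.obj k).as} {u : FreeCocone X k P} (hu : u.IsColimit)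
include hu

lemma exists_comp_whiskerLeft_eq (v : FreeCocone X k Z) :
    ∃ f : P ⟶ Z, ∀ α, u α ≫ eHomWhiskerLeft SSet.{w} _ f = v α :=
  have ⟨f, hf⟩ := hu.exists_hom v
  ⟨f, fun α ↦ hom_ext_of_app (hf α)⟩

lemma hom_ext_of_comp {f g : P ⟶ Z}
    (h : ∀ α, u α ≫ eHomWhiskerLeft SSet.{w} _ f = u α ≫ eHomWhiskerLeft SSet.{w} _ g) : f = g :=
  hu.hom_ext fun α n γ ↦ ConcreteCategory.congr_hom (NatTrans.congr_app (h α) n) γ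

lemma trivialCofibrations_of_comp_eq {Q : M.obj (φ.obj k).as} {v : FreeCocone Y k Q}
    (hv : v.IsColimit) {i : ∀ α, M.push α X ⟶ M.push α Y} (hi : ∀ α, trivialCofibrations _ (i α))
    {g : P ⟶ Q} (hg : ∀ α, u α ≫ eHomWhiskerLeft SSet.{w} _ g =
      v α ≫ eHomWhiskerRight SSet.{w} (i α) _) : trivialCofibrations _ g := by
  rw [← fibrations_llp]
  refine fun A B p hp ↦ ⟨fun {a b} sq ↦ ?_⟩
  choose l hla hlb using fun α ↦ (M.obj _).isSimplicialModelCategory.exists_comp_whisker_eq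
    (hi α) hp (a := u α ≫ eHomWhiskerLeft SSet.{w} _ a)
    (d := v α ≫ eHomWhiskerLeft SSet.{w} _ b) (by
      rw [Category.assoc, ← eHomWhiskerLeft_comp, sq.w, eHomWhiskerLeft_comp,
        reassoc_of% hg α, Category.assoc, eHom_whisker_exchange])
  obtain ⟨e, he⟩ := hv.exists_comp_whiskerLeft_eq l
  refine ⟨⟨⟨e, hu.hom_ext_of_comp fun α ↦ ?_, hv.hom_ext_of_comp fun α ↦ ?_⟩⟩⟩
  · rw [eHomWhiskerLeft_comp, reassoc_of% hg α, ← eHom_whisker_exchange, reassoc_of% he, hla]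
  · rw [eHomWhiskerLeft_comp, reassoc_of% he, hlb]

end IsColimit

lemma ofHom_comp_whiskerLeft_app (g : s ⟶ t) {k : J} (α : (φ.obj j).as ⟶ (φ.obj k).as) :
    ofHom η k α ≫ eHomWhiskerLeft SSet.{w} _ (Hom.app g k) = ofHom (η ≫ Hom.app g j) k α :=
  hom_ext_of_app fun _ γ ↦ ofHom_sComp_app η g γ

lemma ofHom_comp (f : X ⟶ Y) {k : J} (α : (φ.obj j).as ⟶ (φ.obj k).as) : ofHom (f ≫ θ) k α =
    ofHom θ k α ≫ eHomWhiskerRight SSet.{w} ((underlying (M.map α).left).map f) (t.obj k) := by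
  refine hom_ext_of_app fun n γ ↦ ?_
  rw [ofHom_app, sHomOf_comp, M.pushMap_sComp, sComp_assoc, ← ofHom_app]
  exact congrArg (sComp · _) (sHomOf_underlying_map (M.map α).left f n).symm

end FreeCocone

open FreeCocone

lemma trivialCofibrations_app_of_isColimit_ofHom (hη : ∀ k, (ofHom η k).IsColimit)
    (hθ : ∀ k, (ofHom θ k).IsColimit) {f : X ⟶ Y} (hf : trivialCofibrations _ f) {g : s ⟶ t}
    (hg : η ≫ Hom.app g j = f ≫ θ) (k : J) : trivialCofibrations _ (Hom.app g k) :=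
  (hη k).trivialCofibrations_of_comp_eq (hθ k)
    (fun α ↦ (M.map α).trivialCofibration_map f hf) fun α ↦ by
    rw [ofHom_comp_whiskerLeft_app, hg, ofHom_comp]
    rfl

end Free

end SimplicialSection

section LocallyPresentable

lemma exists_isRegular_forall_le {ι : Type v} [Small.{w} ι] (κ : ι → Cardinal.{w}) :
    ∃ κ' : Cardinal.{w}, κ'.IsRegular ∧ ∀ i, κ i ≤ κ' := by
  obtain ⟨κ', hκ', h⟩ := HasCardinalLT.exists_regular_cardinal_forall.{w}
    fun i ↦ (κ i).ord.ToType
  exact ⟨κ', hκ', fun i ↦ le_of_lt (by simpa [hasCardinalLT_iff_cardinal_mk_lt] using h i)⟩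

variable {C : Type u} [Category.{w} C]

lemma hasColimitsOfSize_of_isLocallyPresentable [IsLocallyPresentable.{w} C] :
    HasColimitsOfSize.{w, w} C :=
  have ⟨_, _, _⟩ := IsLocallyPresentable.exists_cardinal.{w} C
  inferInstance

lemma hasSmallObjectArgument_of_isLocallyPresentable [IsLocallyPresentable.{w} C]
    (S : MorphismProperty C) [MorphismProperty.IsSmall.{w} S] :
    MorphismProperty.HasSmallObjectArgument.{w} S := by
  have := hasColimitsOfSize_of_isLocallyPresentable (C := C)
  choose κ hκ hκ' using fun a : S.toSet ↦
    (inferInstance : IsPresentable.{w} a.1.left).exists_cardinal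
  obtain ⟨κ₀, hκ₀, hle⟩ := exists_isRegular_forall_le κ
  have : Fact κ₀.IsRegular := ⟨hκ₀⟩
  have : Nonempty κ₀.ord.ToType := by simpa using hκ₀.ne_zero
  have := WellFoundedLT.toOrderBot κ₀.ord.ToType
  refine ⟨κ₀, inferInstance, inferInstance, { preservesColimit := fun {A B X Y} i hi f hf ↦ ?_ }⟩
  have : IsCardinalPresentable A (κ ⟨Arrow.mk i, hi⟩) := hκ' ⟨Arrow.mk i, hi⟩
  have : IsCardinalPresentable A κ₀ := isCardinalPresentable_of_le A (hle ⟨Arrow.mk i, hi⟩)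
  have := (coyoneda.obj (op A)).preservesColimitsOfShape_of_isCardinalAccessible κ₀ κ₀.ord.ToType
  infer_instance

variable {ι : Type v'} {D : ι → Type v} [∀ i, Category.{w} (D i)] {F : ∀ i, D i ⥤ C}
  {G : ∀ i, C ⥤ D i} (adj : ∀ i, F i ⊣ G i) (hG : JointlyReflectIsomorphisms G) [HasEqualizers C]
include adj hG

lemma isStrongGenerator_iSup_strictMap {P : ∀ i, ObjectProperty (D i)}
    (hP : ∀ i, (P i).IsStrongGenerator) :
    (⨆ i, (P i).strictMap (F i)).IsStrongGenerator := by
  have (i : ι) : (G i).IsRightAdjoint := (adj i).isRightAdjoint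
  have hF {i : ι} {Z : D i} (hZ : P i Z) : (⨆ i, (P i).strictMap (F i)) ((F i).obj Z) :=
    le_iSup (fun i ↦ (P i).strictMap (F i)) i _ ⟨Z, hZ⟩
  rw [ObjectProperty.isStrongGenerator_iff]
  refine ⟨fun X Y f g h ↦ hG.jointlyFaithful.map_injective fun i ↦
    (hP i).isSeparating _ _ fun Z hZ x ↦ ?_, fun X Y f _ h ↦ ?_⟩
  · apply ((adj i).homEquiv _ _).symm.injective
    rw [(adj i).homEquiv_naturality_right_symm, (adj i).homEquiv_naturality_right_symm]
    exact h _ (hF hZ) _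
  · have (i : ι) : IsIso ((G i).map f) := (hP i).isIso_of_mono _ fun Z hZ x ↦ by
      obtain ⟨y, hy⟩ := h _ (hF hZ) (((adj i).homEquiv _ _).symm x)
      exact ⟨(adj i).homEquiv _ _ y, ((adj i).homEquiv_naturality_right y f).symm.trans
        ((Equiv.eq_symm_apply _).1 hy)⟩
    exact hG.isIso f

theorem isLocallyPresentable_of_adjunctions [Small.{w} ι] [HasColimitsOfSize.{w, w} C]
    [∀ i, PreservesColimitsOfSize.{w, w} (G i)] [∀ i, IsLocallyPresentable.{w} (D i)] :
    IsLocallyPresentable.{w} C := by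
  choose κ hκ hκ' using fun i ↦ IsLocallyPresentable.exists_cardinal.{w} (D i)
  obtain ⟨κ₀, hκ₀, hle⟩ := exists_isRegular_forall_le κ
  have : Fact κ₀.IsRegular := ⟨hκ₀⟩
  have (i : ι) : IsCardinalLocallyPresentable (D i) κ₀ := .of_le (D i) (hle i)
  choose P _ hP hPκ using fun i ↦
    (IsCardinalLocallyPresentable.iff_exists_isStrongGenerator (D i) κ₀).1 inferInstance
  refine ⟨κ₀, inferInstance, (IsCardinalLocallyPresentable.iff_exists_isStrongGenerator C κ₀).2
    ⟨⨆ i, (P i).strictMap (F i), inferInstance, isStrongGenerator_iSup_strictMap adj hG hP, ?_⟩⟩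
  rw [iSup_le_iff]
  rintro i _ ⟨Z, hZ⟩
  have : IsCardinalPresentable Z κ₀ := (isCardinalPresentable_iff ..).1 (hPκ i _ hZ)
  exact (isCardinalPresentable_iff ..).2 ((adj i).isCardinalPresentable_leftAdjoint_obj κ₀ Z)

end LocallyPresentable

section Lifting

variable {C : Type u} [Category.{w} C] {D : Type v} [Category.{w} D]

lemma isSmall_strictMap (S : MorphismProperty D) [MorphismProperty.IsSmall.{w} S] (F : D ⥤ C) :
    MorphismProperty.IsSmall.{w} (S.strictMap F) := by
  obtain ⟨ι, A, B, f, rfl⟩ := (MorphismProperty.isSmall_iff_eq_ofHoms.{w} S).1 inferInstance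
  rw [MorphismProperty.isSmall_iff_eq_ofHoms]
  refine ⟨ι, _, _, fun i ↦ F.map (f i), le_antisymm ?_ ?_⟩
  · rintro _ _ _ ⟨⟨i⟩⟩
    exact ⟨i⟩
  · rintro _ _ _ ⟨i⟩
    exact ⟨⟨i⟩⟩

lemma llp_rlp_le_inverseImage_llp (S : MorphismProperty C)
    [MorphismProperty.HasSmallObjectArgument.{w} S] (G : C ⥤ D)
    [PreservesColimitsOfSize.{w, w} G] (P : MorphismProperty D)
    (h : S ≤ P.llp.inverseImage G) : S.rlp.llp ≤ P.llp.inverseImage G := by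
  have : (P.llp.inverseImage G).IsStableUnderCobaseChange :=
    ⟨fun sq hf ↦ MorphismProperty.of_isPushout (P := P.llp) (sq.map G) hf⟩
  have : MorphismProperty.IsStableUnderCoproducts.{w} (P.llp.inverseImage G) :=
    ⟨fun _ ↦ ⟨fun X₁ X₂ c₁ c₂ hc₁ hc₂ f hf φ hφ ↦
      MorphismProperty.colimitsOfShape_le (W := P.llp) _ (MorphismProperty.colimitsOfShape.mk'
        (X₁ ⋙ G) (X₂ ⋙ G) (G.mapCocone c₁) (G.mapCocone c₂) (isColimitOfPreserves G hc₁)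
        (isColimitOfPreserves G hc₂) (Functor.whiskerRight f G) hf (G.map φ) fun k ↦ by
          rw [G.mapCocone_ι_app, ← G.map_comp, hφ, G.map_comp]
          rfl)⟩⟩
  have : MorphismProperty.IsStableUnderTransfiniteComposition.{w} (P.llp.inverseImage G) :=
    ⟨fun K _ _ _ _ ↦ ⟨fun _ _ f hf ↦
      have : PreservesWellOrderContinuousOfShape K G := ⟨fun _ _ ↦ inferInstance⟩
      MorphismProperty.transfiniteCompositionsOfShape_le P.llp K _
        (MorphismProperty.transfiniteCompositionsOfShape_map_of_preserves K G f hf)⟩⟩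
  rw [MorphismProperty.llp_rlp_of_hasSmallObjectArgument.{w}]
  refine (MorphismProperty.retracts_monotone ?_).trans (MorphismProperty.retracts_le _)
  rwa [MorphismProperty.transfiniteCompositions_le_iff, MorphismProperty.pushouts_le_iff,
    MorphismProperty.coproducts_le_iff]

end Lifting

section Recognition

variable {C : Type u} [Category.{v} C]

lemma hasTwoOutOfThreeProperty_iInf {ι : Type v'} (W : ι → MorphismProperty C)
    [∀ i, (W i).HasTwoOutOfThreeProperty] : (⨅ i, W i).HasTwoOutOfThreeProperty where
  toIsStableUnderComposition := inferInstance
  of_postcomp f g hg hfg := by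
    simp only [MorphismProperty.iInf_iff] at hg hfg ⊢
    exact fun i ↦ (W i).of_postcomp f g (hg i) (hfg i)
  of_precomp f g hf hfg := by
    simp only [MorphismProperty.iInf_iff] at hf hfg ⊢
    exact fun i ↦ (W i).of_precomp f g (hf i) (hfg i)

variable {W S T : MorphismProperty C} [hW : W.HasTwoOutOfThreeProperty]
  [MorphismProperty.HasFactorization T.rlp.llp T.rlp]

lemma llp_rlp_inf_eq_of_le (hS : S.rlp = T.rlp ⊓ W) (hT : T.rlp.llp ≤ W) :
    S.rlp.llp ⊓ W = T.rlp.llp := by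
  refine le_antisymm (fun X Y f ⟨hf, hfW⟩ ↦ ?_)
    (le_inf (MorphismProperty.antitone_llp (hS ▸ inf_le_left)) hT)
  -- The retract argument, applied to `f = h.i ≫ h.p`.
  let h := MorphismProperty.factorizationData T.rlp.llp T.rlp f
  have hp : S.rlp h.p := hS ▸ ⟨h.hp, W.of_precomp h.i h.p (hT _ h.hi) (h.fac.symm ▸ hfW)⟩
  have := hf _ hp
  exact MorphismProperty.of_retract (RetractArrow.ofLeftLiftingProperty h.fac) h.hi

theorem exists_modelCategory_of_rlp_eq [HasFiniteLimits C] [HasFiniteColimits C]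
    [MorphismProperty.HasFactorization S.rlp.llp S.rlp]
    (hS : S.rlp = T.rlp ⊓ W) (hT : T.rlp.llp ≤ W) :
    ∃ _ : ModelCategory C, weakEquivalences C = W ∧ fibrations C = T.rlp := by
  let _ : CategoryWithWeakEquivalences C := ⟨W⟩
  let _ : CategoryWithFibrations C := ⟨T.rlp⟩
  let _ : CategoryWithCofibrations C := ⟨S.rlp.llp⟩
  have hSfac : MorphismProperty.IsWeakFactorizationSystem S.rlp.llp S.rlp :=
    { rlp := S.rlp_llp_rlp
      llp := rfl }
  have hTfac : MorphismProperty.IsWeakFactorizationSystem T.rlp.llp T.rlp :=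
    { rlp := T.rlp_llp_rlp
      llp := rfl }
  have hcof : trivialCofibrations C = T.rlp.llp := llp_rlp_inf_eq_of_le (W := W) hS hT
  have hfib : trivialFibrations C = S.rlp := hS.symm
  have : MorphismProperty.IsWeakFactorizationSystem (cofibrations C) (trivialFibrations C) :=
    hfib ▸ hSfac
  have : MorphismProperty.IsWeakFactorizationSystem (trivialCofibrations C) (fibrations C) :=
    hcof ▸ hTfac
  have : (weakEquivalences C).HasTwoOutOfThreeProperty := hW
  exact ⟨ModelCategory.mk' C, rfl, rfl⟩

end Recognition

section Transfer

variable {C : Type u} [Category.{w} C] {ι : Type w} {D : ι → Type v} [∀ i, Category.{w} (D i)]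
  {F : ∀ i, D i ⥤ C} {G : ∀ i, C ⥤ D i} (adj : ∀ i, F i ⊣ G i)

include adj in
lemma rlp_iSup_strictMap (S : ∀ i, MorphismProperty (D i)) :
    (⨆ i, (S i).strictMap (F i)).rlp = ⨅ i, (S i).rlp.inverseImage (G i) := by
  ext X Y p
  simp only [MorphismProperty.iInf_iff, MorphismProperty.inverseImage_iff]
  refine ⟨fun h i A B f hf ↦ ((adj i).hasLiftingProperty_iff f p).1 (h _ ?_),
    fun h A B f hf ↦ ?_⟩
  · rw [MorphismProperty.iSup_iff]
    exact ⟨i, ⟨hf⟩⟩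
  · rw [MorphismProperty.iSup_iff] at hf
    obtain ⟨i, ⟨hf⟩⟩ := hf
    exact ((adj i).hasLiftingProperty_iff _ p).2 (h i _ hf)

variable [∀ i, ModelCategory (D i)]

lemma iInf_inverseImage_trivialFibrations :
    ⨅ i, (trivialFibrations (D i)).inverseImage (G i) =
      (⨅ i, (fibrations (D i)).inverseImage (G i)) ⊓
        ⨅ i, (weakEquivalences (D i)).inverseImage (G i) :=
  iInf_inf_eq

lemma llp_rlp_iSup_strictMap_le {T : ∀ i, MorphismProperty (D i)}
    [MorphismProperty.HasSmallObjectArgument.{w} (⨆ i, (T i).strictMap (F i))]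
    [∀ i, PreservesColimitsOfSize.{w, w} (G i)] (hT : ∀ i, fibrations (D i) = (T i).rlp)
    (hF : ∀ (i i' : ι) {X Y : D i} (f : X ⟶ Y), trivialCofibrations (D i) f →
      trivialCofibrations (D i') ((G i').map ((F i).map f))) :
    (⨆ i, (T i).strictMap (F i)).rlp.llp ≤ ⨅ i, (weakEquivalences (D i)).inverseImage (G i) := by
  refine le_iInf fun i' ↦ (llp_rlp_le_inverseImage_llp _ (G i') (fibrations (D i')) ?_).trans ?_
  · simp only [iSup_le_iff, MorphismProperty.strictMap_le_iff_le_inverseImage, fibrations_llp]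
    refine fun i A B f hf ↦ hF i i' f ?_
    rw [← fibrations_llp, hT i]
    exact MorphismProperty.le_llp_rlp _ _ hf
  · rw [fibrations_llp]
    exact fun X Y f hf ↦ hf.2

include adj

theorem exists_modelCategory_of_adjunctions [IsLocallyPresentable.{w} C] [HasFiniteLimits C]
    [∀ i, PreservesColimitsOfSize.{w, w} (G i)] (hD : ∀ i, IsCombinatorial (D i))
    (hF : ∀ (i i' : ι) {X Y : D i} (f : X ⟶ Y), trivialCofibrations (D i) f →
      trivialCofibrations (D i') ((G i').map ((F i).map f))) :
    ∃ _ : ModelCategory C,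
      weakEquivalences C = ⨅ i, (weakEquivalences (D i)).inverseImage (G i) ∧
      fibrations C = ⨅ i, (fibrations (D i)).inverseImage (G i) := by
  have := hasColimitsOfSize_of_isLocallyPresentable (C := C)
  choose S _ hS using fun i ↦ (hD i).exists_generating_cofibrations
  choose T _ hT using fun i ↦ (hD i).exists_generating_trivialCofibrations
  have (i : ι) := isSmall_strictMap (S i) (F i)
  have (i : ι) := isSmall_strictMap (T i) (F i)
  have := hasSmallObjectArgument_of_isLocallyPresentable (⨆ i, (S i).strictMap (F i))
  have := hasSmallObjectArgument_of_isLocallyPresentable (⨆ i, (T i).strictMap (F i))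
  have := hasTwoOutOfThreeProperty_iInf fun i ↦ (weakEquivalences (D i)).inverseImage (G i)
  have hfib : (⨆ i, (T i).strictMap (F i)).rlp = ⨅ i, (fibrations (D i)).inverseImage (G i) := by
    simp only [rlp_iSup_strictMap adj, hT]
  rw [← hfib]
  refine exists_modelCategory_of_rlp_eq (S := ⨆ i, (S i).strictMap (F i)) ?_
    (llp_rlp_iSup_strictMap_le hT hF)
  simp only [hfib, rlp_iSup_strictMap adj, ← hS, iInf_inverseImage_trivialFibrations]

variable [ModelCategory C] {S : ∀ i, MorphismProperty (D i)}

lemma fibrations_eq_rlp_of_adjunctions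
    (hfib : fibrations C = ⨅ i, (fibrations (D i)).inverseImage (G i))
    (hS : ∀ i, fibrations (D i) = (S i).rlp) :
    fibrations C = (⨆ i, (S i).strictMap (F i)).rlp := by
  simp only [hfib, rlp_iSup_strictMap adj, hS]

variable (hW : weakEquivalences C = ⨅ i, (weakEquivalences (D i)).inverseImage (G i))
  (hfib : fibrations C = ⨅ i, (fibrations (D i)).inverseImage (G i))
include hW hfib

lemma trivialFibrations_eq_rlp_of_adjunctions (hS : ∀ i, trivialFibrations (D i) = (S i).rlp) :
    trivialFibrations C = (⨆ i, (S i).strictMap (F i)).rlp := by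
  rw [rlp_iSup_strictMap adj, trivialFibrations, hW, hfib, ← iInf_inverseImage_trivialFibrations]
  simp only [hS]

lemma isCombinatorial_of_adjunctions [IsLocallyPresentable.{w} C]
    (hD : ∀ i, IsCombinatorial (D i)) : IsCombinatorial C where
  isLocallyPresentable := inferInstance
  exists_generating_cofibrations := by
    choose S _ hS using fun i ↦ (hD i).exists_generating_cofibrations
    have (i : ι) := isSmall_strictMap (S i) (F i)
    exact ⟨_, inferInstance, trivialFibrations_eq_rlp_of_adjunctions adj hW hfib hS⟩
  exists_generating_trivialCofibrations := by
    choose T _ hT using fun i ↦ (hD i).exists_generating_trivialCofibrations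
    have (i : ι) := isSmall_strictMap (T i) (F i)
    exact ⟨_, inferInstance, fibrations_eq_rlp_of_adjunctions adj hfib hT⟩

end Transfer

namespace SimplicialSection

variable {I : Type u₁} [Category.{w} I] {J : Type w} [EnrichedCategory SSet.{w} J]
  (φ : EnrichedFunctor SSet.{w} J (Disc I)) (M : SimplicialQuillenPresheaf.{w, u} I)

lemma levelwiseWeakEquivalences_eq_iInf :
    levelwiseWeakEquivalences φ M = ⨅ j, (weakEquivalences _).inverseImage (ev φ M j) := by
  ext s t T
  rw [MorphismProperty.iInf_iff]
  rfl

lemma levelwiseFibrations_eq_iInf :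
    levelwiseFibrations φ M = ⨅ j, (fibrations _).inverseImage (ev φ M j) := by
  ext s t T
  rw [MorphismProperty.iInf_iff]
  rfl

end SimplicialSection

end SimplicialSections

theorem propositionp {I : Type u₁} [Category.{w} I] {J : Type w} [EnrichedCategory SSet.{w} J]
    (φ : EnrichedFunctor SSet.{w} J (Disc I))
    (M : SimplicialQuillenPresheaf.{w, u} I)
    (hM : ∀ i, IsCombinatorial (M.obj i)) :
    ∃ (_ : ModelCategory (SimplicialSection φ M)),
      IsCombinatorial (SimplicialSection φ M) ∧
      IsSimplicialModelCategory (SimplicialSection φ M) ∧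
      weakEquivalences (SimplicialSection φ M) =
        SimplicialSection.levelwiseWeakEquivalences φ M ∧
      fibrations (SimplicialSection φ M) =
        SimplicialSection.levelwiseFibrations φ M ∧
      cofibrations (SimplicialSection φ M) =
        (SimplicialSection.levelwiseFibrations φ M ⊓
          SimplicialSection.levelwiseWeakEquivalences φ M).llp ∧
      ∃ (F : ∀ j : J, M.obj (φ.obj j).as ⥤ SimplicialSection φ M)
        (adj : ∀ j : J, F j ⊣ SimplicialSection.ev φ M j),
        (∀ (j : J) (X : M.obj (φ.obj j).as),
          SimplicialSection.IsFreeSection ((adj j).unit.app X)) ∧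
        (∀ S : ∀ j : J, MorphismProperty (M.obj (φ.obj j).as),
          (∀ j, trivialFibrations (M.obj (φ.obj j).as) = (S j).rlp) →
            trivialFibrations (SimplicialSection φ M) =
              (⨆ j, (S j).strictMap (F j)).rlp) ∧
        (∀ S : ∀ j : J, MorphismProperty (M.obj (φ.obj j).as),
          (∀ j, fibrations (M.obj (φ.obj j).as) = (S j).rlp) →
            fibrations (SimplicialSection φ M) =
              (⨆ j, (S j).strictMap (F j)).rlp) := by
  have (i : I) : IsLocallyPresentable.{w} (M.obj i) := (hM i).isLocallyPresentable
  have (i : I) : HasColimitsOfSize.{w, w} (M.obj i) := hasColimitsOfSize_of_isLocallyPresentable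
  choose F adj hadj using SimplicialSection.exists_evAdjunction φ M
  have : IsLocallyPresentable.{w} (SimplicialSection φ M) :=
    isLocallyPresentable_of_adjunctions adj (SimplicialSection.jointlyReflectIsomorphisms_ev φ M)
  obtain ⟨_, hW, hfib⟩ := exists_modelCategory_of_adjunctions adj (fun j ↦ hM (φ.obj j).as)
    fun j k _ _ f hf ↦ SimplicialSection.trivialCofibrations_app_of_isColimit_ofHom
      (hadj j _) (hadj j _) hf ((adj j).unit.naturality f).symm k
  have hW' := hW.trans (SimplicialSection.levelwiseWeakEquivalences_eq_iInf φ M).symm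
  have hfib' := hfib.trans (SimplicialSection.levelwiseFibrations_eq_iInf φ M).symm
  refine ⟨inferInstance, isCombinatorial_of_adjunctions adj hW hfib fun j ↦ hM (φ.obj j).as,
    SimplicialSection.isSimplicialModelCategory_of_levelwise hW' hfib', hW', hfib', ?_, F, adj,
    fun j X ↦ SimplicialSection.isFreeSection_of_isColimit_ofHom (hadj j X),
    fun S hS ↦ trivialFibrations_eq_rlp_of_adjunctions adj hW hfib hS,
    fun S hS ↦ fibrations_eq_rlp_of_adjunctions adj hfib hS⟩
  rw [← hW', ← hfib']
  exact (MorphismProperty.llp_eq_of_wfs (cofibrations _) (trivialFibrations _)).symm
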